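/- **Notation.** Let $f:\mathbb{C}\to\mathbb{P}^n(\mathbb{C})$ be an entire holomorphic curve which is linearly nondegenerate, i.e. whose image is contained in no hyperplane, let $0\le k\le n$, and let $\widetilde f=(f_0,\dots,f_n):\mathbb{C}\to\mathbb{C}^{n+1}\setminus\{0\}$ be a reduced representation of $f$ (a global holomorphic lift without zeros). Put $\widetilde F_k=\widetilde f\wedge\widetilde f'\wedge\dots\wedge\widetilde f^{(k)}:\mathbb{C}\to\Lambda^{k+1}(\mathbb{C}^{n+1})$; its coordinates in the standard basis $(e_{i_0}\wedge\dots\wedge e_{i_k})_{i_0<\dots<i_k}$ are the Wronskians $W(f_{i_0},\dots,f_{i_k})$. Let $g$ be an entire function whose zero divisor is the minimum of the zero divisors of these Wronskians. Then $\overline F_k=\widetilde F_k/g$ is holomorphic without zeros, and it is a reduced representation of the *$k$-th derived curve* $F_k:\mathbb{C}\to\mathbb{P}(\Lambda^{k+1}(\mathbb{C}^{n+1}))$ of $f$. Its order function is $$T_{F_k}(r)=\frac1{2\pi}\int_0^{2\pi}\log\|\overline F_k(re^{i\theta})\|_{\max}\,d\theta ,$$ where $\|\cdot\|_{\max}$ is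 the maximum of the absolute values of the coordinates in the standard basis; a different choice of reduced representation of $F_k$ changes $T_{F_k}$ only by a constant, and the theorem holds for every choice. A *decomposable hyperplane* $A\subset\mathbb{P}(\Lambda^{k+1}(\mathbb{C}^{n+1}))$ is the hyperplane $\{[Z]: A^*(Z)=0\}$ given by a nonzero decomposable covector $A^*=a_0\wedge\dots\wedge a_k\in\Lambda^{k+1}(\mathbb{C}^{n+1})^\vee\cong(\Lambda^{k+1}\mathbb{C}^{n+1})^\vee$. For $m\in\mathbb{N}$ and $r>1$ put $$N^{[m]}_{F_k}(r,A)=\int_1^r\Big(\sum_{|a|<t}\min\{m,\operatorname{ord}_a(A^*\circ\overline F_k)\}\Big)\frac{dt}{t}.$$ A function $S_{F_k}(r)$ is an *admissible error term* if there is a constant $C$ such that for every $\varepsilon>0$ one has $S_{F_k}(r)\le C\log T_{F_k}(r)+\varepsilon\log r$ for all $r>0$ outside a set (depending on $\varepsilon$) of finite Lebesgue measure, and if moreover $S_{F_k}(r)=O(1)$ for $r>1$ when $F_k$ is rational (i.e. given by polynomials in homogeneous coordinates). **Main Theorem.** Let $f:\mathbb{C}\to\mathbb{P}^n(\mathbb{C})$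 be a linearly nondegenerate entire curve, let $0\le k\le n$, put $\mathfrak n=\dim\Lambda^{k+1}(\mathbb{C}^{n+1})=\binom{n+1}{k+1}$, and let $\mathfrak N\ge\mathfrak n$ be an integer. Let $A_1,\dots,A_q\subset\mathbb{P}(\Lambda^{k+1}(\mathbb{C}^{n+1}))$ be decomposable hyperplanes such that any $\mathfrak N$ of them (with distinct indices) have empty intersection. Then there is an admissible error term $S_{F_k}$ such that, for all $r>1$, $$(q-2\mathfrak N+\mathfrak n)\,T_{F_k}(r)\le\sum_{i=1}^qN^{[(k+1)(n-k)]}_{F_k}(r,A_i)+S_{F_k}(r).$$ -/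

import Mathlib

open scoped LinearAlgebra.Projectivization

noncomputable section

namespace DerivedCurves

/-! ### Holomorphic curves in projective spaces -/

section Curves

variable {V : Type*} [AddCommGroup V] [Module ℂ V]

/-- The hyperplane `{[v] : φ v = 0}` of `ℙ(V)` cut out by a linear form `φ`. -/
def hyperplane (φ : Module.Dual ℂ V) : Set (ℙ ℂ V) :=
  {p | ∀ v ∈ p.submodule, φ v = 0}

/-- A map `ℂ → ℙ(V)`, with `V` of finite dimension, is an entire (holomorphic) curve if locally
it lifts to a holomorphic map into `V ∖ {0}`. Holomorphy of a map into `V` means that all its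
compositions with linear forms (equivalently, all its coordinates in a basis) are holomorphic. -/
def IsEntireCurve (f : ℂ → ℙ ℂ V) : Prop :=
  ∀ z₀ : ℂ, ∃ U : Set ℂ, IsOpen U ∧ z₀ ∈ U ∧ ∃ G : ℂ → V,
    (∀ φ : Module.Dual ℂ V, DifferentiableOn ℂ (fun z => φ (G z)) U) ∧
      ∀ z ∈ U, ∃ h : G z ≠ 0, f z = Projectivization.mk ℂ (G z) h

/-- `G` is a reduced representation of `f`: a global holomorphic lift `ℂ → V ∖ {0}` of `f`. -/
structure IsReducedRepresentation (f : ℂ → ℙ ℂ V) (G : ℂ → V) : Prop where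
  holomorphic : ∀ φ : Module.Dual ℂ V, Differentiable ℂ (fun z => φ (G z))
  ne_zero : ∀ z, G z ≠ 0
  eq_mk : ∀ z, f z = Projectivization.mk ℂ (G z) (ne_zero z)

/-- The image of `f` is contained in no hyperplane. -/
def IsLinearlyNondegenerate (f : ℂ → ℙ ℂ V) : Prop :=
  ∀ φ : Module.Dual ℂ V, φ ≠ 0 → ¬ Set.range f ⊆ hyperplane φ

/-- `f` is rational: it is given by a polynomial lift `z ↦ ∑ zʲ vⱼ` without zeros. -/
def IsRationalCurve (f : ℂ → ℙ ℂ V) : Prop :=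
  ∃ (d : ℕ) (v : ℕ → V), ∀ z : ℂ, ∃ h : ∑ j ∈ Finset.range (d + 1), z ^ j • v j ≠ 0,
    f z = Projectivization.mk ℂ (∑ j ∈ Finset.range (d + 1), z ^ j • v j) h

/-- The maximum of the absolute values of the coordinates of `v` in a (finite) basis `b`. -/
def maxNorm {ι : Type*} (b : Module.Basis ι ℂ V) (v : V) : ℝ :=
  ⨆ i, ‖b.repr v i‖

/-- The Cartan order function, computed from a reduced representation `G` of the curve and
the coordinates in the basis `b`. -/
def orderFunction {ι : Type*} (b : Module.Basis ι ℂ V) (G : ℂ → V) (r : ℝ) : ℝ :=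
  Real.circleAverage (fun z => Real.log (maxNorm b (G z))) 0 r

/-- `S` is an admissible error term `S_F(r)` for the curve `F` with order function `T`:
for every `ε > 0` one has `S r ≤ O(log (T r)) + ε log r` outside a set of finite measure,
and `S` is bounded if `F` is rational. -/
structure IsErrorTerm (F : ℂ → ℙ ℂ V) (T : ℝ → ℝ) (S : ℝ → ℝ) : Prop where
  bound : ∃ C : ℝ, ∀ ε : ℝ, 0 < ε → ∃ E : Set ℝ, MeasureTheory.volume E < ⊤ ∧
    ∀ r : ℝ, 0 < r → r ∉ E → S r ≤ C * Real.log (T r) + ε * Real.log r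
  rational : IsRationalCurve F → ∃ C : ℝ, ∀ r : ℝ, 1 < r → |S r| ≤ C

end Curves

/-! ### Counting functions -/

/-- The zero divisor `(h)₀` of an entire function `h ≢ 0`, as a multiplicity function. -/
def zeroDivisor (h : ℂ → ℂ) (a : ℂ) : ℕ :=
  analyticOrderNatAt h a

/-- The degree on the disk `|z| < r` of the divisor `E` truncated at level `m`. -/
def truncatedDegree (m : ℕ) (E : ℂ → ℕ) (r : ℝ) : ℕ :=
  ∑ᶠ a ∈ Metric.ball (0 : ℂ) r, min m (E a)

/-- The counting function `N^{[m]}(r, E)` of the divisor `E` truncated at level `m`. -/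
def truncatedCounting (m : ℕ) (E : ℂ → ℕ) (r : ℝ) : ℝ :=
  ∫ t in (1 : ℝ)..r, (truncatedDegree m E t : ℝ) / t

/-! ### Derived curves and decomposable hyperplanes -/

/-- The standard basis `e_{i₀} ∧ ⋯ ∧ e_{iₖ}`, `i₀ < ⋯ < iₖ`, of `Λ^{k+1}(ℂ^{n+1})`. -/
def pluckerBasis (n k : ℕ) : Module.Basis (Set.powersetCard (Fin (n + 1)) (k + 1)) ℂ
    (⋀[ℂ]^(k + 1) (Fin (n + 1) → ℂ)) :=
  (Pi.basisFun ℂ (Fin (n + 1))).exteriorPower (k + 1)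

/-- The map `G ∧ G' ∧ ⋯ ∧ G^{(k)} : ℂ → Λ^{k+1}(ℂ^{n+1})`. Its coordinates in `pluckerBasis n k`
are the Wronskians `W(G_{i₀}, …, G_{iₖ})`. -/
def wedgeDerivatives {n : ℕ} (k : ℕ) (G : ℂ → Fin (n + 1) → ℂ) (z : ℂ) :
    ⋀[ℂ]^(k + 1) (Fin (n + 1) → ℂ) :=
  exteriorPower.ιMulti ℂ (k + 1) (fun l : Fin (k + 1) => iteratedDeriv (l : ℕ) G z)

/-- `F` is the `k`-th derived curve of `f`: for a reduced representation `G` of `f` and an entire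
function `g` whose zero divisor is the minimum of the zero divisors of the Wronskians
`W(G_{i₀}, …, G_{iₖ})`, the quotient `(G ∧ G' ∧ ⋯ ∧ G^{(k)}) / g` is a reduced representation
of `F`. -/
def IsDerivedCurve {n : ℕ} (k : ℕ) (f : ℂ → ℙ ℂ (Fin (n + 1) → ℂ))
    (F : ℂ → ℙ ℂ (⋀[ℂ]^(k + 1) (Fin (n + 1) → ℂ))) : Prop :=
  ∃ G : ℂ → Fin (n + 1) → ℂ, IsReducedRepresentation f G ∧
  ∃ g : ℂ → ℂ, Differentiable ℂ g ∧
    (∀ a : ℂ, analyticOrderAt g a =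
      ⨅ I, analyticOrderAt (fun z => (pluckerBasis n k).repr (wedgeDerivatives k G z) I) a) ∧
  ∃ Fbar : ℂ → ⋀[ℂ]^(k + 1) (Fin (n + 1) → ℂ), IsReducedRepresentation F Fbar ∧
    ∀ z, wedgeDerivatives k G z = g z • Fbar z

/-- A decomposable hyperplane of `ℙ(Λ^{k+1}(ℂ^{n+1}))`, given by a nonzero decomposable
`(k+1)`-covector `A* = a₀ ∧ ⋯ ∧ aₖ`. -/
structure DecomposableHyperplane (n k : ℕ) where
  /-- The covectors `a₀, …, aₖ`. -/
  covector : Fin (k + 1) → Module.Dual ℂ (Fin (n + 1) → ℂ)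
  ne_zero : exteriorPower.ιMulti ℂ (k + 1) covector ≠ 0

namespace DecomposableHyperplane

variable {n k : ℕ}

/-- The covector `A* = a₀ ∧ ⋯ ∧ aₖ`, as a linear form on `Λ^{k+1}(ℂ^{n+1})`. -/
def form (A : DecomposableHyperplane n k) :
    Module.Dual ℂ (⋀[ℂ]^(k + 1) (Fin (n + 1) → ℂ)) :=
  exteriorPower.pairingDual ℂ (Fin (n + 1) → ℂ) (k + 1)
    (exteriorPower.ιMulti ℂ (k + 1) A.covector)

/-- The set of points of the decomposable hyperplane. -/
def carrier (A : DecomposableHyperplane n k) :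
    Set (ℙ ℂ (⋀[ℂ]^(k + 1) (Fin (n + 1) → ℂ))) :=
  hyperplane A.form

/-- The truncated counting function `N^{[m]}(r, (A* ∘ Fbar)₀)` of the curve with reduced
representation `Fbar`. -/
def counting (A : DecomposableHyperplane n k) (m : ℕ)
    (Fbar : ℂ → ⋀[ℂ]^(k + 1) (Fin (n + 1) → ℂ)) (r : ℝ) : ℝ :=
  truncatedCounting m (zeroDivisor (fun z => A.form (Fbar z))) r

end DecomposableHyperplane

end DerivedCurves

end

noncomputable section

namespace DerivedCurves

open Real Filter MeasureTheory Set Topology Metric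

/-! ### A growth lemma of Borel type -/

theorem volume_borel_exceptional_lt_top {T : ℝ → ℝ} (hT : MonotoneOn T (Ici 1))
    (h2 : ∀ r, 1 ≤ r → 2 ≤ T r) :
    volume {r | 1 ≤ r ∧ 2 * T r < T (r + 1 / T r)} < ⊤ := by
  set E : ℕ → Set ℝ := fun j =>
    {r | (1 ≤ r ∧ 2 * T r < T (r + 1 / T r)) ∧ (2 : ℝ) ^ j ≤ T r ∧ T r < 2 ^ (j + 1)} with hE
  have hcover : {r | 1 ≤ r ∧ 2 * T r < T (r + 1 / T r)} ⊆ ⋃ j, E j := by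
    intro r hr
    obtain ⟨j, hj⟩ := exists_nat_pow_near (show (1 : ℝ) ≤ T r by linarith [h2 r hr.1])
      (by norm_num : (1 : ℝ) < 2)
    exact mem_iUnion.2 ⟨j, hr, hj⟩
  have hclose : ∀ j, ∀ x ∈ E j, ∀ y ∈ E j, x ≤ y → y - x ≤ 1 / 2 ^ j := by
    intro j x hx y hy hxy
    by_contra hcon
    have hTx : 0 < T x := by linarith [h2 x hx.1.1]
    have h1 : 1 / T x ≤ 1 / 2 ^ j := one_div_le_one_div_of_le (by positivity) hx.2.1
    have h3 : T (x + 1 / T x) ≤ T y := hT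
      (show 1 ≤ x + 1 / T x by have := hx.1.1; have : 0 < 1 / T x := by positivity
                               linarith) hy.1.1 (by linarith)
    have h4 : (2 : ℝ) ^ (j + 1) = 2 * 2 ^ j := by ring
    linarith [hx.1.2, hy.2.2, hx.2.1]
  have hvol : ∀ j, volume (E j) ≤ (2⁻¹ : ENNReal) ^ j := by
    intro j
    refine (Real.volume_le_diam _).trans (ediam_le fun x hx y hy => ?_)
    have habs : dist x y ≤ 1 / 2 ^ j := by
      rw [Real.dist_eq, abs_le]
      rcases le_total x y with h | h
      · have := hclose j x hx y hy h
        constructor <;> [linarith; linarith [show (0 : ℝ) < 1 / 2 ^ j by positivity]]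
      · have := hclose j y hy x hx h
        constructor <;> [linarith [show (0 : ℝ) < 1 / 2 ^ j by positivity]; linarith]
    rw [edist_dist]
    refine (ENNReal.ofReal_le_ofReal habs).trans ?_
    rw [one_div, ENNReal.ofReal_inv_of_pos (by positivity), ENNReal.ofReal_pow (by norm_num),
      ENNReal.inv_pow]
    simp
  calc volume _ ≤ volume (⋃ j, E j) := measure_mono hcover
    _ ≤ ∑' j, volume (E j) := measure_iUnion_le _
    _ ≤ ∑' j, (2⁻¹ : ENNReal) ^ j := ENNReal.tsum_le_tsum hvol
    _ < ⊤ := by rw [ENNReal.tsum_geometric, ENNReal.one_sub_inv_two, inv_inv]; simp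

/-! ### Circle averages -/

theorem circleAverage_mono_of_codiscrete {f g : ℂ → ℝ} {r : ℝ} (hr : r ≠ 0)
    (hf : CircleIntegrable f 0 r) (hg : CircleIntegrable g 0 r)
    (h : ∀ᶠ z in codiscreteWithin (sphere (0 : ℂ) |r|), f z ≤ g z) :
    circleAverage f 0 r ≤ circleAverage g 0 r := by
  have h1 : f =ᶠ[codiscreteWithin (sphere (0 : ℂ) |r|)] fun z => min (f z) (g z) := by
    filter_upwards [h] with z hz
    rw [min_eq_left hz]
  rw [circleAverage_congr_codiscreteWithin h1 hr]
  exact circleAverage_mono (hf.congr_codiscreteWithin h1) hg fun z _ => min_le_right _ _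

theorem intervalIntegrable_abs_sin_rpow_neg {α : ℝ} (hα : 0 < α) (hα1 : α < 1) (a b : ℝ) :
    IntervalIntegrable (fun θ => |sin θ| ^ (-α)) volume a b := by
  have h0 : IntervalIntegrable (fun θ => |sin θ| ^ (-α)) volume 0 (π / 2) := by
    have h1 : IntervalIntegrable (fun θ : ℝ => (2 / π) ^ (-α) * θ ^ (-α)) volume 0 (π / 2) :=
      (intervalIntegral.intervalIntegrable_rpow' (by linarith)).const_mul _
    refine h1.mono_fun (Measurable.aestronglyMeasurable (by fun_prop)) ?_
    rw [Filter.EventuallyLE, ae_restrict_iff' measurableSet_uIoc]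
    refine Eventually.of_forall fun θ hθ => ?_
    rw [uIoc_of_le (by positivity)] at hθ
    have hs : 2 / π * θ ≤ sin θ := mul_le_sin hθ.1.le hθ.2
    have hp : 0 < 2 / π * θ := mul_pos (by positivity) hθ.1
    rw [← Real.mul_rpow (by positivity) hθ.1.le, Real.norm_of_nonneg (by positivity),
      Real.norm_of_nonneg (by positivity), abs_of_nonneg (hp.le.trans hs)]
    exact rpow_le_rpow_of_nonpos hp hs (by linarith)
  have h2 : IntervalIntegrable (fun θ => |sin θ| ^ (-α)) volume (-(π / 2)) 0 := by
    rw [IntervalIntegrable.iff_comp_neg]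
    simpa using h0.symm
  have hper : Function.Periodic (fun θ => |sin θ| ^ (-α)) π := fun θ => by simp
  refine hper.intervalIntegrable pi_ne_zero (t := -(π / 2)) ?_ a b
  rw [show -(π / 2) + π = π / 2 by ring]
  exact h2.trans h0

theorem exists_circleAverage_norm_sub_rpow_neg_le {α : ℝ} (hα : 0 < α) (hα1 : α < 1) :
    ∃ K : ℝ, 0 ≤ K ∧ ∀ r : ℝ, 0 < r → ∀ u : ℂ,
      CircleIntegrable (fun z => ‖z - u‖ ^ (-α)) 0 r ∧
      circleAverage (fun z => ‖z - u‖ ^ (-α)) 0 r ≤ K * r ^ (-α) := by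
  refine ⟨(2 * π)⁻¹ * ∫ θ in 0..2 * π, |sin θ| ^ (-α), ?_, fun r hr u => ?_⟩
  · exact mul_nonneg (by positivity)
      (intervalIntegral.integral_nonneg (by positivity) fun _ _ => by positivity)
  have hlow : ∀ θ : ℝ, r * |sin (θ - u.arg)| ≤ ‖circleMap 0 r θ - u‖ := by
    intro θ
    have h1 : circleMap 0 r θ - u =
        Complex.exp (u.arg * Complex.I) * (r * Complex.exp ((θ - u.arg : ℝ) * Complex.I) - ‖u‖) := by
      rw [mul_sub, mul_left_comm, ← Complex.exp_add]
      conv_lhs => rw [← Complex.norm_mul_exp_arg_mul_I u]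
      simp only [circleMap, zero_add]
      push_cast
      ring_nf
    rw [h1, norm_mul, Complex.norm_exp_ofReal_mul_I, one_mul]
    refine le_trans (le_of_eq ?_) (Complex.abs_im_le_norm _)
    simp only [Complex.sub_im, Complex.ofReal_im, sub_zero, 
      Complex.im_ofReal_mul, Complex.exp_ofReal_mul_I_im, abs_mul, abs_of_pos hr]
  have hint : ∀ a b, IntervalIntegrable (fun θ => r ^ (-α) * |sin (θ - u.arg)| ^ (-α)) volume a b :=
    fun a b => by
      have h := (intervalIntegrable_abs_sin_rpow_neg hα hα1 (a - u.arg) (b - u.arg)).comp_sub_right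
        u.arg
      simp only [sub_add_cancel] at h
      exact h.const_mul _
  have hae : ∀ᵐ θ : ℝ, ‖circleMap 0 r θ - u‖ ^ (-α) ≤ r ^ (-α) * |sin (θ - u.arg)| ^ (-α) := by
    have hz : ({θ : ℝ | sin (θ - u.arg) = 0}).Countable := by
      have : {θ : ℝ | sin (θ - u.arg) = 0} ⊆ range fun n : ℤ => (n : ℝ) * π + u.arg := by
        intro θ hθ
        obtain ⟨n, hn⟩ := Real.sin_eq_zero_iff.1 hθ
        exact ⟨n, by simp only; linarith⟩
      exact (countable_range _).mono this
    filter_upwards [compl_mem_ae_iff.2 (hz.measure_zero volume)] with θ hθ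
    have hs : 0 < |sin (θ - u.arg)| := abs_pos.2 hθ
    rw [← Real.mul_rpow hr.le (abs_nonneg _)]
    exact rpow_le_rpow_of_nonpos (by positivity) (hlow θ) (by linarith)
  have hI : CircleIntegrable (fun z => ‖z - u‖ ^ (-α)) 0 r := by
    refine (hint 0 (2 * π)).mono_fun ?_ ?_
    · exact Measurable.aestronglyMeasurable (by fun_prop)
    · filter_upwards [ae_restrict_of_ae hae] with θ hθ
      rwa [Real.norm_of_nonneg (by positivity), Real.norm_of_nonneg (by positivity)]
  refine ⟨hI, ?_⟩
  have hper : Function.Periodic (fun θ => |sin θ| ^ (-α)) (2 * π) := fun θ => by simp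
  have hle : ∫ θ in 0..2 * π, ‖circleMap 0 r θ - u‖ ^ (-α) ≤
      r ^ (-α) * ∫ θ in 0..2 * π, |sin θ| ^ (-α) := by
    refine (intervalIntegral.integral_mono_ae (by positivity) hI (hint _ _) hae).trans (le_of_eq ?_)
    rw [intervalIntegral.integral_const_mul,
      intervalIntegral.integral_comp_sub_right (fun θ => |sin θ| ^ (-α))]
    congr 1
    have := hper.intervalIntegral_add_eq (0 - u.arg) 0
    rw [zero_add] at this
    rw [← this]
    congr 1
    ring
  rw [circleAverage_def, smul_eq_mul]
  calc _ ≤ (2 * π)⁻¹ * (r ^ (-α) * ∫ θ in 0..2 * π, |sin θ| ^ (-α)) :=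
        mul_le_mul_of_nonneg_left hle (by positivity)
    _ = _ := by ring

theorem circleAverage_log_one_add_le {y : ℂ → ℝ} {r M : ℝ} (hy0 : ∀ z, 0 ≤ y z)
    (hy : CircleIntegrable y 0 r) (hM : circleAverage y 0 r ≤ M)
    (hl : CircleIntegrable (fun z => log (1 + y z)) 0 r) :
    circleAverage (fun z => log (1 + y z)) 0 r ≤ log (1 + M) := by
  have hM0 : 0 ≤ M := (circleAverage_nonneg_of_nonneg fun z _ => hy0 z).trans hM
  have hint : CircleIntegrable ((fun _ => log (1 + M) - M / (1 + M)) + (1 + M)⁻¹ • y) 0 r :=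
    (circleIntegrable_const _ _ _).add hy.const_smul
  calc circleAverage (fun z => log (1 + y z)) 0 r
      ≤ circleAverage ((fun _ => log (1 + M) - M / (1 + M)) + (1 + M)⁻¹ • y) 0 r := by
        refine circleAverage_mono hl hint fun z _ => ?_
        have h1 : log ((1 + y z) / (1 + M)) ≤ (1 + y z) / (1 + M) - 1 :=
          log_le_sub_one_of_pos (by have := hy0 z; positivity)
        rw [log_div (by have := hy0 z; positivity) (by positivity)] at h1
        have h2 : (1 + y z) / (1 + M) - 1 = - (M / (1 + M)) + (1 + M)⁻¹ * y z := by
          field_simp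
          ring
        simp only [Pi.add_apply, Pi.smul_apply, smul_eq_mul]
        linarith
    _ = log (1 + M) - M / (1 + M) + (1 + M)⁻¹ * circleAverage y 0 r := by
        rw [circleAverage_add (circleIntegrable_const _ _ _) hy.const_smul, circleAverage_const,
          circleAverage_smul, smul_eq_mul]
    _ ≤ log (1 + M) - M / (1 + M) + (1 + M)⁻¹ * M := by gcongr
    _ = log (1 + M) := by field_simp; ring

end DerivedCurves

end

noncomputable section

namespace DerivedCurves

open Real Filter MeasureTheory Set Topology Metric

open scoped ComplexConjugate

/-! ### The logarithmic derivative of a meromorphic function on a disk -/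

theorem logDeriv_canonicalFactor {R : ℝ} (hR : 0 < R) {u z : ℂ} (hu : u ∈ ball (0 : ℂ) R)
    (hz : z ∈ ball (0 : ℂ) R) (hzu : z ≠ u) :
    logDeriv (Complex.canonicalFactor R u) z = -(1 / (z - u) + conj u / (R ^ 2 - conj u * z)) := by
  have h1 : z - u ≠ 0 := sub_ne_zero.2 hzu
  have hR' : (R : ℂ) ≠ 0 := by exact_mod_cast hR.ne'
  have h2 : (R : ℂ) ^ 2 - conj u * z ≠ 0 := by
    have hc := Complex.canonicalFactor_ne_zero hu (ball_subset_closedBall hz) hzu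
    intro h
    exact hc (by rw [Complex.canonicalFactor_apply, h, zero_div])
  rw [Complex.canonicalFactor_def, logDeriv_div (f := fun z => (R : ℂ) ^ 2 - conj u * z)
    (g := fun z => (R : ℂ) * (z - u)) z h2 (mul_ne_zero hR' h1) (by fun_prop) (by fun_prop),
    logDeriv_const_mul _ _ hR']
  simp only [logDeriv_apply]
  have e1 : deriv (fun z => (R : ℂ) ^ 2 - conj u * z) z = -conj u := by
    rw [deriv_const_sub, deriv_const_mul _ differentiableAt_fun_id, deriv_id'', mul_one]
  have e2 : deriv (fun z => z - u) z = 1 := by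
    rw [deriv_sub_const, deriv_id'']
  rw [e1, e2]
  ring

/-- The derivative of the Schwarz integral of `log ‖φ‖`. -/
def schwarzDeriv (φ : ℂ → ℂ) (R : ℝ) (z : ℂ) : ℂ :=
  circleAverage (fun ζ => (2 * ζ / (ζ - z) ^ 2) • ((log ‖φ ζ‖ : ℝ) : ℂ)) 0 R

theorem logDeriv_eq_schwarzDeriv {φ h : ℂ → ℂ} {R : ℝ}
    (hh : AnalyticOnNhd ℂ h (closedBall 0 R)) (hh0 : ∀ z ∈ closedBall (0 : ℂ) R, h z ≠ 0)
    (hφ : CircleIntegrable (fun ζ => log ‖φ ζ‖) 0 R)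
    (hlog : (fun ζ => log ‖φ ζ‖) =ᶠ[codiscreteWithin (sphere (0 : ℂ) |R|)] fun ζ => log ‖h ζ‖)
    {z : ℂ} (hz : z ∈ ball (0 : ℂ) R) :
    logDeriv h z = schwarzDeriv φ R z := by
  have hR : 0 < R := pos_of_mem_ball hz
  have hφc : CircleIntegrable (fun ζ => ((log ‖φ ζ‖ : ℝ) : ℂ)) 0 R := by
    simp only [CircleIntegrable, intervalIntegrable_iff] at hφ ⊢
    exact Complex.ofRealCLM.integrable_comp hφ
  set P : ℂ → ℂ := fun w => circleAverage
    (fun ζ => herglotzRieszKernel 0 w ζ • ((log ‖φ ζ‖ : ℝ) : ℂ)) 0 R with hP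
  have hPd : ∀ w ∈ ball (0 : ℂ) R, HasDerivAt P (schwarzDeriv φ R w) w := fun w hw =>
    hasDerivAt_circleAverage_herglotzRieszKernel_smul hφc hw
  have hharm : InnerProductSpace.HarmonicOnNhd (fun z => log ‖h z‖) (closedBall 0 R) :=
    fun x hx => (hh x hx).harmonicAt_log_norm (hh0 x hx)
  have hre : ∀ w ∈ ball (0 : ℂ) R, (P w).re = log ‖h w‖ := by
    intro w hw
    rw [hP, re_circleAverage_herglotzRieszKernel_smul hφ hw,
      ← hharm.circleAverage_re_herglotzRieszKernel_smul hw]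
    refine circleAverage_congr_codiscreteWithin ?_ hR.ne'
    filter_upwards [hlog] with ζ hζ
    simp only [Pi.smul_apply', hζ]
  set q : ℂ → ℂ := fun w => h w / Complex.exp (P w) with hq
  have hq1 : ∀ w ∈ ball (0 : ℂ) R, ‖q w‖ = 1 := by
    intro w hw
    have h0 : 0 < ‖h w‖ := norm_pos_iff.2 (hh0 w (ball_subset_closedBall hw))
    rw [hq, norm_div, Complex.norm_exp, hre w hw, Real.exp_log h0, div_self h0.ne']
  have hhd : ∀ w ∈ ball (0 : ℂ) R, HasDerivAt h (deriv h w) w := fun w hw =>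
    (hh w (ball_subset_closedBall hw)).differentiableAt.hasDerivAt
  have hqd : DifferentiableOn ℂ q (ball 0 R) := fun w hw =>
    ((hhd w hw).differentiableAt.div (hPd w hw).differentiableAt.cexp
      (Complex.exp_ne_zero _)).differentiableWithinAt
  have hconst : EqOn q (Function.const ℂ (q z)) (ball 0 R) :=
    Complex.eqOn_of_isPreconnected_of_isMaxOn_norm (convex_ball _ _).isPreconnected isOpen_ball
      hqd hz (fun w hw => by simp [hq1 w hw, hq1 z hz])
  have heq : h =ᶠ[𝓝 z] fun w => q z * Complex.exp (P w) := by
    filter_upwards [isOpen_ball.mem_nhds hz] with w hw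
    have := hconst hw
    simp only [Function.const_apply] at this
    rw [← this, hq]
    field_simp
  have hd : HasDerivAt h (q z * (Complex.exp (P z) * schwarzDeriv φ R z)) z :=
    (((hPd z hz).cexp).const_mul (q z)).congr_of_eventuallyEq heq
  have hz0 := hh0 z (ball_subset_closedBall hz)
  rw [logDeriv_apply, hd.deriv, div_eq_iff hz0, heq.eq_of_nhds]
  ring

theorem logDeriv_eventuallyEq_schwarzDeriv_add {φ : ℂ → ℂ} (hφ : Meromorphic φ)
    (hne : ∀ z, meromorphicOrderAt φ z ≠ ⊤) {R : ℝ} (hR : 0 < R)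
    (hS : ∀ z ∈ sphere (0 : ℂ) R, meromorphicOrderAt φ z = 0) :
    ∀ᶠ z in codiscreteWithin (ball (0 : ℂ) R), logDeriv φ z = schwarzDeriv φ R z +
      ∑ᶠ u, MeromorphicOn.divisor φ (ball 0 R) u • (1 / (z - u) + conj u / (R ^ 2 - conj u * z)) := by
  obtain ⟨h, D⟩ := hφ.meromorphicOn.exists_ecanonicalDecomp (R := R) fun u => hne u
  set d := MeromorphicOn.divisor φ (ball 0 R) with hd
  have hfin : (Function.support d).Finite := hφ.meromorphicOn.divisor_ball_support_finite
  have hsph : ∏ᶠ v, (fun z : ℂ => z - v) ^ (MeromorphicOn.divisor φ (sphere 0 R) v) = 1 := by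
    refine finprod_eq_one_of_forall_eq_one fun v => ?_
    by_cases hv : v ∈ sphere (0 : ℂ) R
    · rw [MeromorphicOn.divisor_apply hφ.meromorphicOn hv, hS v hv]
      simp
    · rw [Function.locallyFinsuppWithin.apply_eq_zero_of_notMem _ hv, zpow_zero]
  have heq : φ =ᶠ[codiscreteWithin (closedBall 0 R)]
      (∏ᶠ u, (Complex.canonicalFactor R u) ^ (-d u)) * h := by
    have := D.eventuallyEq
    rwa [hsph, mul_one] at this
  set B : ℂ → ℂ := ∏ᶠ u, (Complex.canonicalFactor R u) ^ (-d u) with hB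
  have hfin' : (Function.support fun u => -d u).Finite := by simpa using hfin
  have hsub : (Function.mulSupport fun u => Complex.canonicalFactor R u ^ (-d u)) ⊆
      hfin.toFinset := by
    intro u hu
    simp only [Finite.coe_toFinset, Function.mem_support]
    intro h0
    simp [h0] at hu
  have hBprod : B = ∏ u ∈ hfin.toFinset, Complex.canonicalFactor R u ^ (-d u) :=
    finprod_eq_prod_of_mulSupport_subset _ hsub
  have hmem : ∀ u ∈ hfin.toFinset, u ∈ ball (0 : ℂ) R := by
    intro u hu
    by_contra hcon
    simp [Function.locallyFinsuppWithin.apply_eq_zero_of_notMem _ hcon, hd] at hu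
  have hBmer : MeromorphicOn B (closedBall 0 R) := by
    rw [hBprod]
    exact MeromorphicOn.prod fun u _ =>
      (Complex.meromorphic_canonicalFactor R u).zpow.meromorphicOn
  have hBsph : ∀ ζ ∈ sphere (0 : ℂ) R, ‖B ζ‖ = 1 := by
    intro ζ hζ
    rw [hBprod, Finset.prod_apply, norm_prod]
    refine Finset.prod_eq_one fun u hu => ?_
    rw [Pi.pow_apply, norm_zpow,
      Complex.norm_canonicalFactor_eval_circle_eq_one (hmem u hu) hζ, one_zpow]
  have hcl : ∀ z ∈ ball (0 : ℂ) R, logDeriv h z = schwarzDeriv φ R z := by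
    intro z hz
    refine logDeriv_eq_schwarzDeriv D.analyticOnNhd D.ne_zero
      hφ.meromorphicOn.circleIntegrable_log_norm ?_ hz
    rw [abs_of_pos hR]
    filter_upwards [heq.filter_mono (codiscreteWithin_mono sphere_subset_closedBall),
      self_mem_codiscreteWithin _] with ζ h1 h2
    rw [h1, Pi.mul_apply, norm_mul, hBsph ζ h2, one_mul]
  have hball : codiscreteWithin (ball (0 : ℂ) R) ≤ codiscreteWithin (closedBall 0 R) :=
    codiscreteWithin_mono ball_subset_closedBall
  have hBne : ∀ x ∈ ball (0 : ℂ) R, meromorphicOrderAt B x ≠ ⊤ := by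
    intro x _
    rw [hB]
    apply meromorphicOrderAt_finprod_ne_top
      (fun _ ↦ MeromorphicAt.zpow (Complex.meromorphic_canonicalFactor _ _ _) _)
    intro c
    rw [meromorphicOrderAt_zpow (Complex.meromorphic_canonicalFactor R c x)]
    lift meromorphicOrderAt (Complex.canonicalFactor R c) x to ℤ using
      (Complex.meromorphicOrderAt_canonicalFactor_ne_top c hR) with ℓ
    exact WithTop.coe_ne_top (a := -d c * ℓ)
  have hhne : ∀ x ∈ ball (0 : ℂ) R, meromorphicOrderAt h x ≠ ⊤ := by
    intro x hx
    have hx' := ball_subset_closedBall hx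
    rw [(D.analyticOnNhd x hx').meromorphicOrderAt_eq,
      (D.analyticOnNhd x hx').analyticOrderAt_eq_zero.2 (D.ne_zero x hx')]
    simp
  have hd1 : deriv φ =ᶠ[codiscreteWithin (ball 0 R)] deriv (B * h) :=
    MeromorphicOn.deriv_eventuallyEq_codiscreteWithin hφ.meromorphicOn
      ((hBmer.mul D.analyticOnNhd.meromorphicOn).mono_set ball_subset_closedBall)
      (heq.filter_mono hball)
  have hd2 : logDeriv (B * h) =ᶠ[codiscreteWithin (ball 0 R)] logDeriv B + logDeriv h :=
    MeromorphicOn.logDeriv_mul_eventuallyEq (hBmer.mono_set ball_subset_closedBall)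
      (D.analyticOnNhd.meromorphicOn.mono_set ball_subset_closedBall) hBne hhne
  have hd3 : logDeriv B =ᶠ[codiscreteWithin (ball 0 R)]
      fun z ↦ ∑ᶠ u, (-d u) • logDeriv (Complex.canonicalFactor R u) z :=
    MeromorphicOn.logDeriv_finprod_zpow_eventuallyEq hfin'
      (fun u => (Complex.meromorphic_canonicalFactor R u).meromorphicOn)
      (fun u x _ => Complex.meromorphicOrderAt_canonicalFactor_ne_top u hR)
  have hd4 : ∀ᶠ z in codiscreteWithin (ball (0 : ℂ) R), z ∉ hfin.toFinset := by
    have : ((hfin.toFinset : Set ℂ))ᶜ ∈ codiscreteWithin (ball (0 : ℂ) R) :=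
      compl_finite_mem_codiscreteWithin (Finset.finite_toSet _)
    filter_upwards [this] with z hz using hz
  filter_upwards [heq.filter_mono hball, hd1, hd2, hd3, hd4, self_mem_codiscreteWithin _]
    with z h1 h2 h3 h4 h5 h6
  have h7 : logDeriv φ z = logDeriv (B * h) z := by
    rw [logDeriv_apply, logDeriv_apply, h1, h2]
  rw [h7, h3, Pi.add_apply, h4, hcl z h6, add_comm]
  congr 1
  refine finsum_congr fun u => ?_
  by_cases hu : d u = 0
  · simp [hu]
  · have hu' : u ∈ hfin.toFinset := by simpa using hu
    rw [logDeriv_canonicalFactor hR (hmem u hu') h6 (fun h => h5 (h ▸ hu')), smul_neg, neg_smul,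
      neg_neg]

end DerivedCurves

end

noncomputable section

namespace DerivedCurves

open Real Filter MeasureTheory Set Topology Metric

open scoped ComplexConjugate

theorem ne_of_norm_lt_of_norm_eq {z ζ : ℂ} {R : ℝ} (hz : ‖z‖ < R) (hζ : ‖ζ‖ = R) : ζ - z ≠ 0 := by
  intro h
  rw [sub_eq_zero.1 h] at hζ
  linarith

theorem circleAverage_poissonKernel_left {r R : ℝ} (hr : 0 < r) (hrR : r < R) {ζ : ℂ}
    (hζ : ‖ζ‖ = R) : circleAverage (fun z => poissonKernel 0 z ζ) 0 r = 1 := by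
  have hne : ∀ z ∈ closedBall (0 : ℂ) r, ζ - z ≠ 0 := fun z hz =>
    ne_of_norm_lt_of_norm_eq ((mem_closedBall_zero_iff.1 hz).trans_lt hrR) hζ
  have hd : DifferentiableOn ℂ (fun z => (ζ + z) / (ζ - z)) (closedBall 0 r) := fun z hz =>
    ((differentiableAt_id.const_add ζ).div (differentiableAt_id.const_sub ζ)
      (hne z hz)).differentiableWithinAt
  have hdc : DiffContOnCl ℂ (fun z => (ζ + z) / (ζ - z)) (ball 0 |r|) := by
    rw [abs_of_pos hr]
    exact ⟨hd.mono ball_subset_closedBall, by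
      rw [closure_ball _ hr.ne']
      exact hd.continuousOn⟩
  have hav := hdc.circleAverage
  have hci : CircleIntegrable (fun z => (ζ + z) / (ζ - z)) 0 r :=
    (hd.continuousOn.mono sphere_subset_closedBall).circleIntegrable hr.le
  have hre := Complex.reCLM.circleAverage_comp_comm hci
  have hζ0 : ζ ≠ 0 := by
    intro h
    rw [h, norm_zero] at hζ
    linarith
  rw [hav] at hre
  simp only [add_zero, sub_zero, div_self hζ0, Complex.reCLM_apply, Complex.one_re] at hre
  rw [← hre]
  refine circleAverage_congr_sphere fun z _ => ?_
  have := congrFun (poissonKernel_eq_re_herglotzRieszKernel (c := 0) (w := z)) ζ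
  simp only [this, Function.comp_apply, herglotzRieszKernel_def, sub_zero, Complex.reCLM_apply]

theorem continuousOn_schwarzDeriv {φ : ℂ → ℂ} {R : ℝ}
    (hφ : CircleIntegrable (fun ζ => log ‖φ ζ‖) 0 R) :
    ContinuousOn (schwarzDeriv φ R) (ball 0 R) := by
  have hφc : CircleIntegrable (fun ζ => ((log ‖φ ζ‖ : ℝ) : ℂ)) 0 R := by
    simp only [CircleIntegrable, intervalIntegrable_iff] at hφ ⊢
    exact Complex.ofRealCLM.integrable_comp hφ
  have h1 := differentiableOn_circleAverage_herglotzRieszKernel_smul hφc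
  refine (h1.deriv isOpen_ball).continuousOn.congr fun w hw => ?_
  exact ((hasDerivAt_circleAverage_herglotzRieszKernel_smul hφc hw).deriv).symm

theorem circleAverage_norm_schwarzDeriv_le {φ : ℂ → ℂ} {r R : ℝ} (hr : 0 < r) (hrR : r < R)
    (hφ : CircleIntegrable (fun ζ => log ‖φ ζ‖) 0 R) :
    circleAverage (fun z => ‖schwarzDeriv φ R z‖) 0 r ≤
      2 * R / (R ^ 2 - r ^ 2) * circleAverage (fun ζ => |log ‖φ ζ‖|) 0 R := by
  have hR : 0 < R := hr.trans hrR
  have hRr : 0 < R ^ 2 - r ^ 2 := by nlinarith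
  set c := 2 * R / (R ^ 2 - r ^ 2) with hc
  have hc0 : 0 ≤ c := by positivity
  set μ : Measure ℝ := volume.restrict (Ioc 0 (2 * π)) with hμ
  set a : ℝ → ℝ := fun τ => |log ‖φ (circleMap 0 R τ)‖| with ha
  have hai : Integrable a μ := by
    have := hφ.abs
    rwa [CircleIntegrable, intervalIntegrable_iff_integrableOn_Ioc_of_le (by positivity)] at this
  set k : ℝ → ℝ → ℝ := fun θ τ => poissonKernel 0 (circleMap 0 r θ) (circleMap 0 R τ) with hk
  have hnr : ∀ θ, ‖circleMap 0 r θ‖ = r := fun θ => by simp [abs_of_pos hr]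
  have hnR : ∀ θ, ‖circleMap 0 R θ‖ = R := fun θ => by simp [abs_of_pos hR]
  have hne : ∀ θ τ, circleMap 0 R τ - circleMap 0 r θ ≠ 0 := fun θ τ =>
    ne_of_norm_lt_of_norm_eq ((hnr θ).trans_lt hrR) (hnR τ)
  have hkdef : ∀ θ τ, k θ τ = (R ^ 2 - r ^ 2) / ‖circleMap 0 R τ - circleMap 0 r θ‖ ^ 2 := by
    intro θ τ
    simp only [hk, poissonKernel_def, sub_zero, hnr, hnR]
  have hk0 : ∀ θ τ, 0 ≤ k θ τ := fun θ τ => by rw [hkdef]; positivity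
  have hdist : ∀ θ τ, R - r ≤ ‖circleMap 0 R τ - circleMap 0 r θ‖ := by
    intro θ τ
    have := norm_sub_norm_le (circleMap 0 R τ) (circleMap 0 r θ)
    rwa [hnR, hnr] at this
  have hkb : ∀ θ τ, k θ τ ≤ (R ^ 2 - r ^ 2) / (R - r) ^ 2 := by
    intro θ τ
    rw [hkdef]
    have := hdist θ τ
    have h0 : 0 < R - r := by linarith
    gcongr
  have hkm : Continuous (Function.uncurry k) := by
    have : Function.uncurry k =
        fun p : ℝ × ℝ => (R ^ 2 - r ^ 2) / ‖circleMap 0 R p.2 - circleMap 0 r p.1‖ ^ 2 := by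
      ext p
      exact hkdef p.1 p.2
    rw [this]
    refine Continuous.div (by fun_prop) (by fun_prop) fun p => ?_
    have := norm_pos_iff.2 (hne p.1 p.2)
    positivity
  have hint : Integrable (Function.uncurry fun θ τ => k θ τ * a τ) (μ.prod μ) := by
    refine (hai.comp_snd μ).bdd_mul (c := (R ^ 2 - r ^ 2) / (R - r) ^ 2)
      hkm.aestronglyMeasurable (Eventually.of_forall fun p => ?_)
    rw [Real.norm_of_nonneg (hk0 _ _)]
    exact hkb _ _
  have hpt : ∀ θ, ‖schwarzDeriv φ R (circleMap 0 r θ)‖ ≤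
      (2 * π)⁻¹ * (c * ∫ τ, k θ τ * a τ ∂μ) := by
    intro θ
    rw [schwarzDeriv, circleAverage_def, norm_smul, Real.norm_of_nonneg (by positivity),
      ← integral_const_mul, intervalIntegral.integral_of_le (by positivity)]
    refine mul_le_mul_of_nonneg_left ((norm_integral_le_integral_norm _).trans (le_of_eq ?_))
      (by positivity)
    refine integral_congr_ae (Eventually.of_forall fun τ => ?_)
    simp only [norm_smul, norm_div, norm_mul, norm_pow, Complex.norm_ofNat, hnR, hkdef, hc,
      Complex.norm_real, Real.norm_eq_abs, ha]
    field_simp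
  have hci : IntervalIntegrable (fun θ => ‖schwarzDeriv φ R (circleMap 0 r θ)‖) volume 0 (2 * π) := by
    have : ContinuousOn (fun z => ‖schwarzDeriv φ R z‖) (sphere 0 r) :=
      ((continuousOn_schwarzDeriv hφ).mono (sphere_subset_ball hrR)).norm
    exact this.circleIntegrable hr.le
  have hmean : ∀ τ, ∫ θ, k θ τ ∂μ = 2 * π := by
    intro τ
    have h1 := circleAverage_poissonKernel_left hr hrR (hnR τ)
    rw [circleAverage_def, smul_eq_mul, intervalIntegral.integral_of_le (by positivity),
      inv_mul_eq_one₀ (by positivity)] at h1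
    exact h1.symm
  have hswap : ∫ θ, ∫ τ, k θ τ * a τ ∂μ ∂μ = 2 * π * ∫ τ, a τ ∂μ := by
    rw [integral_integral_swap hint, ← integral_const_mul]
    refine integral_congr_ae (Eventually.of_forall fun τ => ?_)
    simp only
    rw [integral_mul_const, hmean]
  rw [circleAverage_def, smul_eq_mul, intervalIntegral.integral_of_le (by positivity)]
  have hci' : Integrable (fun θ => ‖schwarzDeriv φ R (circleMap 0 r θ)‖) μ := by
    rwa [intervalIntegrable_iff_integrableOn_Ioc_of_le (by positivity)] at hci
  calc (2 * π)⁻¹ * ∫ θ, ‖schwarzDeriv φ R (circleMap 0 r θ)‖ ∂μ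
      ≤ (2 * π)⁻¹ * ∫ θ, (2 * π)⁻¹ * (c * ∫ τ, k θ τ * a τ ∂μ) ∂μ := by
        refine mul_le_mul_of_nonneg_left (integral_mono hci' ?_ hpt) (by positivity)
        exact (hint.integral_prod_left.const_mul c).const_mul _
    _ = c * ((2 * π)⁻¹ * ∫ τ, a τ ∂μ) := by
        rw [integral_const_mul, integral_const_mul, hswap]
        field_simp
    _ = c * circleAverage (fun ζ => |log ‖φ ζ‖|) 0 R := by
        rw [circleAverage_def, smul_eq_mul, intervalIntegral.integral_of_le (by positivity)]

theorem norm_add_rpow_le {α : ℝ} (hα : 0 < α) (hα1 : α ≤ 1) (x y : ℂ) :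
    ‖x + y‖ ^ α ≤ ‖x‖ ^ α + ‖y‖ ^ α :=
  (rpow_le_rpow (norm_nonneg _) (norm_add_le _ _) hα.le).trans
    (rpow_add_le_add_rpow (norm_nonneg _) (norm_nonneg _) hα.le hα1)

theorem norm_zsmul_rpow_le {α : ℝ} (hα : 0 < α) (hα1 : α ≤ 1) (m : ℤ) (x : ℂ) :
    ‖m • x‖ ^ α ≤ |(m : ℝ)| * ‖x‖ ^ α := by
  rw [zsmul_eq_mul, norm_mul, Complex.norm_intCast, mul_rpow (abs_nonneg _) (norm_nonneg _)]
  refine mul_le_mul_of_nonneg_right ?_ (by positivity)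
  rcases eq_or_ne m 0 with rfl | hm
  · simp [hα.ne']
  · have h1 : (1 : ℝ) ≤ |(m : ℝ)| := by
      rw [← Int.cast_abs]
      exact_mod_cast Int.one_le_abs hm
    calc |(m : ℝ)| ^ α ≤ |(m : ℝ)| ^ (1 : ℝ) := rpow_le_rpow_of_exponent_le h1 hα1
      _ = _ := rpow_one _

theorem posLog_le_inv_mul_log_one_add_rpow {α x : ℝ} (hα : 0 < α) (hx : 0 ≤ x) :
    log⁺ x ≤ α⁻¹ * log (1 + x ^ α) := by
  have h0 : 0 ≤ x ^ α := by positivity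
  rw [posLog_def]
  refine max_le (mul_nonneg (by positivity) (log_nonneg (by linarith))) ?_
  rcases hx.eq_or_lt with rfl | hx'
  · simp only [log_zero]
    exact mul_nonneg (by positivity) (log_nonneg (by linarith))
  · rw [le_inv_mul_iff₀ hα, ← log_rpow hx']
    exact log_le_log (by positivity) (by linarith)

theorem proximity_logDeriv_le {α K : ℝ} (hα : 0 < α) (hα1 : α < 1)
    (hK : ∀ r : ℝ, 0 < r → ∀ u : ℂ,
      CircleIntegrable (fun z => ‖z - u‖ ^ (-α)) 0 r ∧
      circleAverage (fun z => ‖z - u‖ ^ (-α)) 0 r ≤ K * r ^ (-α))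
    {φ : ℂ → ℂ} (hφ : Meromorphic φ)
    (hne : ∀ z, meromorphicOrderAt φ z ≠ ⊤) {r R : ℝ} (hr : 0 < r) (hrR : r < R)
    (hS : ∀ z ∈ sphere (0 : ℂ) R, meromorphicOrderAt φ z = 0) :
    ValueDistribution.proximity (logDeriv φ) ⊤ r ≤ α⁻¹ * log (2 +
      2 * R / (R ^ 2 - r ^ 2) * circleAverage (fun ζ => |log ‖φ ζ‖|) 0 R +
      (∑ᶠ u, |(MeromorphicOn.divisor φ (ball 0 R) u : ℝ)|) * (2 * K * r ^ (-α))) := by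
  have hR : 0 < R := hr.trans hrR
  set d := MeromorphicOn.divisor φ (ball 0 R) with hd
  have hfin : (Function.support d).Finite := hφ.meromorphicOn.divisor_ball_support_finite
  set s := hfin.toFinset with hs
  have hφi : CircleIntegrable (fun ζ => log ‖φ ζ‖) 0 R :=
    hφ.meromorphicOn.circleIntegrable_log_norm
  set w : ℂ → ℂ := fun u => R ^ 2 / conj u with hw
  set y : ℂ → ℝ := fun z => 1 + ‖schwarzDeriv φ R z‖ +
    ∑ u ∈ s, |(d u : ℝ)| * (‖z - u‖ ^ (-α) + ‖z - w u‖ ^ (-α)) with hy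
  have hy0 : ∀ z, 0 ≤ y z := fun z => by positivity
  have hSi : CircleIntegrable (fun z => ‖schwarzDeriv φ R z‖) 0 r :=
    ContinuousOn.circleIntegrable hr.le
      ((continuousOn_schwarzDeriv hφi).mono (sphere_subset_ball hrR)).norm
  have hti : ∀ u, CircleIntegrable
      (fun z => |(d u : ℝ)| * (‖z - u‖ ^ (-α) + ‖z - w u‖ ^ (-α))) 0 r := fun u =>
    ((hK r hr u).1.add (hK r hr (w u)).1).const_smul (a := |(d u : ℝ)|)
  have hsumi : CircleIntegrable
      (fun z => ∑ u ∈ s, |(d u : ℝ)| * (‖z - u‖ ^ (-α) + ‖z - w u‖ ^ (-α))) 0 r := by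
    have := CircleIntegrable.sum s fun u _ => hti u
    convert this using 1
    ext z
    simp
  have hyi : CircleIntegrable y 0 r := ((circleIntegrable_const 1 0 r).add hSi).add hsumi
  have hli : CircleIntegrable (fun z => log (1 + y z)) 0 r := by
    refine IntervalIntegrable.mono_fun hyi ?_ ?_
    · exact (measurable_log.comp_aemeasurable
        (hyi.aestronglyMeasurable_restrict_uIoc.aemeasurable.const_add 1)).aestronglyMeasurable
    · refine Eventually.of_forall fun θ => ?_
      have := hy0 (circleMap 0 r θ)
      simp only
      rw [Real.norm_of_nonneg (log_nonneg (by linarith)), Real.norm_of_nonneg this]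
      linarith [log_le_sub_one_of_pos (show 0 < 1 + y (circleMap 0 r θ) by linarith)]
  have hpt : ∀ᶠ z in codiscreteWithin (sphere (0 : ℂ) |r|),
      log⁺ ‖logDeriv φ z‖ ≤ α⁻¹ * log (1 + y z) := by
    rw [abs_of_pos hr]
    filter_upwards [(logDeriv_eventuallyEq_schwarzDeriv_add hφ hne hR hS).filter_mono
      (codiscreteWithin_mono (sphere_subset_ball hrR))] with z hz
    refine (posLog_le_inv_mul_log_one_add_rpow hα (norm_nonneg _)).trans ?_
    refine mul_le_mul_of_nonneg_left (log_le_log (by positivity) ?_) (by positivity)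
    refine add_le_add_right ?_ 1
    have hsum : ∑ᶠ u, d u • (1 / (z - u) + conj u / (R ^ 2 - conj u * z)) =
        ∑ u ∈ s, d u • (1 / (z - u) + conj u / (R ^ 2 - conj u * z)) := by
      refine finsum_eq_sum_of_support_subset _ fun u hu => ?_
      simp only [hs, Finite.coe_toFinset, Function.mem_support]
      intro h0
      simp [h0] at hu
    rw [hz, hsum]
    refine (norm_add_rpow_le hα hα1.le _ _).trans (add_le_add ?_ ?_)
    · rcases le_total ‖schwarzDeriv φ R z‖ 1 with h | h
      · have := rpow_le_one (norm_nonneg _) h hα.le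
        linarith [norm_nonneg (schwarzDeriv φ R z)]
      · have := rpow_le_rpow_of_exponent_le h hα1.le
        rw [rpow_one] at this
        linarith
    · have h1 := Finset.le_sum_of_subadditive (fun x : ℂ => ‖x‖ ^ α) (by simp [hα.ne'])
        (norm_add_rpow_le hα hα1.le) s
        (fun u => d u • (1 / (z - u) + conj u / (R ^ 2 - conj u * z)))
      refine h1.trans (Finset.sum_le_sum fun u _ => ?_)
      refine (norm_zsmul_rpow_le hα hα1.le _ _).trans
        (mul_le_mul_of_nonneg_left ?_ (abs_nonneg _))
      refine (norm_add_rpow_le hα hα1.le _ _).trans (add_le_add ?_ ?_)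
      · rw [one_div, norm_inv, inv_rpow (norm_nonneg _), rpow_neg (norm_nonneg _)]
      · rcases eq_or_ne u 0 with rfl | hu
        · rw [map_zero, zero_div, norm_zero, zero_rpow hα.ne']
          positivity
        · have hcu : conj u ≠ 0 := by simpa using hu
          have : conj u / (R ^ 2 - conj u * z) = -(z - w u)⁻¹ := by
            rw [hw, ← inv_neg, neg_sub, ← inv_div]
            congr 1
            field_simp
          rw [this, norm_neg, norm_inv, inv_rpow (norm_nonneg _), rpow_neg (norm_nonneg _)]
  have hmean : circleAverage y 0 r ≤ 1 +
      2 * R / (R ^ 2 - r ^ 2) * circleAverage (fun ζ => |log ‖φ ζ‖|) 0 R +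
      (∑ᶠ u, |(d u : ℝ)|) * (2 * K * r ^ (-α)) := by
    have h1 : circleAverage y 0 r = 1 + circleAverage (fun z => ‖schwarzDeriv φ R z‖) 0 r +
        circleAverage
          (fun z => ∑ u ∈ s, |(d u : ℝ)| * (‖z - u‖ ^ (-α) + ‖z - w u‖ ^ (-α))) 0 r := by
      rw [hy, circleAverage_fun_add (f₁ := fun z => 1 + ‖schwarzDeriv φ R z‖)
          ((circleIntegrable_const 1 0 r).add hSi) hsumi,
        circleAverage_fun_add (circleIntegrable_const 1 0 r) hSi, circleAverage_const]
    have h2 : (∑ᶠ u, |(d u : ℝ)|) = ∑ u ∈ s, |(d u : ℝ)| := by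
      refine finsum_eq_sum_of_support_subset _ fun u hu => ?_
      simp only [hs, Finite.coe_toFinset, Function.mem_support]
      intro h0
      simp [h0] at hu
    rw [h1, h2, Finset.sum_mul]
    refine add_le_add (add_le_add_right (circleAverage_norm_schwarzDeriv_le hr hrR hφi) 1) ?_
    rw [circleAverage_fun_sum fun u _ => hti u]
    refine Finset.sum_le_sum fun u _ => ?_
    have h3 := circleAverage_fun_smul (a := |(d u : ℝ)|) (c := 0) (R := r)
      (f := fun z => ‖z - u‖ ^ (-α) + ‖z - w u‖ ^ (-α))
    simp only [smul_eq_mul] at h3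
    rw [h3]
    refine mul_le_mul_of_nonneg_left ?_ (abs_nonneg _)
    rw [circleAverage_fun_add (hK r hr u).1 (hK r hr (w u)).1]
    linarith [(hK r hr u).2, (hK r hr (w u)).2]
  rw [ValueDistribution.proximity_top]
  have hposi : CircleIntegrable (fun z => log⁺ ‖logDeriv φ z‖) 0 r :=
    (hφ.deriv.div hφ).meromorphicOn.circleIntegrable_posLog_norm
  calc circleAverage (fun z => log⁺ ‖logDeriv φ z‖) 0 r
      ≤ circleAverage (α⁻¹ • fun z => log (1 + y z)) 0 r :=
        circleAverage_mono_of_codiscrete hr.ne' hposi hli.const_smul hpt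
    _ = α⁻¹ * circleAverage (fun z => log (1 + y z)) 0 r := by
        rw [circleAverage_smul, smul_eq_mul]
    _ ≤ _ := by
        refine mul_le_mul_of_nonneg_left ?_ (by positivity)
        refine (circleAverage_log_one_add_le hy0 hyi hmean hli).trans (le_of_eq ?_)
        congr 1
        ring

end DerivedCurves

end

noncomputable section

namespace DerivedCurves

open Real Filter MeasureTheory Set Topology Metric

/-! ### The lemma on the logarithmic derivative -/

theorem logCounting_eq_sum (E : Function.locallyFinsupp ℂ ℤ) {r : ℝ} (hr : 0 < r)
    {F : Finset ℂ} (hF : ∀ z, z ∈ F ↔ ‖z‖ ≤ r ∧ E z ≠ 0) :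
    Function.locallyFinsuppWithin.logCounting E r = ∑ z ∈ F, (E z : ℝ) * (log r - log ‖z‖) := by
  classical
  have hval : ∀ z ∈ F, E.toClosedBall r z = E z := fun z hz =>
    Function.locallyFinsuppWithin.toClosedBall_eval_within _
      (by simpa [abs_of_pos hr] using ((hF z).1 hz).1)
  have h1 : ∑ᶠ z, (E.toClosedBall r z : ℝ) * log (r * ‖z‖⁻¹) =
      ∑ z ∈ F, (E z : ℝ) * log (r * ‖z‖⁻¹) := by
    rw [finsum_eq_sum_of_support_subset (s := F)]
    · exact Finset.sum_congr rfl fun z hz => by rw [hval z hz]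
    · intro z hz
      have hz' : E.toClosedBall r z ≠ 0 := by
        intro h0
        simp [h0] at hz
      have hmem : z ∈ closedBall (0 : ℂ) |r| := by
        by_contra hcon
        exact hz' (Function.locallyFinsuppWithin.apply_eq_zero_of_notMem _ hcon)
      rw [Function.locallyFinsuppWithin.toClosedBall_eval_within _ hmem] at hz'
      exact (hF z).2 ⟨by simpa [abs_of_pos hr] using hmem, hz'⟩
  have h2 : (E 0 : ℝ) * log r = ∑ z ∈ F, if z = 0 then (E z : ℝ) * log r else 0 := by
    rw [Finset.sum_ite_eq' F 0]
    split_ifs with h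
    · rfl
    · have : E 0 = 0 := by
        by_contra hcon
        exact h ((hF 0).2 ⟨by simpa using hr.le, hcon⟩)
      simp [this]
  change ∑ᶠ z, (E.toClosedBall r z : ℝ) * log (r * ‖z‖⁻¹) + (E 0 : ℝ) * log r = _
  rw [h1, h2, ← Finset.sum_add_distrib]
  refine Finset.sum_congr rfl fun z _ => ?_
  rcases eq_or_ne z 0 with rfl | hz
  · simp
  · have : ‖z‖ ≠ 0 := norm_ne_zero_iff.2 hz
    rw [if_neg hz, log_mul hr.ne' (inv_ne_zero this), log_inv]
    ring

theorem exists_finset_support (E : Function.locallyFinsupp ℂ ℤ) (r : ℝ) :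
    ∃ F : Finset ℂ, ∀ z, z ∈ F ↔ ‖z‖ ≤ r ∧ E z ≠ 0 := by
  rcases lt_or_ge r 0 with hr | hr
  · refine ⟨∅, fun z => ?_⟩
    have := norm_nonneg z
    simp only [Finset.notMem_empty, false_iff, not_and]
    intro h
    linarith
  have hfin := (E.toClosedBall r).finiteSupport (isCompact_closedBall 0 |r|)
  refine ⟨hfin.toFinset, fun z => ?_⟩
  simp only [Finite.mem_toFinset, Function.mem_support]
  by_cases hz : z ∈ closedBall (0 : ℂ) |r|
  · rw [Function.locallyFinsuppWithin.toClosedBall_eval_within _ hz]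
    simp only [mem_closedBall_zero_iff, abs_of_nonneg hr] at hz
    simp [hz]
  · rw [Function.locallyFinsuppWithin.apply_eq_zero_of_notMem _ hz]
    simp only [mem_closedBall_zero_iff, abs_of_nonneg hr] at hz
    simp [hz]

theorem exists_radius_order_eq_zero {φ : ℂ → ℂ} (hφ : Meromorphic φ)
    (hne : ∀ z, meromorphicOrderAt φ z ≠ ⊤) {a b : ℝ} (hab : a < b) :
    ∃ R ∈ Ioo a b, ∀ z ∈ sphere (0 : ℂ) R, meromorphicOrderAt φ z = 0 := by
  obtain ⟨F, hF⟩ := exists_finset_support (MeromorphicOn.divisor φ univ) b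
  obtain ⟨R, hR, hR'⟩ := (Ioo_infinite hab).exists_notMem_finset (F.image norm)
  refine ⟨R, hR, fun z hz => ?_⟩
  have hzR : ‖z‖ = R := by simpa using hz
  have h0 : MeromorphicOn.divisor φ univ z = 0 := by
    by_contra hcon
    exact hR' (Finset.mem_image.2 ⟨z, (hF z).2 ⟨by rw [hzR]; exact hR.2.le, hcon⟩, hzR⟩)
  rw [MeromorphicOn.divisor_apply hφ.meromorphicOn (mem_univ z)] at h0
  rcases WithTop.untop₀_eq_zero.1 h0 with h | h
  · exact h
  · exact absurd h (hne z)

open ValueDistribution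

theorem exists_characteristic_inv_le {φ : ℂ → ℂ} (hφ : Meromorphic φ) :
    ∃ c : ℝ, 0 ≤ c ∧ ∀ r, characteristic φ⁻¹ ⊤ r ≤ characteristic φ ⊤ r + c := by
  refine ⟨max |log ‖φ 0‖| |log ‖meromorphicTrailingCoeffAt φ 0‖|,
    (abs_nonneg _).trans (le_max_left _ _), fun r => ?_⟩
  have := (abs_le.1 (characteristic_sub_characteristic_inv_le (R := r) hφ)).1
  linarith

theorem proximity_le_characteristic {φ : ℂ → ℂ} {a : WithTop ℂ} {r : ℝ} (hr : 1 ≤ r) :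
    proximity φ a r ≤ characteristic φ a r :=
  le_add_of_nonneg_right (logCounting_nonneg hr)

theorem logCounting_le_characteristic {φ : ℂ → ℂ} {a : WithTop ℂ} {r : ℝ} :
    logCounting φ a r ≤ characteristic φ a r :=
  le_add_of_nonneg_left (proximity_nonneg r)

theorem circleAverage_abs_log_norm_le {φ : ℂ → ℂ} (hφ : Meromorphic φ) {r : ℝ} (hr : 1 ≤ r) :
    circleAverage (fun z => |log ‖φ z‖|) 0 r ≤
      characteristic φ ⊤ r + characteristic φ⁻¹ ⊤ r := by
  have h1 : circleAverage (fun z => |log ‖φ z‖|) 0 r = proximity φ ⊤ r + proximity φ⁻¹ ⊤ r := by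
    rw [proximity_top, proximity_top, ← circleAverage_fun_add
      hφ.meromorphicOn.circleIntegrable_posLog_norm
      hφ.inv.meromorphicOn.circleIntegrable_posLog_norm]
    refine circleAverage_congr_sphere fun z _ => ?_
    simp only [Pi.inv_apply, norm_inv]
    have h := half_mul_log_add_log_abs (x := ‖φ z‖)
    have h' := half_mul_log_add_log_abs (x := ‖φ z‖⁻¹)
    rw [log_inv, abs_neg] at h'
    linarith
  rw [h1]
  exact add_le_add (proximity_le_characteristic hr) (proximity_le_characteristic hr)

theorem finsum_abs_divisor_mul_log_le {φ : ℂ → ℂ} (hφ : Meromorphic φ) {R ρ : ℝ} (hR : 1 ≤ R)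
    (hRρ : R < ρ) :
    (∑ᶠ u, |(MeromorphicOn.divisor φ (ball 0 R) u : ℝ)|) * log (ρ / R) ≤
      characteristic φ ⊤ ρ + characteristic φ⁻¹ ⊤ ρ := by
  have hρ : 1 ≤ ρ := hR.trans hRρ.le
  set D := MeromorphicOn.divisor φ univ with hD
  have hDball : ∀ u ∈ ball (0 : ℂ) R, MeromorphicOn.divisor φ (ball 0 R) u = D u := by
    intro u hu
    rw [MeromorphicOn.divisor_apply hφ.meromorphicOn hu,
      MeromorphicOn.divisor_apply hφ.meromorphicOn (mem_univ u)]
  obtain ⟨F, hF⟩ := exists_finset_support |D| ρ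
  have hF' : ∀ z, z ∈ F ↔ ‖z‖ ≤ ρ ∧ |D| z ≠ 0 := hF
  have habs : ∀ z, |D| z = |D z| := fun z => rfl
  have h1 : Function.locallyFinsuppWithin.logCounting |D| ρ =
      logCounting φ ⊤ ρ + logCounting φ⁻¹ ⊤ ρ := by
    rw [logCounting_inv, logCounting_zero, logCounting_top, ← posPart_add_negPart D, map_add]
    exact add_comm _ _
  have h2 : (∑ᶠ u, |(MeromorphicOn.divisor φ (ball 0 R) u : ℝ)|) * log (ρ / R) ≤
      Function.locallyFinsuppWithin.logCounting |D| ρ := by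
    rw [logCounting_eq_sum |D| (by linarith) hF]
    have h3 : (∑ᶠ u, |(MeromorphicOn.divisor φ (ball 0 R) u : ℝ)|) =
        ∑ u ∈ F, |(MeromorphicOn.divisor φ (ball 0 R) u : ℝ)| := by
      refine finsum_eq_sum_of_support_subset _ fun u hu => ?_
      have hu0 : MeromorphicOn.divisor φ (ball 0 R) u ≠ 0 := by
        intro h0
        simp [h0] at hu
      have hub : u ∈ ball (0 : ℂ) R := by
        by_contra hcon
        exact hu0 (Function.locallyFinsuppWithin.apply_eq_zero_of_notMem _ hcon)
      refine (hF u).2 ⟨(mem_ball_zero_iff.1 hub).le.trans hRρ.le, ?_⟩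
      rw [habs, ← hDball u hub]
      simpa using hu0
    rw [h3, Finset.sum_mul]
    refine Finset.sum_le_sum fun u hu => ?_
    have hle : log ‖u‖ ≤ log ρ := by
      rcases (norm_nonneg u).eq_or_lt with h | h
      · rw [← h, log_zero]
        exact log_nonneg hρ
      · exact log_le_log h ((hF u).1 hu).1
    have hnn : 0 ≤ ((|D| u : ℤ) : ℝ) := by
      rw [habs]
      exact_mod_cast abs_nonneg _
    by_cases hub : u ∈ ball (0 : ℂ) R
    · rw [hDball u hub, habs, Int.cast_abs, log_div (by linarith) (by linarith)]
      refine mul_le_mul_of_nonneg_left ?_ (abs_nonneg _)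
      have : log ‖u‖ ≤ log R := by
        rcases (norm_nonneg u).eq_or_lt with h | h
        · rw [← h, log_zero]
          exact log_nonneg hR
        · exact log_le_log h (mem_ball_zero_iff.1 hub).le
      linarith
    · rw [Function.locallyFinsuppWithin.apply_eq_zero_of_notMem _ hub]
      simp only [Int.cast_zero, abs_zero, zero_mul]
      exact mul_nonneg hnn (by linarith)
  rw [h1] at h2
  exact h2.trans (add_le_add logCounting_le_characteristic logCounting_le_characteristic)

/-- The filter of sets of positive reals whose complement has finite Lebesgue measure. -/
def cofiniteMeasure : Filter ℝ := (volume.restrict (Ioi (0 : ℝ))).cofinite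

theorem mem_cofiniteMeasure {s : Set ℝ} : s ∈ cofiniteMeasure ↔ volume (sᶜ ∩ Ioi 0) < ⊤ := by
  rw [cofiniteMeasure, Measure.mem_cofinite, Measure.restrict_apply' measurableSet_Ioi]

theorem cofiniteMeasure_le_atTop : cofiniteMeasure ≤ atTop := by
  intro s hs
  obtain ⟨a, ha⟩ := mem_atTop_sets.1 hs
  rw [mem_cofiniteMeasure]
  refine (measure_mono (t := Ioc 0 a) fun x hx => ⟨hx.2, ?_⟩).trans_lt (by simp)
  by_contra hcon
  exact hx.1 (ha x (not_le.1 hcon).le)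

theorem characteristic_mono {φ : ℂ → ℂ} (hφ : Meromorphic φ) {r s : ℝ} (hr : 1 ≤ r) (hrs : r ≤ s) :
    characteristic φ ⊤ r ≤ characteristic φ ⊤ s :=
  characteristic_monotoneOn hφ (show 0 < r by linarith) (show 0 < s by linarith) hrs

theorem two_mul_div_sq_sub_sq_le {r R t δ : ℝ} (hr : 0 < r) (ht : 0 < t) (htδ : t * δ = 1)
    (hδ : 0 < δ) (hR : r + δ / 4 < R) : 2 * R / (R ^ 2 - r ^ 2) ≤ 8 * t := by
  have h1 : 0 < R - r := by linarith
  have h3 : R ^ 2 - r ^ 2 = (R - r) * (R + r) := by ring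
  rw [h3, div_le_iff₀ (mul_pos h1 (by linarith))]
  have h2 : 1 ≤ 4 * (t * (R - r)) := by
    have : t * (δ / 4) ≤ t * (R - r) := mul_le_mul_of_nonneg_left (by linarith) ht.le
    linarith
  calc 2 * R ≤ 1 * (2 * (R + r)) := by linarith
    _ ≤ 4 * (t * (R - r)) * (2 * (R + r)) := mul_le_mul_of_nonneg_right h2 (by linarith)
    _ = _ := by ring

theorem le_mul_sq_mul_of_mul_log_le {r R t δ n M : ℝ} (hr : 1 ≤ r) (ht : 0 < t) (htδ : t * δ = 1)
    (hδ : 0 < δ) (hδ1 : δ ≤ 1) (hrR : r < R) (hR : R < r + δ / 2) (hn : 0 ≤ n) (hM : 0 ≤ M)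
    (h : n * log ((r + δ) / R) ≤ M * t) : n ≤ 8 * M * t ^ 2 * r := by
  have hR0 : 0 < R := by linarith
  have h3 : δ / (4 * r) ≤ log ((r + δ) / R) := by
    refine le_trans ?_ (one_sub_inv_le_log_of_pos (show 0 < (r + δ) / R by positivity))
    rw [inv_div, one_sub_div (by positivity), div_le_div_iff₀ (by positivity) (by positivity)]
    have h5 : δ * (r + δ) ≤ δ * (2 * r) := mul_le_mul_of_nonneg_left (by linarith) hδ.le
    have h6 : δ / 2 * (4 * r) ≤ (r + δ - R) * (4 * r) :=
      mul_le_mul_of_nonneg_right (by linarith) (by linarith)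
    linarith
  have h4 : n * (δ / (4 * r)) ≤ M * t := (mul_le_mul_of_nonneg_left h3 hn).trans h
  have h5 : n = n * (δ / (4 * r)) * (4 * r * t) := by
    have : n * (δ / (4 * r)) * (4 * r * t) = n * (t * δ) := by
      field_simp
    rw [this, htδ, mul_one]
  rw [h5]
  have h7 : 0 ≤ M * t ^ 2 * r := by positivity
  calc n * (δ / (4 * r)) * (4 * r * t) ≤ M * t * (4 * r * t) :=
        mul_le_mul_of_nonneg_right h4 (by positivity)
    _ = 4 * (M * t ^ 2 * r) := by ring
    _ ≤ 8 * (M * t ^ 2 * r) := by linarith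
    _ = _ := by ring

theorem two_add_add_le_mul_sq_mul_rpow {r t α n q A M K : ℝ} (hr : 1 ≤ r) (ht : 1 ≤ t)
    (hα1 : α < 1) (hM : 0 ≤ M) (hK : 0 ≤ K) (hA0 : 0 ≤ A) (hq : q ≤ 8 * t) (hA : A ≤ M * t)
    (hn : n ≤ 8 * M * t ^ 2 * r) :
    2 + q * A + n * (2 * K * r ^ (-α)) ≤ (2 + 8 * M + 16 * K * M) * t ^ 2 * r ^ (1 - α) := by
  have hr0 : 0 < r := by linarith
  have hrpow : (1 : ℝ) ≤ r ^ (1 - α) := one_le_rpow hr (by linarith)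
  have e1 : q * A ≤ 8 * M * t ^ 2 := by
    calc _ ≤ 8 * t * (M * t) := mul_le_mul hq hA hA0 (by positivity)
      _ = _ := by ring
  have e2 : n * (2 * K * r ^ (-α)) ≤ 16 * K * M * t ^ 2 * r ^ (1 - α) := by
    calc _ ≤ 8 * M * t ^ 2 * r * (2 * K * r ^ (-α)) :=
          mul_le_mul_of_nonneg_right hn (by positivity)
      _ = 16 * K * M * t ^ 2 * (r ^ (1 : ℝ) * r ^ (-α)) := by rw [rpow_one]; ring
      _ = _ := by rw [← rpow_add hr0, ← sub_eq_add_neg]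
  have e3 : 2 + 8 * M * t ^ 2 ≤ (2 + 8 * M) * t ^ 2 * r ^ (1 - α) := by
    have h1 : (1 : ℝ) ≤ t ^ 2 := one_le_pow₀ ht
    calc 2 + 8 * M * t ^ 2 ≤ (2 + 8 * M) * t ^ 2 := by linarith
      _ ≤ _ := le_mul_of_one_le_right (by positivity) hrpow
  calc _ ≤ (2 + 8 * M) * t ^ 2 * r ^ (1 - α) + 16 * K * M * t ^ 2 * r ^ (1 - α) := by linarith
    _ = _ := by ring

theorem inv_mul_log_mul_sq_mul_rpow_le {e B t r : ℝ} (he : 0 < e) (he1 : e ≤ 1) (hB : 1 ≤ B)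
    (ht : 1 ≤ t) (hr : 1 ≤ r) (h : 2 * log B ≤ e / 2 * log r) :
    ((1 + e / 2)⁻¹)⁻¹ * log (B * t ^ 2 * r ^ (1 - (1 + e / 2)⁻¹)) ≤ 4 * log t + e * log r := by
  have hr0 : 0 < r := by linarith
  have hlog : log (B * t ^ 2 * r ^ (1 - (1 + e / 2)⁻¹)) =
      log B + 2 * log t + (1 - (1 + e / 2)⁻¹) * log r := by
    rw [log_mul (by positivity) (by positivity), log_mul (by positivity) (by positivity), log_pow,
      log_rpow hr0]
    push_cast
    ring
  have h1 : 0 ≤ log B := log_nonneg hB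
  have h2 : 0 ≤ log t := log_nonneg ht
  rw [hlog, inv_inv]
  have h3 : (1 + e / 2) * (1 + e / 2)⁻¹ = 1 := mul_inv_cancel₀ (by positivity)
  have h4 : (1 + e / 2) * (log B + 2 * log t + (1 - (1 + e / 2)⁻¹) * log r) =
      (1 + e / 2) * (log B + 2 * log t) + e / 2 * log r := by
    linear_combination (-log r) * h3
  rw [h4]
  have h5 : (1 + e / 2) * (log B + 2 * log t) ≤ 2 * (log B + 2 * log t) :=
    mul_le_mul_of_nonneg_right (by linarith) (by linarith)
  linarith

theorem eventually_proximity_logDeriv_le {φ : ℂ → ℂ} (hφ : Meromorphic φ)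
    (hne : ∀ z, meromorphicOrderAt φ z ≠ ⊤) {ε : ℝ} (hε : 0 < ε) :
    ∀ᶠ r in cofiniteMeasure, proximity (logDeriv φ) ⊤ r ≤
      4 * log (characteristic φ ⊤ r + 2) + ε * log r := by
  obtain ⟨e, he0, he1, heε⟩ : ∃ e : ℝ, 0 < e ∧ e ≤ 1 ∧ e ≤ ε :=
    ⟨min ε 1, lt_min hε one_pos, min_le_right _ _, min_le_left _ _⟩
  have hα : 0 < (1 + e / 2)⁻¹ := by positivity
  have hα1 : (1 + e / 2)⁻¹ < 1 := inv_lt_one_of_one_lt₀ (by linarith)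
  obtain ⟨K, hK0, hK⟩ := exists_circleAverage_norm_sub_rpow_neg_le hα hα1
  obtain ⟨c, hc0, hc⟩ := exists_characteristic_inv_le hφ
  have hT2 : ∀ r, 1 ≤ r → 2 ≤ characteristic φ ⊤ r + 2 := fun r hr => by
    have : 0 ≤ characteristic φ ⊤ r := characteristic_nonneg hr
    linarith
  have hTm : MonotoneOn (fun r => characteristic φ ⊤ r + 2) (Ici 1) := fun r hr s _ hrs =>
    add_le_add_left (characteristic_mono hφ hr hrs) 2
  obtain ⟨B, hB⟩ : ∃ B, B = 2 + 8 * (4 + c) + 16 * K * (4 + c) := ⟨_, rfl⟩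
  have hB1 : 1 ≤ B := by
    have : 0 ≤ K * (4 + c) := by positivity
    linarith
  have hev : {r | 1 ≤ r ∧ 2 * (characteristic φ ⊤ r + 2) <
      characteristic φ ⊤ (r + 1 / (characteristic φ ⊤ r + 2)) + 2}ᶜ ∈ cofiniteMeasure := by
    rw [mem_cofiniteMeasure, compl_compl]
    exact (measure_mono inter_subset_left).trans_lt (volume_borel_exceptional_lt_top hTm hT2)
  have hlarge : ∀ᶠ r : ℝ in cofiniteMeasure, 2 * log B ≤ e / 2 * log r :=
    cofiniteMeasure_le_atTop ((tendsto_log_atTop.const_mul_atTop (by positivity :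
      0 < e / 2)).eventually_ge_atTop _)
  filter_upwards [hev, hlarge, cofiniteMeasure_le_atTop (eventually_ge_atTop 1)] with r hr1 hr2 hr
  have hr0 : 0 < r := by linarith
  have hTr := hT2 r hr
  obtain ⟨t, ht⟩ : ∃ t, t = characteristic φ ⊤ r + 2 := ⟨_, rfl⟩
  obtain ⟨δ, hδ⟩ : ∃ δ, δ = 1 / t := ⟨_, rfl⟩
  have hbor : characteristic φ ⊤ (r + δ) + 2 ≤ 2 * t := by
    by_contra hcon
    rw [hδ, ht] at hcon
    exact hr1 ⟨hr, not_le.1 hcon⟩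
  rw [← ht] at hTr ⊢
  have ht0 : 0 < t := by linarith
  have hδ0 : 0 < δ := by rw [hδ]; positivity
  have hδ1 : δ ≤ 1 := by
    rw [hδ, div_le_one ht0]
    linarith
  have htδ : t * δ = 1 := by
    rw [hδ]
    field_simp
  obtain ⟨R, hR, hS⟩ := exists_radius_order_eq_zero hφ hne
    (show r + δ / 4 < r + δ / 2 by linarith)
  have hRr : r < R := by linarith [hR.1]
  have hR1 : 1 ≤ R := by linarith
  have hRρ : R < r + δ := by linarith [hR.2]
  have hbd : ∀ s, 1 ≤ s → s ≤ r + δ →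
      characteristic φ ⊤ s + characteristic φ⁻¹ ⊤ s ≤ (4 + c) * t := by
    intro s h1 h2
    have h3 := hc s
    have h4 : c ≤ c * t := le_mul_of_one_le_right hc0 (by linarith)
    have h5 := characteristic_mono hφ h1 h2
    linarith
  have hn0 : 0 ≤ ∑ᶠ u, |(MeromorphicOn.divisor φ (ball 0 R) u : ℝ)| :=
    finsum_nonneg fun _ => abs_nonneg _
  have hA0 : 0 ≤ circleAverage (fun ζ => |log ‖φ ζ‖|) 0 R :=
    circleAverage_nonneg_of_nonneg fun _ _ => abs_nonneg _
  have hnle := le_mul_sq_mul_of_mul_log_le (M := 4 + c) hr ht0 htδ hδ0 hδ1 hRr hR.2 hn0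
    (by linarith) ((finsum_abs_divisor_mul_log_le hφ hR1 hRρ).trans (hbd _ (by linarith) le_rfl))
  have harg := two_add_add_le_mul_sq_mul_rpow hr (by linarith) hα1 (by linarith) hK0 hA0
    (two_mul_div_sq_sub_sq_le hr0 ht0 htδ hδ0 hR.1)
    ((circleAverage_abs_log_norm_le hφ hR1).trans (hbd R hR1 hRρ.le)) hnle
  rw [← hB] at harg
  have h1 : 0 < R ^ 2 - r ^ 2 := by nlinarith
  refine (proximity_logDeriv_le hα hα1 hK hφ hne hr0 hRr hS).trans
    ((mul_le_mul_of_nonneg_left (log_le_log (by positivity) harg) (by positivity)).trans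
    ((inv_mul_log_mul_sq_mul_rpow_le he0 he1 hB1 (by linarith) hr hr2).trans ?_))
  have : e * log r ≤ ε * log r := mul_le_mul_of_nonneg_right heε (log_nonneg hr)
  linarith

theorem log_six_mul_le_sqrt {r : ℝ} (hr : 1 ≤ r) : log (6 * r) ≤ 6 * r ^ (1 / 2 : ℝ) := by
  have h := log_le_rpow_div (show 0 ≤ 6 * r by linarith) (show (0 : ℝ) < 1 / 2 by norm_num)
  refine h.trans ?_
  rw [mul_rpow (by norm_num) (by linarith)]
  have h6 : (6 : ℝ) ^ (1 / 2 : ℝ) ≤ 3 := by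
    rw [← sqrt_eq_rpow, sqrt_le_left (by norm_num)]
    norm_num
  have : 0 ≤ r ^ (1 / 2 : ℝ) := by positivity
  nlinarith

theorem exists_proximity_logDeriv_le_of_log_growth {φ : ℂ → ℂ} (hφ : Meromorphic φ)
    (hne : ∀ z, meromorphicOrderAt φ z ≠ ⊤) {A : ℝ}
    (hA : ∀ᶠ r in atTop, characteristic φ ⊤ r ≤ A * log r) :
    ∃ C : ℝ, ∀ᶠ r in atTop, proximity (logDeriv φ) ⊤ r ≤ C := by
  have hα : (0 : ℝ) < 1 / 2 := by norm_num
  have hα1 : (1 / 2 : ℝ) < 1 := by norm_num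
  obtain ⟨K, hK0, hK⟩ := exists_circleAverage_norm_sub_rpow_neg_le hα hα1
  obtain ⟨c, hc0, hc⟩ := exists_characteristic_inv_le hφ
  set A' := max A 0 with hA'
  obtain ⟨s₀, hs₀⟩ := eventually_atTop.1 hA
  set M := 12 * A' + c with hM
  have hM0 : 0 ≤ M := by positivity
  refine ⟨(1 / 2 : ℝ)⁻¹ * log (2 + 2 * M + 2 * M * (2 * K)), ?_⟩
  filter_upwards [eventually_ge_atTop s₀, eventually_ge_atTop 1] with r hrs hr
  have hr0 : 0 < r := by linarith
  obtain ⟨R, hR, hS⟩ := exists_radius_order_eq_zero hφ hne (show 2 * r < 3 * r by linarith)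
  have hRr : r < R := by linarith [hR.1]
  have hR1 : 1 ≤ R := by linarith
  have hRρ : R < 6 * r := by linarith [hR.2]
  refine (proximity_logDeriv_le hα hα1 hK hφ hne hr0 hRr hS).trans ?_
  have hsq : (1 : ℝ) ≤ r ^ (1 / 2 : ℝ) := one_le_rpow hr (by norm_num)
  have hTs : ∀ s, r ≤ s → s ≤ 6 * r →
      characteristic φ ⊤ s + characteristic φ⁻¹ ⊤ s ≤ M * r ^ (1 / 2 : ℝ) := by
    intro s h1 h2
    have h3 : characteristic φ ⊤ s ≤ A' * log (6 * r) := by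
      refine (characteristic_mono hφ (hr.trans h1) h2).trans
        ((hs₀ (6 * r) (by linarith)).trans ?_)
      exact mul_le_mul_of_nonneg_right (le_max_left _ _) (log_nonneg (by linarith))
    have h4 := hc s
    have h5 : A' * log (6 * r) ≤ A' * (6 * r ^ (1 / 2 : ℝ)) :=
      mul_le_mul_of_nonneg_left (log_six_mul_le_sqrt hr) (le_max_right _ _)
    have h6 : c ≤ c * r ^ (1 / 2 : ℝ) := le_mul_of_one_le_right hc0 hsq
    simp only [hM]
    linarith
  have hA2 := (circleAverage_abs_log_norm_le hφ hR1).trans (hTs R hRr.le hRρ.le)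
  have hA0 : 0 ≤ circleAverage (fun ζ => |log ‖φ ζ‖|) 0 R :=
    circleAverage_nonneg_of_nonneg fun _ _ => abs_nonneg _
  have hRr2 : 0 < R ^ 2 - r ^ 2 := by nlinarith
  have hsqr : r ^ (1 / 2 : ℝ) * r ^ (1 / 2 : ℝ) = r := by
    rw [← rpow_add hr0]
    norm_num
  have hsqi : r ^ (1 / 2 : ℝ) * r ^ (-(1 / 2) : ℝ) = 1 := by
    rw [← rpow_add hr0]
    norm_num
  have e1 : 2 * R / (R ^ 2 - r ^ 2) * circleAverage (fun ζ => |log ‖φ ζ‖|) 0 R ≤ 2 * M := by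
    have h1 : 2 * R / (R ^ 2 - r ^ 2) ≤ 2 / r := by
      rw [div_le_div_iff₀ hRr2 hr0]
      nlinarith [hR.1]
    calc _ ≤ 2 / r * (M * r ^ (1 / 2 : ℝ)) := mul_le_mul h1 hA2 hA0 (by positivity)
      _ ≤ 2 / r * (M * r) := by
          gcongr
          calc r ^ (1 / 2 : ℝ) ≤ r ^ (1 / 2 : ℝ) * r ^ (1 / 2 : ℝ) :=
                le_mul_of_one_le_right (by positivity) hsq
            _ = r := hsqr
      _ = 2 * M := by field_simp
  have e2 : (∑ᶠ u, |(MeromorphicOn.divisor φ (ball 0 R) u : ℝ)|) *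
      (2 * K * r ^ (-(1 / 2) : ℝ)) ≤ 2 * M * (2 * K) := by
    have h1 := (finsum_abs_divisor_mul_log_le hφ hR1 hRρ).trans (hTs (6 * r) (by linarith) le_rfl)
    have h2 : (1 / 2 : ℝ) ≤ log (6 * r / R) := by
      have h4 := one_sub_inv_le_log_of_pos (show 0 < 6 * r / R by positivity)
      refine le_trans ?_ h4
      rw [inv_div, one_sub_div (by positivity), div_le_div_iff₀ (by positivity) (by positivity)]
      nlinarith [hR.2]
    have hn0 : 0 ≤ ∑ᶠ u, |(MeromorphicOn.divisor φ (ball 0 R) u : ℝ)| :=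
      finsum_nonneg fun _ => abs_nonneg _
    have h3 := (mul_le_mul_of_nonneg_left h2 hn0).trans h1
    calc _ ≤ 2 * (M * r ^ (1 / 2 : ℝ)) * (2 * K * r ^ (-(1 / 2) : ℝ)) := by
            gcongr
            linarith
      _ = 2 * M * (2 * K) * (r ^ (1 / 2 : ℝ) * r ^ (-(1 / 2) : ℝ)) := by ring
      _ = _ := by rw [hsqi, mul_one]
  refine mul_le_mul_of_nonneg_left (log_le_log ?_ ?_) (by norm_num)
  · have : 0 ≤ ∑ᶠ u, |(MeromorphicOn.divisor φ (ball 0 R) u : ℝ)| :=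
      finsum_nonneg fun _ => abs_nonneg _
    positivity
  · linarith

end DerivedCurves

end

noncomputable section

namespace DerivedCurves

open Real Filter MeasureTheory Set Topology Metric ValueDistribution

/-! ### Meromorphic functions of moderate growth -/

theorem eventually_codiscrete_iff {p : ℂ → Prop} :
    (∀ᶠ z in codiscrete ℂ, p z) ↔ ∀ x, ∀ᶠ z in 𝓝[≠] x, p z := by
  simp only [Filter.Eventually, mem_codiscrete, disjoint_principal_right, compl_compl]

theorem eventuallyEq_zero_or_meromorphicOrderAt_ne_top {φ : ℂ → ℂ} (hφ : Meromorphic φ) :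
    φ =ᶠ[codiscrete ℂ] 0 ∨ ∀ z, meromorphicOrderAt φ z ≠ ⊤ := by
  by_cases h : ∃ u, meromorphicOrderAt φ u ≠ ⊤
  · exact Or.inr (hφ.exists_meromorphicOrderAt_ne_top_iff_forall.1 h)
  · push Not at h
    exact Or.inl (eventually_codiscrete_iff.2 fun x => meromorphicOrderAt_eq_top_iff.1 (h x))

theorem eventually_ne_zero_of_meromorphicOrderAt_ne_top {φ : ℂ → ℂ} (hφ : Meromorphic φ)
    (h : ∀ z, meromorphicOrderAt φ z ≠ ⊤) : ∀ᶠ z in codiscrete ℂ, φ z ≠ 0 :=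
  eventually_codiscrete_iff.2 fun x =>
    (meromorphicOrderAt_ne_top_iff_eventually_ne_zero (hφ x)).1 (h x)

theorem eventually_analyticAt_codiscrete {φ : ℂ → ℂ} (hφ : Meromorphic φ) :
    ∀ᶠ z in codiscrete ℂ, AnalyticAt ℂ φ z :=
  eventually_codiscrete_iff.2 fun x => (hφ x).eventually_analyticAt

theorem eventuallyEq_deriv_codiscrete {φ ψ : ℂ → ℂ} (h : φ =ᶠ[codiscrete ℂ] ψ) :
    deriv φ =ᶠ[codiscrete ℂ] deriv ψ := by
  refine eventually_codiscrete_iff.2 fun x => ?_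
  exact EventuallyEq.nhdsNE_deriv (eventually_codiscrete_iff.1 h x)

theorem logCounting_deriv_top_le {φ : ℂ → ℂ} (hφ : Meromorphic φ)
    (hne : ∀ z, meromorphicOrderAt φ z ≠ ⊤) {r : ℝ} (hr : 1 ≤ r) :
    logCounting (deriv φ) ⊤ r ≤ 2 * logCounting φ ⊤ r := by
  have hD : (MeromorphicOn.divisor (deriv φ) univ)⁻ ≤ 2 • (MeromorphicOn.divisor φ univ)⁻ := by
    intro z
    have hz : (MeromorphicOn.divisor (deriv φ) univ)⁻ z =
        (MeromorphicOn.divisor (deriv φ) univ z)⁻ := rfl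
    have hz' : (2 • (MeromorphicOn.divisor φ univ)⁻) z =
        2 * (MeromorphicOn.divisor φ univ z)⁻ := by
      rw [two_smul, two_mul]; rfl
    rw [hz, hz', MeromorphicOn.divisor_apply hφ.meromorphicOn (mem_univ z),
      MeromorphicOn.divisor_apply hφ.deriv.meromorphicOn (mem_univ z)]
    obtain ⟨m, hm⟩ := WithTop.ne_top_iff_exists.1 (hne z)
    rcases lt_or_ge m 0 with h | h
    · rw [meromorphicOrderAt_deriv_eq_sub_one (by exact_mod_cast h.ne) hm.symm, ← hm]
      simp only [WithTop.untop₀_coe, negPart_def]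
      omega
    · have hA : 0 ≤ meromorphicOrderAt φ z := by rw [← hm]; exact_mod_cast h
      obtain ⟨g, hg, hgz⟩ := (MeromorphicAt.meromorphicOrderAt_nonneg_iff (hφ z)).1 hA
      have h1 : 0 ≤ meromorphicOrderAt (deriv φ) z := by
        refine (MeromorphicAt.meromorphicOrderAt_nonneg_iff (hφ.deriv z)).2
          ⟨deriv g, hg.deriv, hgz.nhdsNE_deriv⟩
      have h2 : 0 ≤ (meromorphicOrderAt (deriv φ) z).untop₀ := WithTop.untop₀_nonneg.2 h1
      rw [negPart_eq_zero.2 h2]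
      positivity
  have := Function.locallyFinsuppWithin.logCounting_le hD hr
  rw [map_nsmul] at this
  rw [logCounting_top, logCounting_top]
  simpa using this

/-- A growth function `T` together with a notion of functions that are negligible in
comparison with `T`, for which the lemma on the logarithmic derivative holds. -/
structure Gauge where
  filter : Filter ℝ
  T : ℝ → ℝ
  Small : (ℝ → ℝ) → Prop
  filter_le : filter ≤ atTop
  le_T : ∀ c, ∀ᶠ r in filter, c ≤ T r
  small_const : ∀ c, Small fun _ => c
  small_add : ∀ {s t}, Small s → Small t → Small (s + t)
  small_mono : ∀ {s t}, Small s → (∀ᶠ r in filter, t r ≤ s r) → Small t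
  small_le : ∀ {s}, Small s → ∃ C, ∀ᶠ r in filter, s r ≤ C * T r
  small_logDeriv : ∀ {φ : ℂ → ℂ}, Meromorphic φ → (∀ z, meromorphicOrderAt φ z ≠ ⊤) →
    (∃ C, ∀ᶠ r in filter, characteristic φ ⊤ r ≤ C * T r) → Small (proximity (logDeriv φ) ⊤)

theorem log_ge_of_eventually_le {T : ℝ → ℝ} (h : ∃ c, ∀ᶠ r in atTop, log r - c ≤ T r) (c : ℝ) :
    ∀ᶠ r in atTop, c ≤ T r := by
  obtain ⟨c', hc'⟩ := h
  filter_upwards [hc', tendsto_log_atTop.eventually_ge_atTop (c + c')] with r h1 h2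
  linarith

/-- The gauge with exceptional sets of finite measure. -/
def nevanlinnaGauge (T : ℝ → ℝ) (h : ∃ c, ∀ᶠ r in atTop, log r - c ≤ T r) : Gauge where
  filter := cofiniteMeasure
  T := T
  Small s := ∃ C, ∀ ε > 0, ∀ᶠ r in cofiniteMeasure, s r ≤ C * log (T r) + ε * log r
  filter_le := cofiniteMeasure_le_atTop
  le_T c := cofiniteMeasure_le_atTop (log_ge_of_eventually_le h c)
  small_const c := ⟨0, fun ε hε => cofiniteMeasure_le_atTop (by
    filter_upwards [(tendsto_log_atTop.const_mul_atTop hε).eventually_ge_atTop c] with r hr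
    linarith)⟩
  small_add := by
    rintro s t ⟨C, hC⟩ ⟨D, hD⟩
    refine ⟨C + D, fun ε hε => ?_⟩
    filter_upwards [hC (ε / 2) (by linarith), hD (ε / 2) (by linarith)] with r h1 h2
    simp only [Pi.add_apply]
    linarith
  small_mono := by
    rintro s t ⟨C, hC⟩ hst
    refine ⟨C, fun ε hε => ?_⟩
    filter_upwards [hC ε hε, hst] with r h1 h2
    linarith
  small_le := by
    rintro s ⟨C, hC⟩
    obtain ⟨c, hc⟩ := id h
    refine ⟨|C| + 1 + |c|, ?_⟩
    filter_upwards [hC 1 one_pos, cofiniteMeasure_le_atTop hc,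
      cofiniteMeasure_le_atTop (log_ge_of_eventually_le h 1)] with r h1 h2 h3
    have h4 : 0 ≤ log (T r) := log_nonneg h3
    have h5 : log (T r) ≤ T r := (log_le_sub_one_of_pos (by linarith)).trans (by linarith)
    have h6 : C * log (T r) ≤ |C| * T r :=
      (mul_le_mul_of_nonneg_right (le_abs_self C) h4).trans
        (mul_le_mul_of_nonneg_left h5 (abs_nonneg C))
    have h7 : c ≤ |c| * T r := (le_abs_self c).trans (le_mul_of_one_le_right (abs_nonneg c) h3)
    linarith
  small_logDeriv := by
    rintro φ hφ hne ⟨C, hC⟩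
    refine ⟨4, fun ε hε => ?_⟩
    have h0 : ∀ᶠ r in cofiniteMeasure, 4 * log (|C| + 2) ≤ ε / 2 * log r :=
      cofiniteMeasure_le_atTop
        ((tendsto_log_atTop.const_mul_atTop (half_pos hε)).eventually_ge_atTop _)
    filter_upwards [hC, eventually_proximity_logDeriv_le hφ hne (half_pos hε), h0,
      cofiniteMeasure_le_atTop (log_ge_of_eventually_le h 1),
      cofiniteMeasure_le_atTop (eventually_ge_atTop 1)] with r h1 h2 h3 h4 h5
    have h6 : 0 ≤ characteristic φ ⊤ r := characteristic_nonneg h5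
    have h7 : characteristic φ ⊤ r + 2 ≤ (|C| + 2) * T r := by
      have : C * T r ≤ |C| * T r := mul_le_mul_of_nonneg_right (le_abs_self C) (by linarith)
      linarith
    have h8 : log (characteristic φ ⊤ r + 2) ≤ log (|C| + 2) + log (T r) := by
      rw [← log_mul (by positivity) (by linarith)]
      exact log_le_log (by linarith) h7
    linarith

/-- The gauge without exceptional sets, for growth functions of logarithmic order. -/
def logarithmicGauge (T : ℝ → ℝ) (h : ∃ c, ∀ᶠ r in atTop, log r - c ≤ T r)
    (h' : ∃ A, ∀ᶠ r in atTop, T r ≤ A * log r) : Gauge where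
  filter := atTop
  T := T
  Small s := ∃ C, ∀ᶠ r in atTop, s r ≤ C
  filter_le := le_rfl
  le_T c := log_ge_of_eventually_le h c
  small_const c := ⟨c, Eventually.of_forall fun _ => le_rfl⟩
  small_add := by
    rintro s t ⟨C, hC⟩ ⟨D, hD⟩
    refine ⟨C + D, ?_⟩
    filter_upwards [hC, hD] with r h1 h2 using add_le_add h1 h2
  small_mono := by
    rintro s t ⟨C, hC⟩ hst
    refine ⟨C, ?_⟩
    filter_upwards [hC, hst] with r h1 h2
    linarith
  small_le := by
    rintro s ⟨C, hC⟩
    refine ⟨|C|, ?_⟩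
    filter_upwards [hC, log_ge_of_eventually_le h 1] with r h1 h2
    exact h1.trans ((le_abs_self C).trans (le_mul_of_one_le_right (abs_nonneg C) h2))
  small_logDeriv := by
    rintro φ hφ hne ⟨C, hC⟩
    obtain ⟨A, hA⟩ := h'
    refine exists_proximity_logDeriv_le_of_log_growth hφ hne (A := |C| * A) ?_
    filter_upwards [hC, hA, log_ge_of_eventually_le h 0] with r h1 h2 h3
    calc _ ≤ C * T r := h1
      _ ≤ |C| * T r := mul_le_mul_of_nonneg_right (le_abs_self C) h3
      _ ≤ |C| * (A * log r) := mul_le_mul_of_nonneg_left h2 (abs_nonneg C)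
      _ = _ := by ring

namespace Gauge

variable (𝔤 : Gauge)

/-- Meromorphic functions whose characteristic is bounded by a multiple of the gauge. -/
structure Moderate (φ : ℂ → ℂ) : Prop where
  meromorphic : Meromorphic φ
  bound : ∃ C, ∀ᶠ r in 𝔤.filter, characteristic φ ⊤ r ≤ C * 𝔤.T r

/-- Functions of moderate growth whose proximity function is negligible. -/
structure Slow (φ : ℂ → ℂ) : Prop where
  moderate : 𝔤.Moderate φ
  small : 𝔤.Small (proximity φ ⊤)

variable {𝔤} {φ ψ : ℂ → ℂ}

theorem eventually_ge (c : ℝ) : ∀ᶠ r in 𝔤.filter, c ≤ r :=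
  𝔤.filter_le (eventually_ge_atTop c)

theorem Moderate.of_le (hφ : Meromorphic φ) {C c : ℝ}
    (h : ∀ᶠ r in 𝔤.filter, characteristic φ ⊤ r ≤ C * 𝔤.T r + c) : 𝔤.Moderate φ := by
  refine ⟨hφ, C + |c|, ?_⟩
  filter_upwards [h, 𝔤.le_T 1] with r h1 h2
  have : c ≤ |c| * 𝔤.T r := (le_abs_self c).trans (le_mul_of_one_le_right (abs_nonneg c) h2)
  linarith

theorem Moderate.congr (hφ : 𝔤.Moderate φ) (h : φ =ᶠ[codiscrete ℂ] ψ) : 𝔤.Moderate ψ := by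
  obtain ⟨C, hC⟩ := hφ.bound
  refine ⟨hφ.meromorphic.congr_codiscrete h, C, ?_⟩
  filter_upwards [hC, eventually_ge 1] with r h1 h2
  rwa [← characteristic_congr_codiscrete h (by linarith)]

theorem Slow.congr (hφ : 𝔤.Slow φ) (h : φ =ᶠ[codiscrete ℂ] ψ) : 𝔤.Slow ψ := by
  refine ⟨hφ.moderate.congr h, 𝔤.small_mono hφ.small ?_⟩
  filter_upwards [eventually_ge 1] with r h2
  rw [proximity_congr_codiscrete h (by linarith)]

theorem moderate_const (c : ℂ) : 𝔤.Moderate fun _ => c :=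
  Moderate.of_le (Meromorphic.const c) (C := 0) (c := log⁺ ‖c‖) <| Eventually.of_forall fun r => by
    simp [characteristic]

theorem slow_const (c : ℂ) : 𝔤.Slow fun _ => c :=
  ⟨moderate_const c, 𝔤.small_mono (𝔤.small_const (log⁺ ‖c‖)) <| Eventually.of_forall fun r => by
    simp⟩

theorem Moderate.add (hφ : 𝔤.Moderate φ) (hψ : 𝔤.Moderate ψ) : 𝔤.Moderate (φ + ψ) := by
  obtain ⟨C, hC⟩ := hφ.bound
  obtain ⟨D, hD⟩ := hψ.bound
  refine Moderate.of_le (hφ.meromorphic.add hψ.meromorphic) (C := C + D) (c := log 2) ?_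
  filter_upwards [hC, hD, eventually_ge 1] with r h1 h2 h3
  have := characteristic_add_top_le hφ.meromorphic hψ.meromorphic h3
  linarith

theorem moderate_zero : 𝔤.Moderate 0 := moderate_const 0

theorem slow_zero : 𝔤.Slow 0 := slow_const 0

theorem Moderate.mul (hφ : 𝔤.Moderate φ) (hψ : 𝔤.Moderate ψ) : 𝔤.Moderate (φ * ψ) := by
  rcases eventuallyEq_zero_or_meromorphicOrderAt_ne_top hφ.meromorphic with h | h
  · refine moderate_zero.congr ?_
    filter_upwards [h] with z hz
    simp [hz]
  rcases eventuallyEq_zero_or_meromorphicOrderAt_ne_top hψ.meromorphic with h' | h'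
  · refine moderate_zero.congr ?_
    filter_upwards [h'] with z hz
    simp [hz]
  obtain ⟨C, hC⟩ := hφ.bound
  obtain ⟨D, hD⟩ := hψ.bound
  refine ⟨hφ.meromorphic.mul hψ.meromorphic, C + D, ?_⟩
  filter_upwards [hC, hD, eventually_ge 1] with r h1 h2 h3
  have := characteristic_mul_top_le h3 hφ.meromorphic h hψ.meromorphic h'
  simp only [Pi.add_apply] at this
  linarith

theorem Slow.add (hφ : 𝔤.Slow φ) (hψ : 𝔤.Slow ψ) : 𝔤.Slow (φ + ψ) :=
  ⟨hφ.moderate.add hψ.moderate,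
    𝔤.small_mono (𝔤.small_add (𝔤.small_add hφ.small hψ.small) (𝔤.small_const (log 2)))
      (Eventually.of_forall fun r =>
        proximity_add_top_le hφ.moderate.meromorphic hψ.moderate.meromorphic r)⟩

theorem Slow.mul (hφ : 𝔤.Slow φ) (hψ : 𝔤.Slow ψ) : 𝔤.Slow (φ * ψ) :=
  ⟨hφ.moderate.mul hψ.moderate, 𝔤.small_mono (𝔤.small_add hφ.small hψ.small)
      (Eventually.of_forall fun r =>
        proximity_mul_top_le hφ.moderate.meromorphic hψ.moderate.meromorphic r)⟩

theorem Moderate.inv (hφ : 𝔤.Moderate φ) : 𝔤.Moderate φ⁻¹ := by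
  obtain ⟨C, hC⟩ := hφ.bound
  obtain ⟨c, -, hc⟩ := exists_characteristic_inv_le hφ.meromorphic
  refine Moderate.of_le hφ.meromorphic.inv (C := C) (c := c) ?_
  filter_upwards [hC] with r h1
  linarith [hc r]

theorem Moderate.small_logDeriv (hφ : 𝔤.Moderate φ) : 𝔤.Small (proximity (logDeriv φ) ⊤) := by
  rcases eventuallyEq_zero_or_meromorphicOrderAt_ne_top hφ.meromorphic with h | h
  · refine 𝔤.small_mono (𝔤.small_const 0) ?_
    have h' : logDeriv φ =ᶠ[codiscrete ℂ] fun _ => 0 := by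
      filter_upwards [h] with z hz
      simp [logDeriv_apply, hz]
    filter_upwards [eventually_ge 1] with r hr
    rw [proximity_congr_codiscrete h' (by linarith)]
    simp
  · exact 𝔤.small_logDeriv hφ.meromorphic h hφ.bound

theorem Moderate.deriv (hφ : 𝔤.Moderate φ) : 𝔤.Moderate (deriv φ) := by
  rcases eventuallyEq_zero_or_meromorphicOrderAt_ne_top hφ.meromorphic with h | h
  · refine moderate_zero.congr ?_
    have := eventuallyEq_deriv_codiscrete h
    filter_upwards [this] with z hz
    rw [hz]
    simp
  obtain ⟨C, hC⟩ := hφ.bound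
  obtain ⟨D, hD⟩ := 𝔤.small_le hφ.small_logDeriv
  have h1 : _root_.deriv φ =ᶠ[codiscrete ℂ] φ * logDeriv φ := by
    filter_upwards [eventually_ne_zero_of_meromorphicOrderAt_ne_top hφ.meromorphic h] with z hz
    simp only [Pi.mul_apply, logDeriv_apply]
    field_simp
  have hmd : Meromorphic (logDeriv φ) := hφ.meromorphic.deriv.div hφ.meromorphic
  refine ⟨hφ.meromorphic.deriv, 2 * C + D, ?_⟩
  filter_upwards [hC, hD, eventually_ge 1] with r h2 h3 h4
  have h5 := proximity_mul_top_le hφ.meromorphic hmd r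
  have h6 := logCounting_deriv_top_le hφ.meromorphic h h4
  have h7 : 0 ≤ proximity φ ⊤ r := proximity_nonneg r
  simp only [characteristic, Pi.add_apply] at h2 h5 ⊢
  rw [proximity_congr_codiscrete h1 (by linarith)]
  linarith

theorem Moderate.slow_logDeriv (hφ : 𝔤.Moderate φ) : 𝔤.Slow (logDeriv φ) :=
  ⟨hφ.deriv.mul hφ.inv, hφ.small_logDeriv⟩

theorem Slow.deriv (hφ : 𝔤.Slow φ) : 𝔤.Slow (_root_.deriv φ) := by
  refine ⟨hφ.moderate.deriv, ?_⟩
  rcases eventuallyEq_zero_or_meromorphicOrderAt_ne_top hφ.moderate.meromorphic with h | h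
  · refine (slow_zero.congr ?_).small
    filter_upwards [eventuallyEq_deriv_codiscrete h] with z hz
    rw [hz]
    simp
  have h1 : φ * logDeriv φ =ᶠ[codiscrete ℂ] _root_.deriv φ := by
    filter_upwards [eventually_ne_zero_of_meromorphicOrderAt_ne_top hφ.moderate.meromorphic h]
      with z hz
    simp only [Pi.mul_apply, logDeriv_apply]
    field_simp
  refine 𝔤.small_mono (𝔤.small_add hφ.small hφ.moderate.small_logDeriv) ?_
  filter_upwards [eventually_ge 1] with r hr
  rw [← proximity_congr_codiscrete h1 (by linarith)]
  exact proximity_mul_top_le hφ.moderate.meromorphic hφ.moderate.slow_logDeriv.moderate.meromorphic r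

theorem Moderate.sum {ι : Type*} (s : Finset ι) {f : ι → ℂ → ℂ} (h : ∀ i ∈ s, 𝔤.Moderate (f i)) :
    𝔤.Moderate (∑ i ∈ s, f i) :=
  Finset.sum_induction f 𝔤.Moderate (fun _ _ => Moderate.add) moderate_zero h

theorem Slow.sum {ι : Type*} (s : Finset ι) {f : ι → ℂ → ℂ} (h : ∀ i ∈ s, 𝔤.Slow (f i)) :
    𝔤.Slow (∑ i ∈ s, f i) :=
  Finset.sum_induction f 𝔤.Slow (fun _ _ => Slow.add) slow_zero h

theorem Moderate.prod {ι : Type*} (s : Finset ι) {f : ι → ℂ → ℂ} (h : ∀ i ∈ s, 𝔤.Moderate (f i)) :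
    𝔤.Moderate (∏ i ∈ s, f i) :=
  Finset.prod_induction f 𝔤.Moderate (fun _ _ => Moderate.mul) (moderate_const 1) h

theorem Slow.prod {ι : Type*} (s : Finset ι) {f : ι → ℂ → ℂ} (h : ∀ i ∈ s, 𝔤.Slow (f i)) :
    𝔤.Slow (∏ i ∈ s, f i) :=
  Finset.prod_induction f 𝔤.Slow (fun _ _ => Slow.mul) (slow_const 1) h

theorem Moderate.det {ι : Type*} [Fintype ι] [DecidableEq ι] {M : ι → ι → ℂ → ℂ}
    (h : ∀ i j, 𝔤.Moderate (M i j)) :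
    𝔤.Moderate fun z => (Matrix.of fun i j => M i j z).det := by
  have : (fun z => (Matrix.of fun i j => M i j z).det) =
      ∑ σ : Equiv.Perm ι, (fun _ => ((Equiv.Perm.sign σ : ℤ) : ℂ)) * ∏ i, M (σ i) i := by
    ext z
    simp [Matrix.det_apply', Finset.sum_apply, Finset.prod_apply]
  rw [this]
  exact Moderate.sum _ fun σ _ => (moderate_const _).mul (Moderate.prod _ fun i _ => h _ _)

theorem Slow.det {ι : Type*} [Fintype ι] [DecidableEq ι] {M : ι → ι → ℂ → ℂ}
    (h : ∀ i j, 𝔤.Slow (M i j)) :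
    𝔤.Slow fun z => (Matrix.of fun i j => M i j z).det := by
  have : (fun z => (Matrix.of fun i j => M i j z).det) =
      ∑ σ : Equiv.Perm ι, (fun _ => ((Equiv.Perm.sign σ : ℤ) : ℂ)) * ∏ i, M (σ i) i := by
    ext z
    simp [Matrix.det_apply', Finset.sum_apply, Finset.prod_apply]
  rw [this]
  exact Slow.sum _ fun σ _ => (slow_const _).mul (Slow.prod _ fun i _ => h _ _)

end Gauge

end DerivedCurves

end

noncomputable section

namespace DerivedCurves

open Real Filter MeasureTheory Set Topology Metric ValueDistribution

/-! ### Generalised Wronskians -/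

/-- The determinant of the matrix of the derivatives of orders `J j` of the functions `h i`. -/
def wr {m : ℕ} (J : Fin m → ℕ) (h : Fin m → ℂ → ℂ) (z : ℂ) : ℂ :=
  (Matrix.of fun i j => iteratedDeriv (J j) (h i) z).det

/-- The operators in the factorisation of a linear differential operator annihilating `h`. -/
def factorOp (h : ℕ → ℂ → ℂ) : ℕ → (ℂ → ℂ) → ℂ → ℂ
  | 0, y => y
  | j + 1, y => deriv (factorOp h j y) - logDeriv (factorOp h j (h j)) * factorOp h j y

/-- The coefficients in the expansion of the `s`-th derivative in terms of `factorOp`. -/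
def factorCoeff (h : ℕ → ℂ → ℂ) : ℕ → ℕ → ℂ → ℂ
  | 0, 0 => 1
  | 0, _ + 1 => 0
  | s + 1, 0 => deriv (factorCoeff h s 0) + factorCoeff h s 0 * logDeriv (factorOp h 0 (h 0))
  | s + 1, j + 1 => deriv (factorCoeff h s (j + 1)) +
      factorCoeff h s (j + 1) * logDeriv (factorOp h (j + 1) (h (j + 1))) + factorCoeff h s j

theorem meromorphic_factorOp {h : ℕ → ℂ → ℂ} (hh : ∀ i, Meromorphic (h i)) (j : ℕ) {y : ℂ → ℂ}
    (hy : Meromorphic y) : Meromorphic (factorOp h j y) := by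
  induction j generalizing y with
  | zero => exact hy
  | succ j ih =>
    have h1 := ih (hh j)
    exact (ih hy).deriv.sub ((h1.deriv.div h1).mul (ih hy))

theorem factorOp_eventuallyEq_zero {h : ℕ → ℂ → ℂ} (hh : ∀ i, Meromorphic (h i)) {i j : ℕ}
    (hij : i < j) : factorOp h j (h i) =ᶠ[codiscrete ℂ] 0 := by
  induction j with
  | zero => omega
  | succ j ih =>
    rcases eventuallyEq_zero_or_meromorphicOrderAt_ne_top
      (meromorphic_factorOp hh j (hh i)) with h0 | h0
    · filter_upwards [h0, eventuallyEq_deriv_codiscrete h0] with z h1 h2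
      simp [factorOp, h1, h2]
    · have hne := eventually_ne_zero_of_meromorphicOrderAt_ne_top
        (meromorphic_factorOp hh j (hh i)) h0
      rcases (Nat.lt_succ_iff.1 hij).eq_or_lt with rfl | hlt
      · filter_upwards [hne] with z hz
        simp only [factorOp, Pi.sub_apply, Pi.mul_apply, logDeriv_apply, Pi.zero_apply]
        field_simp
        ring
      · filter_upwards [ih hlt, eventuallyEq_deriv_codiscrete (ih hlt)] with z h1 h2
        simp [factorOp, h1, h2]

theorem meromorphic_factorCoeff {h : ℕ → ℂ → ℂ} (hh : ∀ i, Meromorphic (h i)) (s j : ℕ) :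
    Meromorphic (factorCoeff h s j) := by
  have hl : ∀ j, Meromorphic (logDeriv (factorOp h j (h j))) := fun j =>
    (meromorphic_factorOp hh j (hh j)).deriv.div (meromorphic_factorOp hh j (hh j))
  induction s generalizing j with
  | zero =>
    cases j with
    | zero => exact Meromorphic.const 1
    | succ j => exact Meromorphic.const 0
  | succ s ih =>
    cases j with
    | zero => exact (ih 0).deriv.add ((ih 0).mul (hl 0))
    | succ j => exact ((ih _).deriv.add ((ih _).mul (hl _))).add (ih j)

theorem factorCoeff_of_lt {h : ℕ → ℂ → ℂ} {s j : ℕ} (hsj : s < j) : factorCoeff h s j = 0 := by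
  induction s generalizing j with
  | zero =>
    cases j with
    | zero => omega
    | succ j => rfl
  | succ s ih =>
    cases j with
    | zero => omega
    | succ j =>
      rw [factorCoeff, ih (by omega), ih (by omega)]
      ext z
      simp

theorem factorCoeff_self {h : ℕ → ℂ → ℂ} (s : ℕ) : factorCoeff h s s = 1 := by
  induction s with
  | zero => rfl
  | succ s ih =>
    rw [factorCoeff, ih, factorCoeff_of_lt (Nat.lt_succ_self s)]
    ext z
    simp

theorem sum_range_mul_succ_eq (m : ℕ) (b b' l D D' : ℕ → ℂ) (c : ℕ → ℂ)
    (hD : ∀ j, D' j = D (j + 1) + l j * D j) (hm : D m = 0)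
    (hc0 : c 0 = b' 0 + b 0 * l 0) (hc : ∀ j, c (j + 1) = b' (j + 1) + b (j + 1) * l (j + 1) + b j) :
    ∑ j ∈ Finset.range m, (b' j * D j + b j * D' j) = ∑ j ∈ Finset.range m, c j * D j := by
  have hc' : ∀ j, c j = (b' j + b j * l j) + (if j = 0 then 0 else b (j - 1)) := by
    intro j
    cases j with
    | zero => simp [hc0]
    | succ j => simp [hc]
  have h1 := Finset.sum_range_succ (fun j => (if j = 0 then 0 else b (j - 1)) * D j) m
  rw [Finset.sum_range_succ'] at h1
  simp only [Nat.add_eq_zero_iff, one_ne_zero, and_false, if_false, Nat.add_sub_cancel, if_true,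
    zero_mul, add_zero, hm, mul_zero] at h1
  simp only [hc', add_mul _ (ite _ _ _), Finset.sum_add_distrib, ← h1, hD]
  simp only [← Finset.sum_add_distrib]
  exact Finset.sum_congr rfl fun j _ => by ring

theorem iteratedDeriv_eventuallyEq_sum {h : ℕ → ℂ → ℂ} (hh : ∀ i, Meromorphic (h i)) {y : ℂ → ℂ}
    (hy : Meromorphic y) {m : ℕ} (hm : 0 < m) (hym : factorOp h m y =ᶠ[codiscrete ℂ] 0) (s : ℕ) :
    ∀ᶠ z in codiscrete ℂ,
      iteratedDeriv s y z = ∑ j ∈ Finset.range m, factorCoeff h s j z * factorOp h j y z := by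
  induction s with
  | zero =>
    refine Eventually.of_forall fun z => ?_
    rw [Finset.sum_eq_single_of_mem 0 (Finset.mem_range.2 hm)]
    · simp [factorCoeff, factorOp]
    · intro j _ hj
      rw [factorCoeff_of_lt (Nat.pos_of_ne_zero hj)]
      simp
  | succ s ih =>
    have hd : ∀ᶠ z in codiscrete ℂ, ∀ j ∈ Finset.range m,
        AnalyticAt ℂ (factorCoeff h s j) z ∧ AnalyticAt ℂ (factorOp h j y) z :=
      (Finset.eventually_all _).2 fun j _ =>
        (eventually_analyticAt_codiscrete (meromorphic_factorCoeff hh s j)).and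
          (eventually_analyticAt_codiscrete (meromorphic_factorOp hh j hy))
    filter_upwards [eventuallyEq_deriv_codiscrete ih, hd, hym] with z h1 h2 h3
    rw [iteratedDeriv_succ, h1]
    have h4 : deriv (fun z => ∑ j ∈ Finset.range m, factorCoeff h s j z * factorOp h j y z) z =
        ∑ j ∈ Finset.range m, (deriv (factorCoeff h s j) z * factorOp h j y z +
          factorCoeff h s j z * deriv (factorOp h j y) z) := by
      rw [deriv_fun_sum fun j hj => ((h2 j hj).1.differentiableAt.fun_mul (h2 j hj).2.differentiableAt)]
      exact Finset.sum_congr rfl fun j hj =>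
        deriv_fun_mul (h2 j hj).1.differentiableAt (h2 j hj).2.differentiableAt
    rw [h4]
    refine sum_range_mul_succ_eq m (fun j => factorCoeff h s j z)
      (fun j => deriv (factorCoeff h s j) z) (fun j => logDeriv (factorOp h j (h j)) z)
      (fun j => factorOp h j y z) (fun j => deriv (factorOp h j y) z)
      (fun j => factorCoeff h (s + 1) j z) (fun j => ?_) h3 rfl fun j => rfl
    simp [factorOp]

namespace Gauge

variable {𝔤 : Gauge}

theorem Moderate.neg {φ : ℂ → ℂ} (hφ : 𝔤.Moderate φ) : 𝔤.Moderate (-φ) := by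
  have : -φ = (fun _ => -1) * φ := by
    ext z
    simp
  rw [this]
  exact (moderate_const _).mul hφ

theorem Moderate.sub {φ ψ : ℂ → ℂ} (hφ : 𝔤.Moderate φ) (hψ : 𝔤.Moderate ψ) :
    𝔤.Moderate (φ - ψ) := by
  rw [sub_eq_add_neg]
  exact hφ.add hψ.neg

theorem Moderate.div {φ ψ : ℂ → ℂ} (hφ : 𝔤.Moderate φ) (hψ : 𝔤.Moderate ψ) :
    𝔤.Moderate (φ / ψ) := by
  rw [div_eq_mul_inv]
  exact hφ.mul hψ.inv

theorem Moderate.iteratedDeriv {φ : ℂ → ℂ} (hφ : 𝔤.Moderate φ) (s : ℕ) :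
    𝔤.Moderate (iteratedDeriv s φ) := by
  induction s with
  | zero => simpa using hφ
  | succ s ih =>
    rw [iteratedDeriv_succ]
    exact ih.deriv

theorem moderate_factorOp {h : ℕ → ℂ → ℂ} (hh : ∀ i, 𝔤.Moderate (h i)) (j : ℕ) {y : ℂ → ℂ}
    (hy : 𝔤.Moderate y) : 𝔤.Moderate (factorOp h j y) := by
  induction j generalizing y with
  | zero => exact hy
  | succ j ih => exact (ih hy).deriv.sub ((ih (hh j)).slow_logDeriv.moderate.mul (ih hy))

theorem slow_factorCoeff {h : ℕ → ℂ → ℂ} (hh : ∀ i, 𝔤.Moderate (h i)) (s j : ℕ) :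
    𝔤.Slow (factorCoeff h s j) := by
  have hl : ∀ j, 𝔤.Slow (logDeriv (factorOp h j (h j))) := fun j =>
    (moderate_factorOp hh j (hh j)).slow_logDeriv
  induction s generalizing j with
  | zero =>
    cases j with
    | zero => exact slow_const 1
    | succ j => exact slow_const 0
  | succ s ih =>
    cases j with
    | zero => exact (ih 0).deriv.add ((ih 0).mul (hl 0))
    | succ j => exact ((ih _).deriv.add ((ih _).mul (hl _))).add (ih j)

/-- For functions of moderate growth, the quotient of a generalised Wronskian by the
Wronskian is negligible. -/
theorem exists_slow_wr_eq_mul {m : ℕ} (J : Fin m → ℕ) {h : Fin m → ℂ → ℂ}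
    (hh : ∀ i, 𝔤.Moderate (h i)) :
    ∃ ρ, 𝔤.Slow ρ ∧ ∀ᶠ z in codiscrete ℂ, wr J h z = ρ z * wr (fun i => (i : ℕ)) h z := by
  rcases Nat.eq_zero_or_pos m with rfl | hm
  · exact ⟨_, slow_const 1, Eventually.of_forall fun z => by simp [wr]⟩
  set H : ℕ → ℂ → ℂ := fun i => if hi : i < m then h ⟨i, hi⟩ else 0 with hH
  have hHm : ∀ i, 𝔤.Moderate (H i) := by
    intro i
    simp only [hH]
    split_ifs with hi
    · exact hh _
    · exact moderate_zero
  have hHh : ∀ i : Fin m, H i = h i := fun i => by simp [hH]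
  have hexp : ∀ s, ∀ᶠ z in codiscrete ℂ, ∀ i : Fin m, iteratedDeriv s (h i) z =
      ∑ j : Fin m, factorOp H j (h i) z * factorCoeff H s j z := by
    refine fun s => eventually_all.2 fun i => ?_
    have h1 := iteratedDeriv_eventuallyEq_sum (fun i => (hHm i).meromorphic)
      (hHm i).meromorphic hm (factorOp_eventuallyEq_zero (fun i => (hHm i).meromorphic) i.2) s
    filter_upwards [h1] with z hz
    rw [← hHh, hz, Finset.sum_range]
    exact Finset.sum_congr rfl fun j _ => mul_comm _ _
  have key : ∀ J : Fin m → ℕ, ∀ᶠ z in codiscrete ℂ, wr J h z =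
      (Matrix.of fun i j : Fin m => factorOp H j (h i) z).det *
        (Matrix.of fun l j : Fin m => factorCoeff H (J j) l z).det := by
    intro J
    filter_upwards [eventually_all.2 fun j => hexp (J j)] with z hz
    rw [wr, ← Matrix.det_mul]
    congr 1
    ext i j
    simp only [Matrix.of_apply, Matrix.mul_apply]
    exact hz j i
  refine ⟨_, Slow.det fun l j => slow_factorCoeff hHm (J j) l, ?_⟩
  filter_upwards [key J, key fun i => (i : ℕ)] with z h1 h2
  have h3 : (Matrix.of fun l j : Fin m => factorCoeff H j l z).det = 1 := by
    rw [Matrix.det_of_isUpperTriangular]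
    · simp [factorCoeff_self]
    · intro l j hlj
      simp only [Matrix.of_apply]
      rw [factorCoeff_of_lt (by simpa using hlj)]
      rfl
  rw [h1, h2, h3]
  ring

end Gauge

end DerivedCurves

end

noncomputable section

namespace DerivedCurves

open Real Filter MeasureTheory Set Topology Metric ValueDistribution

/-! ### Compound matrices and decomposable forms -/

/-- The index set of the Plücker coordinates. -/
abbrev PluckerIndex (n k : ℕ) : Type := Set.powersetCard (Fin (n + 1)) (k + 1)

/-- The increasing enumeration of an index set. -/
abbrev emb {n k : ℕ} (t : PluckerIndex n k) : Fin (k + 1) ↪o Fin (n + 1) :=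
  Set.powersetCard.ofFinEmbEquiv.symm t

theorem card_pluckerIndex (n k : ℕ) : Fintype.card (PluckerIndex n k) = (n + 1).choose (k + 1) := by
  have h : (Finset.univ : Finset (PluckerIndex n k)).card =
      (Finset.powersetCard (k + 1) (Finset.univ : Finset (Fin (n + 1)))).card := by
    refine Finset.card_bij (fun t _ => t.1) (fun t _ => ?_) (fun t _ s _ h => Subtype.ext h)
      fun s hs => ⟨⟨s, (Finset.mem_powersetCard.1 hs).2⟩, Finset.mem_univ _, rfl⟩
    exact Finset.mem_powersetCard.2 ⟨Finset.subset_univ _, t.2⟩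
  rw [← Finset.card_univ, h, Finset.card_powersetCard, Finset.card_univ, Fintype.card_fin]

theorem card_filter_mem_pluckerIndex {n k : ℕ} (i : Fin (n + 1)) :
    (Finset.univ.filter fun t : PluckerIndex n k => i ∈ t.1).card = n.choose k := by
  have h : (Finset.univ.filter fun t : PluckerIndex n k => i ∈ t.1).card =
      (Finset.powersetCard k (Finset.univ.erase i)).card := by
    refine Finset.card_bij (fun t _ => t.1.erase i) (fun t ht => ?_) (fun t ht s hs h => ?_)
      fun s hs => ?_
    · rw [Finset.mem_powersetCard]
      refine ⟨Finset.erase_subset_erase _ (Finset.subset_univ _), ?_⟩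
      rw [Finset.card_erase_of_mem (Finset.mem_filter.1 ht).2, t.2, Nat.add_sub_cancel]
    · refine Subtype.ext ?_
      rw [← Finset.insert_erase (Finset.mem_filter.1 ht).2, h,
        Finset.insert_erase (Finset.mem_filter.1 hs).2]
    · rw [Finset.mem_powersetCard] at hs
      have hi : i ∉ s := fun hi => by simpa using hs.1 hi
      exact ⟨⟨insert i s, by rw [Set.powersetCard, Set.mem_ofPred_eq,
          Finset.card_insert_of_notMem hi, hs.2]⟩,
        Finset.mem_filter.2 ⟨Finset.mem_univ _, Finset.mem_insert_self _ _⟩,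
        Finset.erase_insert hi⟩
  rw [h, Finset.card_powersetCard, Finset.card_erase_of_mem (Finset.mem_univ i), Finset.card_univ,
    Fintype.card_fin, Nat.add_sub_cancel]

theorem map_emb_univ {n k : ℕ} (t : PluckerIndex n k) :
    Finset.univ.map (emb t).toEmbedding = t.1 := by
  ext i
  rw [Finset.mem_map]
  simp only [Finset.mem_univ, true_and]
  exact Set.powersetCard.mem_range_ofFinEmbEquiv_symm_iff_mem t i

@[to_additive]
theorem prod_prod_emb {M : Type*} [CommMonoid M] {n k : ℕ} (u : Fin (n + 1) → M) :
    ∏ t : PluckerIndex n k, ∏ j, u (emb t j) = (∏ i, u i) ^ n.choose k := by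
  have h1 : ∀ t : PluckerIndex n k, ∏ j, u (emb t j) = ∏ i, if i ∈ t.1 then u i else 1 := by
    intro t
    rw [Finset.prod_ite_mem, Finset.univ_inter, ← map_emb_univ t, Finset.prod_map]
    rfl
  simp_rw [h1]
  rw [Finset.prod_comm, ← Finset.prod_pow]
  refine Finset.prod_congr rfl fun i _ => ?_
  rw [← Finset.prod_filter, Finset.prod_const, card_filter_mem_pluckerIndex]

theorem pluckerBasis_apply {n k : ℕ} (t : PluckerIndex n k) :
    pluckerBasis n k t = exteriorPower.ιMulti ℂ (k + 1) (Pi.basisFun ℂ (Fin (n + 1)) ∘ emb t) :=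
  exteriorPower.basis_apply ..

theorem map_pluckerBasis {n k : ℕ} (L : (Fin (n + 1) → ℂ) →ₗ[ℂ] (Fin (n + 1) → ℂ))
    (t : PluckerIndex n k) :
    exteriorPower.map (k + 1) L (pluckerBasis n k t) =
      exteriorPower.ιMulti ℂ (k + 1) ((L ∘ Pi.basisFun ℂ (Fin (n + 1))) ∘ emb t) := by
  rw [pluckerBasis_apply, exteriorPower.map_apply_ιMulti]
  rfl

/-- The determinant of a compound matrix, as a multiplicative function. -/
def detCompound (n k : ℕ) : Matrix (Fin (n + 1)) (Fin (n + 1)) ℂ →* ℂ where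
  toFun M := LinearMap.det (exteriorPower.map (k + 1) (Matrix.toLin' M))
  map_one' := by rw [Matrix.toLin'_one, exteriorPower.map_id, LinearMap.det_id]
  map_mul' A B := by rw [Matrix.toLin'_mul, exteriorPower.map_comp, LinearMap.det_comp]

theorem detCompound_diagonal (n k : ℕ) (D : Fin (n + 1) → ℂ) :
    detCompound n k (Matrix.diagonal D) = (∏ i, D i) ^ n.choose k := by
  have h : LinearMap.toMatrix (pluckerBasis n k) (pluckerBasis n k)
      (exteriorPower.map (k + 1) (Matrix.toLin' (Matrix.diagonal D))) =
      Matrix.diagonal fun t : PluckerIndex n k => ∏ j, D (emb t j) := by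
    ext s t
    rw [LinearMap.toMatrix_apply, map_pluckerBasis]
    have h1 : (Matrix.toLin' (Matrix.diagonal D) ∘ Pi.basisFun ℂ (Fin (n + 1))) ∘ emb t =
        fun j => D (emb t j) • (Pi.basisFun ℂ (Fin (n + 1)) ∘ emb t) j := by
      ext j i
      by_cases hij : i = emb t j
      · simp [Matrix.mulVec_diagonal, hij]
      · simp [Matrix.mulVec_diagonal, hij]
    rw [h1, ← AlternatingMap.coe_multilinearMap, MultilinearMap.map_smul_univ,
      AlternatingMap.coe_multilinearMap, ← pluckerBasis_apply, map_smul, Module.Basis.repr_self,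
      Matrix.diagonal_apply, Finsupp.smul_apply, Finsupp.single_apply]
    by_cases hst : s = t
    · simp [hst]
    · simp [hst, Ne.symm hst]
  change LinearMap.det _ = _
  rw [← LinearMap.det_toMatrix (pluckerBasis n k), h, Matrix.det_diagonal, prod_prod_emb]

theorem diagonal_mul_transvection {ι : Type*} [Fintype ι] [DecidableEq ι] {i j : ι} (hij : i ≠ j)
    (c : ℂ) : Matrix.diagonal (fun l => if l = i then (2 : ℂ) else 1) * Matrix.transvection i j c =
      Matrix.transvection i j c * Matrix.transvection i j c *
        Matrix.diagonal fun l => if l = i then (2 : ℂ) else 1 := by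
  rw [Matrix.transvection_mul_transvection_same i j hij]
  ext a b
  simp only [Matrix.diagonal_mul, Matrix.mul_diagonal, Matrix.transvection, Matrix.add_apply,
    Matrix.one_apply, Matrix.single_apply]
  by_cases ha : a = i
  · subst ha
    by_cases hb : b = j
    · subst hb
      simp [hij, Ne.symm hij]
      ring
    · by_cases hab : a = b
      · subst hab
        simp [Ne.symm hb]
      · simp [hab, Ne.symm hb]
  · by_cases hab : a = b
    · subst hab
      simp [ha, Ne.symm ha]
    · simp [hab, Ne.symm ha]

/-- The Sylvester–Franke theorem. -/
theorem detCompound_eq (n k : ℕ) (M : Matrix (Fin (n + 1)) (Fin (n + 1)) ℂ) :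
    detCompound n k M = M.det ^ n.choose k := by
  refine Matrix.diagonal_transvection_induction
    (fun M => detCompound n k M = M.det ^ n.choose k) M (fun D _ => ?_) (fun t => ?_)
    fun A B hA hB => ?_
  · rw [detCompound_diagonal, Matrix.det_diagonal]
  · rw [t.det, one_pow]
    obtain ⟨i, j, hij, c⟩ := t
    rw [Matrix.TransvectionStruct.toMatrix_mk]
    have h1 := congrArg (detCompound n k) (diagonal_mul_transvection hij c)
    rw [map_mul, map_mul, map_mul, detCompound_diagonal] at h1
    have h2 : (∏ l, if l = i then (2 : ℂ) else 1) ^ n.choose k ≠ 0 := by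
      rw [Finset.prod_ite_eq' Finset.univ i]
      simp
    have h3 : detCompound n k (Matrix.transvection i j c) ≠ 0 := by
      intro h0
      have h4 := congrArg (detCompound n k)
        (Matrix.transvection_mul_transvection_same i j hij c (-c))
      rw [map_mul, h0, zero_mul, add_neg_cancel, Matrix.transvection_zero, map_one] at h4
      exact zero_ne_one h4
    have h5 : detCompound n k (Matrix.transvection i j c) *
        ((∏ l, if l = i then (2 : ℂ) else 1) ^ n.choose k) *
          (detCompound n k (Matrix.transvection i j c) - 1) = 0 := by
      linear_combination -h1
    rcases mul_eq_zero.1 h5 with h6 | h6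
    · exact absurd h6 (mul_ne_zero h3 h2)
    · exact sub_eq_zero.1 h6
  · rw [map_mul, hA, hB, Matrix.det_mul, mul_pow]

theorem det_apply_basis_ne_zero {V ι : Type*} [AddCommGroup V] [Module ℂ V] [Fintype ι]
    [DecidableEq ι] (b : Module.Basis ι ℂ V) {φ : ι → Module.Dual ℂ V}
    (hφ : LinearIndependent ℂ φ) : (Matrix.of fun s t => φ s (b t)).det ≠ 0 := by
  have h1 : LinearIndependent ℂ (Matrix.of fun s t => φ s (b t)).row :=
    hφ.map' (b.constr ℂ).symm.toLinearMap (LinearEquiv.ker _)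
  exact (Matrix.isUnit_iff_isUnit_det _).1 (Matrix.linearIndependent_rows_iff_isUnit.1 h1) |>.ne_zero

/-- Linearly independent forms on the exterior power, evaluated at the exterior products of
the rows of a square matrix. -/
theorem exists_det_form_ιMulti_eq {n k : ℕ}
    {φ : PluckerIndex n k → Module.Dual ℂ (⋀[ℂ]^(k + 1) (Fin (n + 1) → ℂ))}
    (hφ : LinearIndependent ℂ φ) :
    ∃ c : ℂ, c ≠ 0 ∧ ∀ v : Fin (n + 1) → Fin (n + 1) → ℂ,
      (Matrix.of fun s t : PluckerIndex n k =>
        φ s (exteriorPower.ιMulti ℂ (k + 1) (v ∘ emb t))).det =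
        c * (Matrix.of v).det ^ n.choose k := by
  refine ⟨_, det_apply_basis_ne_zero (pluckerBasis n k) hφ, fun v => ?_⟩
  have h1 : Matrix.toLin' (Matrix.of v).transpose ∘ Pi.basisFun ℂ (Fin (n + 1)) = v := by
    ext i j
    simp
  have h2 : (Matrix.of fun s t : PluckerIndex n k =>
        φ s (exteriorPower.ιMulti ℂ (k + 1) (v ∘ emb t))) =
      (Matrix.of fun s t => φ s (pluckerBasis n k t)) *
        LinearMap.toMatrix (pluckerBasis n k) (pluckerBasis n k)
          (exteriorPower.map (k + 1) (Matrix.toLin' (Matrix.of v).transpose)) := by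
    ext s t
    rw [Matrix.mul_apply]
    simp only [Matrix.of_apply, LinearMap.toMatrix_apply]
    rw [map_pluckerBasis, h1]
    conv_lhs => rw [← (pluckerBasis n k).sum_repr (exteriorPower.ιMulti ℂ (k + 1) (v ∘ emb t))]
    rw [map_sum]
    exact Finset.sum_congr rfl fun u _ => by rw [map_smul, smul_eq_mul, mul_comm]
  rw [h2, Matrix.det_mul, LinearMap.det_toMatrix]
  have h3 := detCompound_eq n k (Matrix.of v).transpose
  rw [Matrix.det_transpose] at h3
  rw [← h3]
  rfl

theorem form_ιMulti {n k : ℕ} (A : DecomposableHyperplane n k) (v : Fin (k + 1) → Fin (n + 1) → ℂ) :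
    A.form (exteriorPower.ιMulti ℂ (k + 1) v) =
      (Matrix.of fun i j => A.covector j (v i)).det :=
  exteriorPower.pairingDual_ιMulti_ιMulti _ _

end DerivedCurves

end

noncomputable section

namespace DerivedCurves

open Real Filter MeasureTheory Set Topology Metric ValueDistribution

/-! ### Nochka weights -/

section Nochka

variable {ι : Type*} [DecidableEq ι]

/-- The defining properties of the rank function of a matroid on `ι`. -/
structure IsRankFunction (r : Finset ι → ℕ) : Prop where
  empty : r ∅ = 0
  mono : ∀ {A B}, A ⊆ B → r A ≤ r B
  insert_le : ∀ i A, r (insert i A) ≤ r A + 1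
  submodular : ∀ A B, r (A ∪ B) + r (A ∩ B) ≤ r A + r B

namespace IsRankFunction

variable {r : Finset ι → ℕ} (hr : IsRankFunction r)

include hr

theorem le_card (A : Finset ι) : r A ≤ A.card := by
  induction A using Finset.induction_on with
  | empty => simp [hr.empty]
  | insert i A hi ih =>
    rw [Finset.card_insert_of_notMem hi]
    exact (hr.insert_le i A).trans (by omega)

theorem union_eq_of_forall_insert_le {A R : Finset ι} (h : ∀ i ∈ R, r (insert i A) ≤ r A) :
    r (A ∪ R) ≤ r A := by
  induction R using Finset.induction_on with
  | empty => simp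
  | insert j R hj ih =>
    have h1 := ih fun i hi => h i (Finset.mem_insert_of_mem hi)
    have h2 := h j (Finset.mem_insert_self _ _)
    have h3 := hr.submodular (A ∪ R) (insert j A)
    have h4 : A ∪ insert j R = (A ∪ R) ∪ insert j A := by
      ext x
      simp only [Finset.mem_union, Finset.mem_insert]
      tauto
    have h5 : r A ≤ r ((A ∪ R) ∩ insert j A) :=
      hr.mono (Finset.subset_inter Finset.subset_union_left (Finset.subset_insert _ _))
    rw [h4]
    omega

theorem exists_rank_insert {A R : Finset ι} (h : r A < r R) :
    ∃ i ∈ R, i ∉ A ∧ r (insert i A) = r A + 1 := by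
  by_contra! hcon
  have h1 : r (A ∪ R) ≤ r A := hr.union_eq_of_forall_insert_le fun i hi => by
    by_cases hiA : i ∈ A
    · rw [Finset.insert_eq_of_mem hiA]
    · have := hr.insert_le i A
      have := hcon i hi hiA
      omega
  exact absurd (h.trans_le (hr.mono Finset.subset_union_right)) (not_lt.2 h1)

theorem exists_superset_rank {A R : Finset ι} (hAR : A ⊆ R) {m : ℕ} (hA : r A ≤ m) (hm : m ≤ r R) :
    ∃ B, A ⊆ B ∧ B ⊆ R ∧ r B = m ∧ B.card = A.card + (m - r A) := by
  induction m, hA using Nat.le_induction with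
  | base => exact ⟨A, subset_rfl, hAR, rfl, by simp⟩
  | succ m hAm ih =>
    obtain ⟨B, h1, h2, h3, h4⟩ := ih (by omega)
    obtain ⟨i, hi, hiB, h5⟩ := hr.exists_rank_insert (A := B) (R := R) (by omega)
    refine ⟨insert i B, h1.trans (Finset.subset_insert _ _), Finset.insert_subset hi h2, by omega, ?_⟩
    rw [Finset.card_insert_of_notMem hiB]
    omega

theorem exists_independent_sum_le {ω : ι → ℝ} (R : Finset ι)
    (hω : ∀ S ⊆ R, ∑ i ∈ S, ω i ≤ r S) {x : ι → ℝ} (hx : ∀ i ∈ R, 0 ≤ x i) :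
    ∃ B ⊆ R, r B = r R ∧ B.card = r R ∧ ∑ i ∈ R, ω i * x i ≤ ∑ i ∈ B, x i := by
  induction hn : R.card generalizing R x with
  | zero =>
    rw [Finset.card_eq_zero] at hn
    subst hn
    exact ⟨∅, subset_rfl, rfl, by simp [hr.empty], by simp⟩
  | succ n ih =>
    obtain ⟨j, hj, hmin⟩ := R.exists_min_image x (Finset.card_pos.1 (by omega))
    have hsub : R.erase j ⊆ R := Finset.erase_subset _ _
    obtain ⟨B', hB', hr', hc', hle⟩ := ih (R.erase j) (fun S hS => hω S (hS.trans hsub))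
      (x := fun i => x i - x j) (fun i hi => sub_nonneg.2 (hmin i (hsub hi)))
      (by rw [Finset.card_erase_of_mem hj, hn]; rfl)
    obtain ⟨B, h1, h2, h3, h4⟩ := hr.exists_superset_rank (hB'.trans hsub)
      (hr' ▸ hr.mono hsub) le_rfl
    have hcard : B.card = r R := by
      have := hr.mono hsub
      omega
    refine ⟨B, h2, h3, hcard, ?_⟩
    have e1 : ∑ i ∈ R, ω i * x i = (∑ i ∈ R, ω i) * x j + ∑ i ∈ R.erase j, ω i * (x i - x j) := by
      rw [Finset.sum_erase _ (by simp), Finset.sum_mul, ← Finset.sum_add_distrib]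
      exact Finset.sum_congr rfl fun i _ => by ring
    have e2 : ∑ i ∈ B', (x i - x j) ≤ ∑ i ∈ B, (x i - x j) :=
      Finset.sum_le_sum_of_subset_of_nonneg h1 fun i hi _ => sub_nonneg.2 (hmin i (h2 hi))
    have e3 : ∑ i ∈ B, (x i - x j) = ∑ i ∈ B, x i - (r R : ℝ) * x j := by
      rw [Finset.sum_sub_distrib, Finset.sum_const, hcard, nsmul_eq_mul]
    have e4 : (∑ i ∈ R, ω i) * x j ≤ r R * x j :=
      mul_le_mul_of_nonneg_right (hω R subset_rfl) (hx j hj)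
    linarith

theorem mul_card_sdiff_le {d N : ℕ} (hdN : d ≤ N)
    (hsub : ∀ R, r R < d → R.card + d ≤ N + r R) {R₀ : Finset ι} (hR₀ : r R₀ < d) {θ : ℝ}
    (hθ0 : 0 ≤ θ) (hθ : θ * (2 * N - d - R₀.card) = d - r R₀)
    (h : ∀ R, R₀ ⊆ R → r R < d → θ * (R.card - R₀.card) ≤ r R - r R₀) {R : Finset ι}
    (hR : r R < d) : θ * (R \ R₀).card ≤ r R - r (R ∩ R₀) := by
  have hs : (r (R ∪ R₀) : ℝ) + r (R ∩ R₀) ≤ r R + r R₀ := by exact_mod_cast hr.submodular R R₀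
  rcases lt_or_ge (r (R ∪ R₀)) d with hlt | hge
  · have h1 := h (R ∪ R₀) Finset.subset_union_right hlt
    have h2 : ((R ∪ R₀).card : ℝ) = (R \ R₀).card + R₀.card := by
      rw [← Finset.sdiff_union_self_eq_union, Finset.card_union_of_disjoint Finset.sdiff_disjoint]
      push_cast
      rfl
    rw [h2, add_sub_cancel_right] at h1
    linarith
  · have hge' : (d : ℝ) ≤ r (R ∪ R₀) := by exact_mod_cast hge
    have h3 : (R₀.card : ℝ) + d ≤ N + r R₀ := by exact_mod_cast hsub R₀ hR₀
    have h4 : (r R₀ : ℝ) < d := by exact_mod_cast hR₀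
    have h5 : (d : ℝ) ≤ N := by exact_mod_cast hdN
    have h6 : (R.card : ℝ) + d ≤ N + r R := by exact_mod_cast hsub R hR
    have h7 : ((R \ R₀).card : ℝ) + (R ∩ R₀).card = R.card := by
      exact_mod_cast Finset.card_sdiff_add_card_inter R R₀
    have h8 : (r (R ∩ R₀) : ℝ) ≤ (R ∩ R₀).card := by exact_mod_cast hr.le_card _
    have h9 : θ * (N - d + (d - r R₀)) ≤ d - r R₀ := by
      rw [← hθ]
      exact mul_le_mul_of_nonneg_left (by linarith) hθ0
    have h10 : θ ≤ 1 := by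
      by_contra hcon
      have h11 : 1 * ((N : ℝ) - d + (d - r R₀)) < θ * (N - d + (d - r R₀)) :=
        mul_lt_mul_of_pos_right (not_le.1 hcon) (by linarith)
      linarith
    have h12 : θ * (R \ R₀).card ≤ θ * (N - d + (d - r R₀) + (r R - r (R ∩ R₀) - (d - r R₀))) :=
      mul_le_mul_of_nonneg_left (by linarith) hθ0
    have h13 : θ * ((r R : ℝ) - r (R ∩ R₀) - (d - r R₀)) ≤ r R - r (R ∩ R₀) - (d - r R₀) :=
      mul_le_of_le_one_left (by linarith) h10
    rw [mul_add] at h12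
    linarith

variable [Fintype ι]

theorem exists_weights_aux {d N : ℕ} (hdN : d ≤ N)
    (hsub : ∀ R, r R < d → R.card + d ≤ N + r R) (R₀ : Finset ι)
    (hR₀ : r R₀ < d) (σ : ℝ) (hσ : 0 ≤ σ)
    (h1 : ∀ R, R₀ ⊆ R → r R < d → σ * (R.card - R₀.card) ≤ r R - r R₀)
    (h2 : σ * (2 * N - d - R₀.card) ≤ d - r R₀) :
    ∃ (ω : ι → ℝ) (θ : ℝ), σ ≤ θ ∧ 0 < θ ∧ (∀ i, i ∉ R₀ → 0 ≤ ω i ∧ ω i ≤ θ) ∧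
      ∑ i ∈ R₀ᶜ, ω i = d - r R₀ + θ * (Fintype.card ι - 2 * N + d) ∧
      ∀ R, r R < d → ∑ i ∈ R \ R₀, ω i ≤ r R - r (R ∩ R₀) := by
  induction hn : R₀ᶜ.card using Nat.strong_induction_on generalizing R₀ σ with
  | _ n ih =>
  have hden : (0 : ℝ) < 2 * N - d - R₀.card := by
    have h3 : (R₀.card : ℝ) + d ≤ N + r R₀ := by exact_mod_cast hsub R₀ hR₀
    have h4 : (r R₀ : ℝ) < d := by exact_mod_cast hR₀
    have h5 : (d : ℝ) ≤ N := by exact_mod_cast hdN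
    linarith
  have hnum : (0 : ℝ) < d - r R₀ := sub_pos.2 (by exact_mod_cast hR₀)
  obtain ⟨θ₀, hθ₀⟩ : ∃ θ₀ : ℝ, θ₀ = (d - r R₀) / (2 * N - d - R₀.card) := ⟨_, rfl⟩
  have hθpos : 0 < θ₀ := by
    rw [hθ₀]
    positivity
  have hθmul : θ₀ * (2 * N - d - R₀.card) = d - r R₀ := by
    rw [hθ₀]
    field_simp
  have hcompl : ((R₀ᶜ).card : ℝ) = Fintype.card ι - R₀.card := by
    rw [Finset.card_compl, Nat.cast_sub (Finset.card_le_univ _)]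
  by_cases hA : ∀ R, R₀ ⊆ R → r R < d → θ₀ * (R.card - R₀.card) ≤ r R - r R₀
  · refine ⟨fun _ => θ₀, θ₀, ?_, hθpos, fun i _ => ⟨hθpos.le, le_rfl⟩, ?_, fun R hR => ?_⟩
    · rw [hθ₀, le_div_iff₀ hden]
      exact h2
    · rw [Finset.sum_const, nsmul_eq_mul, hcompl, ← hθmul]
      ring
    · rw [Finset.sum_const, nsmul_eq_mul, mul_comm]
      exact hr.mul_card_sdiff_le hdN hsub hR₀ hθpos.le hθmul hA hR
  · push Not at hA
    obtain ⟨R', hR'1, hR'2, hR'3⟩ := hA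
    have hss : ∀ {R}, R₀ ⊆ R → R ≠ R₀ → (0 : ℝ) < R.card - R₀.card := fun h h' =>
      sub_pos.2 (by exact_mod_cast Finset.card_lt_card (h.ssubset_of_ne (Ne.symm h')))
    have hne' : R' ≠ R₀ := by
      rintro rfl
      simp at hR'3
    obtain ⟨R₁, hR₁, hmin⟩ := Finset.exists_min_image
      (Finset.univ.filter fun R : Finset ι => (R₀ ⊆ R ∧ R ≠ R₀) ∧ r R < d)
      (fun R => ((r R : ℝ) - r R₀) / (R.card - R₀.card))
      ⟨R', Finset.mem_filter.2 ⟨Finset.mem_univ _, ⟨hR'1, hne'⟩, hR'2⟩⟩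
    obtain ⟨⟨hR₁1, hR₁2⟩, hR₁3⟩ := (Finset.mem_filter.1 hR₁).2
    obtain ⟨τ, hτ⟩ : ∃ τ : ℝ, τ = ((r R₁ : ℝ) - r R₀) / (R₁.card - R₀.card) := ⟨_, rfl⟩
    have hτmul : τ * (R₁.card - R₀.card) = r R₁ - r R₀ := by
      rw [hτ]
      exact div_mul_cancel₀ _ (hss hR₁1 hR₁2).ne'
    have hτmin : ∀ R, R₀ ⊆ R → r R < d → τ * (R.card - R₀.card) ≤ r R - r R₀ := by
      intro R hR hRd
      by_cases hRe : R = R₀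
      · simp [hRe]
      · rw [← le_div_iff₀ (hss hR hRe), hτ]
        exact hmin R (Finset.mem_filter.2 ⟨Finset.mem_univ _, ⟨hR, hRe⟩, hRd⟩)
    have hτθ : τ ≤ θ₀ := by
      have h3 := hτmin R' hR'1 hR'2
      exact (lt_of_mul_lt_mul_right (h3.trans_lt hR'3) (hss hR'1 hne').le).le
    have hτσ : σ ≤ τ := by
      rw [hτ, le_div_iff₀ (hss hR₁1 hR₁2)]
      exact h1 R₁ hR₁1 hR₁3
    have hτ0 : 0 ≤ τ := hσ.trans hτσ
    obtain ⟨ω, θ, hθτ, hθ0, hω, hsum, hbd⟩ := ih (R₁ᶜ).card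
      (by
        rw [← hn]
        exact Finset.card_lt_card (Finset.compl_ssubset_compl.2
          (hR₁1.ssubset_of_ne (Ne.symm hR₁2))))
      R₁ hR₁3 τ hτ0
      (fun R hR hRd => by
        have := hτmin R (hR₁1.trans hR) hRd
        linarith)
      (by
        have := mul_le_mul_of_nonneg_right hτθ hden.le
        linarith) rfl
    have hcard : ∀ S : Finset ι, ∑ i ∈ S, (if i ∈ R₁ then τ else ω i) =
        τ * (S ∩ R₁).card + ∑ i ∈ S \ R₁, ω i := by
      intro S
      rw [Finset.sum_ite, Finset.sum_const, nsmul_eq_mul, mul_comm, Finset.filter_mem_eq_inter,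
        Finset.filter_notMem_eq_sdiff]
    refine ⟨fun i => if i ∈ R₁ then τ else ω i, θ, hτσ.trans hθτ, hθ0, fun i _ => ?_, ?_,
      fun R hR => ?_⟩
    · by_cases hi : i ∈ R₁
      · simpa [hi] using ⟨hτ0, hθτ⟩
      · simpa [hi] using hω i hi
    · have e1 : R₀ᶜ \ R₁ = R₁ᶜ := by
        ext x
        simp only [Finset.mem_sdiff, Finset.mem_compl]
        exact ⟨fun h => h.2, fun h => ⟨fun h' => h (hR₁1 h'), h⟩⟩
      have e2 : ((R₀ᶜ ∩ R₁).card : ℝ) = R₁.card - R₀.card := by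
        have : R₀ᶜ ∩ R₁ = R₁ \ R₀ := by
          ext x
          simp only [Finset.mem_sdiff, Finset.mem_compl, Finset.mem_inter]
          tauto
        rw [this, Finset.card_sdiff_of_subset hR₁1, Nat.cast_sub (Finset.card_le_card hR₁1)]
      rw [hcard, e1, e2, hτmul, hsum]
      ring
    · have e1 : (R \ R₀) \ R₁ = R \ R₁ := by
        ext x
        simp only [Finset.mem_sdiff]
        exact ⟨fun h => ⟨h.1.1, h.2⟩, fun h => ⟨⟨h.1, fun h' => h.2 (hR₁1 h')⟩, h.2⟩⟩
      have e2 : (((R \ R₀) ∩ R₁).card : ℝ) = ((R ∩ R₁) ∪ R₀).card - R₀.card := by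
        have : (R ∩ R₁) ∪ R₀ = ((R \ R₀) ∩ R₁) ∪ R₀ := by
          ext x
          simp only [Finset.mem_sdiff, Finset.mem_union, Finset.mem_inter]
          tauto
        rw [this, Finset.card_union_of_disjoint]
        · push_cast
          ring
        · exact (Finset.sdiff_disjoint).mono_left Finset.inter_subset_left
      have hsubR : (R ∩ R₁) ∪ R₀ ⊆ R₁ := Finset.union_subset Finset.inter_subset_right hR₁1
      have h4 := hτmin ((R ∩ R₁) ∪ R₀) Finset.subset_union_right ((hr.mono hsubR).trans_lt hR₁3)
      have h5 : (r ((R ∩ R₁) ∪ R₀) : ℝ) + r (R ∩ R₀) ≤ r (R ∩ R₁) + r R₀ := by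
        have h6 := hr.submodular (R ∩ R₁) R₀
        have h7 : (R ∩ R₁) ∩ R₀ = R ∩ R₀ := by
          ext x
          simp only [Finset.mem_inter]
          exact ⟨fun h => ⟨h.1.1, h.2⟩, fun h => ⟨⟨h.1, hR₁1 h.2⟩, h.2⟩⟩
        rw [h7] at h6
        exact_mod_cast h6
      have h6 := hbd R hR
      rw [hcard, e1, e2]
      linarith

/-- Existence of Nochka weights. -/
theorem exists_weights {d N : ℕ} (hd : 0 < d) (hdN : d ≤ N) (hN : ∀ R, N ≤ R.card → r R = d)
    (hcard : N ≤ Fintype.card ι) :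
    ∃ (ω : ι → ℝ) (θ : ℝ), 0 < θ ∧ (∀ i, 0 ≤ ω i ∧ ω i ≤ θ) ∧
      ∑ i, ω i = d + θ * (Fintype.card ι - 2 * N + d) ∧
      ∀ R, r R < d → ∑ i ∈ R, ω i ≤ r R := by
  have huniv : r Finset.univ = d := hN _ (by rwa [Finset.card_univ])
  have hsub : ∀ R, r R < d → R.card + d ≤ N + r R := by
    intro R hR
    obtain ⟨B, -, -, h3, h4⟩ := hr.exists_superset_rank (A := R) (R := Finset.univ)
      (m := d - 1) (Finset.subset_univ _) (by omega) (by omega)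
    have : B.card < N := by
      by_contra hcon
      have := hN B (not_lt.1 hcon)
      omega
    omega
  obtain ⟨ω, θ, -, hθ, hω, hsum, hbd⟩ := hr.exists_weights_aux hdN hsub ∅
    (by rwa [hr.empty]) 0 le_rfl
    (fun R _ _ => by simp [hr.empty]) (by simp [hr.empty])
  refine ⟨ω, θ, hθ, fun i => hω i (Finset.notMem_empty i), ?_, fun R hR => ?_⟩
  · simpa [hr.empty] using hsum
  · simpa [hr.empty] using hbd R hR

end IsRankFunction

theorem isRankFunction_finrank_span {V : Type*} [AddCommGroup V] [Module ℂ V]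
    [FiniteDimensional ℂ V] (φ : ι → V) :
    IsRankFunction fun R : Finset ι => Module.finrank ℂ (Submodule.span ℂ (φ '' R)) where
  empty := by simp
  mono h := Submodule.finrank_mono (Submodule.span_mono (image_mono (by exact_mod_cast h)))
  insert_le i A := by
    rw [Finset.coe_insert, image_insert_eq, ← union_singleton, Submodule.span_union]
    refine (Submodule.finrank_add_le_finrank_add_finrank _ _).trans ?_
    gcongr
    exact (finrank_span_le_card ({φ i} : Set V)).trans (by simp)
  submodular A B := by
    rw [Finset.coe_union, image_union, Submodule.span_union,
      ← Submodule.finrank_sup_add_finrank_inf_eq (Submodule.span ℂ (φ '' A))]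
    refine Nat.add_le_add_left (Submodule.finrank_mono (le_inf ?_ ?_)) _
    · exact Submodule.span_mono (image_mono (by simp))
    · exact Submodule.span_mono (image_mono (by simp))

end Nochka

end DerivedCurves

end

noncomputable section

namespace DerivedCurves

open Real Filter MeasureTheory Set Topology Metric ValueDistribution

/-! ### Orders of Wronskians at a point -/

theorem analyticAt_det {ι : Type*} [Fintype ι] [DecidableEq ι] {M : ι → ι → ℂ → ℂ} {a : ℂ}
    (h : ∀ i j, AnalyticAt ℂ (M i j) a) :
    AnalyticAt ℂ (fun z => (Matrix.of fun i j => M i j z).det) a := by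
  simp only [Matrix.det_apply', Matrix.of_apply]
  exact Finset.analyticAt_fun_sum _ fun σ _ =>
    analyticAt_const.fun_mul (Finset.analyticAt_fun_prod _ fun i _ => h _ _)

theorem analyticAt_iteratedDeriv {h : ℂ → ℂ} {a : ℂ} (hh : AnalyticAt ℂ h a) (s : ℕ) :
    AnalyticAt ℂ (iteratedDeriv s h) a := by
  rw [iteratedDeriv_eq_iterate]
  exact hh.iterated_deriv s

theorem exists_pow_mul_iteratedDeriv_eq {h g : ℂ → ℂ} {a : ℂ} {ν : ℕ} (hh : AnalyticAt ℂ h a)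
    (hg : AnalyticAt ℂ g a) (hhg : ∀ᶠ z in 𝓝 a, h z = (z - a) ^ ν * g z) (j : ℕ) :
    ∃ u : ℂ → ℂ, AnalyticAt ℂ u a ∧ u a = (descPochhammer ℂ j).eval (ν : ℂ) * g a ∧
      ∀ᶠ z in 𝓝 a, (z - a) ^ j * iteratedDeriv j h z = (z - a) ^ ν * u z := by
  induction j with
  | zero => exact ⟨g, hg, by simp, by simpa using hhg⟩
  | succ j ih =>
    obtain ⟨u, hu, hua, hev⟩ := ih
    refine ⟨fun z => (ν - j : ℂ) * u z + (z - a) * deriv u z,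
      (analyticAt_const.fun_mul hu).fun_add
        ((analyticAt_id.fun_sub analyticAt_const).fun_mul hu.deriv), ?_, ?_⟩
    · simp only [hua, sub_self, zero_mul, add_zero, descPochhammer_succ_right, Polynomial.eval_mul,
        Polynomial.eval_sub, Polynomial.eval_X, Polynomial.eval_natCast]
      ring
    · filter_upwards [hev.eventually_nhds, hu.eventually_analyticAt,
        (analyticAt_iteratedDeriv hh j).eventually_analyticAt] with z h1 h2 h3
      have h4 : ∀ l : ℕ, HasDerivAt (fun z : ℂ => (z - a) ^ l) (l * (z - a) ^ (l - 1)) z :=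
        fun l => by simpa using ((hasDerivAt_id z).sub_const a).fun_pow l
      have h5 := (h4 j).mul h3.differentiableAt.hasDerivAt
      have h6 := (h4 ν).mul h2.differentiableAt.hasDerivAt
      have h7 := h5.unique (h6.congr_of_eventuallyEq h1)
      have h8 : ∀ l : ℕ, (l : ℂ) * (z - a) ^ (l - 1) * (z - a) = l * (z - a) ^ l := by
        intro l
        cases l with
        | zero => simp
        | succ l => rw [Nat.add_sub_cancel, mul_assoc, ← pow_succ]
      have h9 := h1.self_of_nhds
      rw [iteratedDeriv_succ]
      simp only [pow_succ]
      linear_combination (z - a) * h7 - (j : ℂ) * h9 + h8 ν * u z - h8 j * iteratedDeriv j h z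

theorem analyticOrderAt_wr_add {m : ℕ} {h : Fin m → ℂ → ℂ} {a : ℂ} {ν : Fin m → ℕ}
    (hh : ∀ i, AnalyticAt ℂ (h i) a) (hν : ∀ i, analyticOrderAt (h i) a = ν i)
    (hinj : Function.Injective ν) :
    ∃ o : ℕ, analyticOrderAt (wr (fun i => (i : ℕ)) h) a = o ∧
      o + ∑ j : Fin m, (j : ℕ) = ∑ i, ν i := by
  choose g hg hga hgev using fun i => ((hh i).analyticOrderAt_eq_natCast).1 (hν i)
  choose u hu hua huev using fun i (j : Fin m) =>
    exists_pow_mul_iteratedDeriv_eq (hh i) (hg i) (by simpa using hgev i) j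
  have hU : AnalyticAt ℂ (fun z => (Matrix.of fun i j => u i j z).det) a :=
    analyticAt_det fun i j => hu i j
  have hW : AnalyticAt ℂ (wr (fun i => (i : ℕ)) h) a :=
    analyticAt_det fun i j => analyticAt_iteratedDeriv (hh i) _
  have hU0 : (Matrix.of fun i j => u i j a).det ≠ 0 := by
    have e1 : (Matrix.of fun i j => u i j a) = Matrix.of fun i j =>
        g i a * (Matrix.of fun i (j : Fin m) => (descPochhammer ℂ j).eval (ν i : ℂ)) i j := by
      ext i j
      simp [hua, mul_comm]
    rw [e1, Matrix.det_mul_column]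
    refine mul_ne_zero (Finset.prod_ne_zero_iff.2 fun i _ => hga i) ?_
    rw [← Matrix.det_eval_matrixOfPolynomials_eq_det_vandermonde (fun i => (ν i : ℂ))
      (fun j : Fin m => descPochhammer ℂ j) (fun i => descPochhammer_natDegree ℂ i)
      (fun i => monic_descPochhammer ℂ i), Matrix.det_vandermonde_ne_zero_iff]
    exact Nat.cast_injective.comp hinj
  have key : (fun z => (z - a) ^ (∑ j : Fin m, (j : ℕ))) * wr (fun i => (i : ℕ)) h =ᶠ[𝓝 a]
      (fun z => (z - a) ^ (∑ i, ν i)) * fun z => (Matrix.of fun i j => u i j z).det := by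
    filter_upwards [eventually_all.2 fun i => eventually_all.2 fun j => huev i j] with z hz
    simp only [Pi.mul_apply, wr, ← Finset.prod_pow_eq_pow_sum]
    rw [← Matrix.det_mul_row, ← Matrix.det_mul_column]
    congr 1
    ext i j
    exact hz i j
  have hpow : ∀ l : ℕ, analyticOrderAt (fun z => (z - a) ^ l) a = l := fun l => by
    refine (AnalyticAt.analyticOrderAt_eq_natCast (by fun_prop)).2
      ⟨fun _ => 1, analyticAt_const, one_ne_zero, by simp⟩
  have h1 := analyticOrderAt_congr key
  rw [analyticOrderAt_mul (by fun_prop) hW, analyticOrderAt_mul (by fun_prop) hU, hpow, hpow,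
    (hU.analyticOrderAt_eq_zero).2 hU0, add_zero] at h1
  have hne : analyticOrderAt (wr (fun i => (i : ℕ)) h) a ≠ ⊤ := by
    intro htop
    rw [htop, add_top] at h1
    exact ENat.natCast_ne_top _ h1.symm
  obtain ⟨o, ho⟩ := ENat.ne_top_iff_exists.1 hne
  refine ⟨o, ho.symm, ?_⟩
  rw [← ho] at h1
  rw [add_comm]
  exact_mod_cast h1

/-! ### Adapted bases -/

section Adapted

variable {E : Type*} [AddCommGroup E] [Module ℂ E]

/-- A family of vectors is adapted to a sequence of linear forms if it is in echelon form. -/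
structure IsAdapted (ℓ : ℕ → E →ₗ[ℂ] ℂ) {m : ℕ} (w : Fin m → E) (ν : Fin m → ℕ) : Prop where
  strictMono : StrictMono ν
  eq_zero : ∀ i, ∀ s < ν i, ℓ s (w i) = 0
  ne_zero : ∀ i, ℓ (ν i) (w i) ≠ 0

theorem exists_isAdapted [FiniteDimensional ℂ E] (ℓ : ℕ → E →ₗ[ℂ] ℂ) (m : ℕ) (S : Submodule ℂ E)
    (hS : ∀ c ∈ S, c ≠ 0 → ∃ s, ℓ s c ≠ 0) (hm : Module.finrank ℂ S = m) :
    ∃ (w : Fin m → E) (ν : Fin m → ℕ), (∀ i, w i ∈ S) ∧ IsAdapted ℓ w ν := by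
  induction m generalizing S with
  | zero => exact ⟨Fin.elim0, Fin.elim0, fun i => i.elim0, fun i => i.elim0, fun i => i.elim0,
      fun i => i.elim0⟩
  | succ m ih =>
    classical
    have hne : ∃ s, ∃ c ∈ S, ℓ s c ≠ 0 := by
      have : S ≠ ⊥ := by
        rintro rfl
        simp at hm
      obtain ⟨c, hc, hc0⟩ := S.exists_mem_ne_zero_of_ne_bot this
      obtain ⟨s, hs⟩ := hS c hc hc0
      exact ⟨s, c, hc, hs⟩
    obtain ⟨c, hc, hcs⟩ := Nat.find_spec hne
    have hmin : ∀ s < Nat.find hne, ∀ c ∈ S, ℓ s c = 0 := by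
      intro s hs c hc
      by_contra hcon
      exact Nat.find_min hne hs ⟨c, hc, hcon⟩
    generalize Nat.find hne = s₀ at hcs hmin
    have hdim : Module.finrank ℂ (S ⊓ LinearMap.ker (ℓ s₀) : Submodule ℂ E) = m := by
      have h1 := LinearMap.finrank_range_add_finrank_ker ((ℓ s₀).domRestrict S)
      have h2 : LinearMap.range ((ℓ s₀).domRestrict S) = ⊤ := by
        refine LinearMap.range_eq_top.2 (LinearMap.surjective ?_)
        intro h0
        exact hcs (LinearMap.congr_fun h0 ⟨c, hc⟩)
      have h3 : LinearMap.ker ((ℓ s₀).domRestrict S) =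
          (S ⊓ LinearMap.ker (ℓ s₀) : Submodule ℂ E).comap S.subtype := by
        ext x
        simp
      rw [h2, finrank_top, Module.finrank_self, hm, h3,
        (Submodule.comapSubtypeEquivOfLe inf_le_left).finrank_eq] at h1
      omega
    obtain ⟨w, ν, hwS, hw⟩ := ih _ (fun c hc => hS c (Submodule.mem_inf.1 hc).1) hdim
    have hlt : ∀ i, s₀ < ν i := by
      intro i
      rcases lt_trichotomy s₀ (ν i) with h | h | h
      · exact h
      · exact absurd (h ▸ (hwS i).2) (hw.ne_zero i)
      · exact absurd (hmin _ h _ (hwS i).1) (hw.ne_zero i)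
    refine ⟨Fin.cons c w, Fin.cons s₀ ν, ?_, ?_, ?_, ?_⟩
    · exact Fin.cases hc fun i => (hwS i).1
    · rw [Fin.strictMono_iff_lt_succ]
      refine fun i => ?_
      cases m with
      | zero => exact i.elim0
      | succ m =>
        refine Fin.cases ?_ (fun j => ?_) i
        · simpa using hlt 0
        · simpa using hw.strictMono (Fin.castSucc_lt_succ (i := j))
    · exact Fin.cases (fun s hs => hmin s hs c hc) fun i => hw.eq_zero i
    · exact Fin.cases hcs fun i => hw.ne_zero i

theorem IsAdapted.coeff_eq_zero {ℓ : ℕ → E →ₗ[ℂ] ℂ} {m : ℕ} {w : Fin m → E} {ν : Fin m → ℕ}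
    (hw : IsAdapted ℓ w ν) {c : Fin m → ℂ} {l : Fin m}
    (h : ∀ s ≤ ν l, ℓ s (∑ i, c i • w i) = 0) : c l = 0 := by
  have key : ∀ j : Fin m, j ≤ l → c j = 0 := by
    intro j
    induction j using WellFoundedLT.induction with
    | _ j ih =>
    intro hj
    have h1 := h (ν j) (hw.strictMono.monotone hj)
    rw [map_sum, Finset.sum_eq_single j] at h1
    · rw [map_smul, smul_eq_mul] at h1
      exact (mul_eq_zero.1 h1).resolve_right (hw.ne_zero j)
    · intro i _ hij
      rcases lt_or_gt_of_ne hij with h2 | h2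
      · rw [ih i h2 (h2.le.trans hj), zero_smul, map_zero]
      · rw [map_smul, hw.eq_zero i _ (hw.strictMono h2), smul_zero]
    · simp
  exact key l le_rfl

theorem IsAdapted.linearIndependent {ℓ : ℕ → E →ₗ[ℂ] ℂ} {m : ℕ} {w : Fin m → E} {ν : Fin m → ℕ}
    (hw : IsAdapted ℓ w ν) : LinearIndependent ℂ w :=
  Fintype.linearIndependent_iff.2 fun c hc l => hw.coeff_eq_zero fun s _ => by rw [hc, map_zero]

end Adapted

/-! ### Derivatives of holomorphic maps into the standard space -/

section Vector

variable {n : ℕ} {G : ℂ → Fin (n + 1) → ℂ}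

theorem differentiable_iteratedDeriv (hG : Differentiable ℂ G) (s : ℕ) :
    Differentiable ℂ (iteratedDeriv s G) :=
  (hG.contDiff (n := s + 1)).differentiable_iteratedDeriv s (by exact_mod_cast Nat.lt_succ_self s)

theorem iteratedDeriv_dual_comp (hG : Differentiable ℂ G)
    (c : Module.Dual ℂ (Fin (n + 1) → ℂ)) (s : ℕ) :
    iteratedDeriv s (fun z => c (G z)) = fun z => c (iteratedDeriv s G z) := by
  induction s with
  | zero => simp
  | succ s ih =>
    rw [iteratedDeriv_succ, ih, iteratedDeriv_succ]
    ext z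
    exact ((LinearMap.toContinuousLinearMap c).hasFDerivAt.comp_hasDerivAt z
      (differentiable_iteratedDeriv hG s z).hasDerivAt).deriv

theorem differentiable_dual_comp (hG : Differentiable ℂ G)
    (c : Module.Dual ℂ (Fin (n + 1) → ℂ)) : Differentiable ℂ fun z => c (G z) :=
  (LinearMap.toContinuousLinearMap c).differentiable.comp hG

theorem natCast_le_analyticOrderAt_dual_comp (hG : Differentiable ℂ G)
    (c : Module.Dual ℂ (Fin (n + 1) → ℂ)) (a : ℂ) (ν : ℕ) :
    ν ≤ analyticOrderAt (fun z => c (G z)) a ↔ ∀ s < ν, c (iteratedDeriv s G a) = 0 := by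
  rw [natCast_le_analyticOrderAt_iff_iteratedDeriv_eq_zero
    ((differentiable_dual_comp hG c).analyticAt a)]
  simp only [iteratedDeriv_dual_comp hG c]

theorem analyticOrderAt_dual_comp_eq (hG : Differentiable ℂ G)
    {c : Module.Dual ℂ (Fin (n + 1) → ℂ)} {a : ℂ} {ν : ℕ}
    (h : ∀ s < ν, c (iteratedDeriv s G a) = 0) (h' : c (iteratedDeriv ν G a) ≠ 0) :
    analyticOrderAt (fun z => c (G z)) a = ν := by
  refine le_antisymm ?_ ((natCast_le_analyticOrderAt_dual_comp hG c a ν).2 h)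
  by_contra hcon
  have h1 : ((ν + 1 : ℕ) : ℕ∞) ≤ analyticOrderAt (fun z => c (G z)) a := by
    push_cast
    exact Order.add_one_le_of_lt (not_le.1 hcon)
  exact h' ((natCast_le_analyticOrderAt_dual_comp hG c a (ν + 1)).1 h1 ν (Nat.lt_succ_self ν))

theorem exists_iteratedDeriv_ne_zero (hG : Differentiable ℂ G)
    {c : Module.Dual ℂ (Fin (n + 1) → ℂ)} (hc : ∃ z, c (G z) ≠ 0) (a : ℂ) :
    ∃ s, c (iteratedDeriv s G a) ≠ 0 := by
  by_contra! hcon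
  have h1 : analyticOrderAt (fun z => c (G z)) a = ⊤ := by
    refine ENat.eq_top_iff_forall_ge.2 fun ν => ?_
    exact (natCast_le_analyticOrderAt_dual_comp hG c a ν).2 fun s _ => hcon s
  have h2 : (fun z => c (G z)) = 0 :=
    AnalyticOnNhd.eq_of_eventuallyEq (z₀ := a)
      (fun z _ => (differentiable_dual_comp hG c).analyticAt z) (fun z _ => analyticAt_const)
      (analyticOrderAt_eq_top.1 h1)
  obtain ⟨z, hz⟩ := hc
  exact hz (congrFun h2 z)

end Vector

end DerivedCurves

end

noncomputable section

namespace DerivedCurves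

open Real Filter MeasureTheory Set Topology Metric ValueDistribution

/-! ### The local inequality for the orders of vanishing -/

/-- The determinant of the values of a family of covectors at a family of vectors. -/
def dualDet {V : Type*} [AddCommGroup V] [Module ℂ V] {m : ℕ} (b : Fin m → Module.Dual ℂ V)
    (v : Fin m → V) : ℂ :=
  (Matrix.of fun i j => b i (v j)).det

theorem exists_dualDet_eq_mul {V : Type*} [AddCommGroup V] [Module ℂ V] {m : ℕ}
    {b b' : Fin m → Module.Dual ℂ V} (hb' : LinearIndependent ℂ b')
    (h : ∀ i, b' i ∈ Submodule.span ℂ (range b)) :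
    ∃ p : ℂ, p ≠ 0 ∧ ∀ v : Fin m → V, dualDet b' v = p * dualDet b v := by
  choose P hP using fun i => (Submodule.mem_span_range_iff_exists_fun ℂ).1 (h i)
  refine ⟨(Matrix.of P).det, fun h0 => ?_, fun v => ?_⟩
  · obtain ⟨c, hc0, hc⟩ := Matrix.exists_vecMul_eq_zero_iff.2 h0
    refine hc0 (funext fun i => Fintype.linearIndependent_iff.1 hb' c ?_ i)
    simp_rw [← hP, Finset.smul_sum]
    rw [Finset.sum_comm]
    refine Finset.sum_eq_zero fun l _ => ?_
    have := congrFun hc l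
    simp only [Matrix.vecMul, dotProduct, Matrix.of_apply, Pi.zero_apply] at this
    simp_rw [smul_smul]
    rw [← Finset.sum_smul, this, zero_smul]
  · rw [dualDet, dualDet, ← Matrix.det_mul]
    congr 1
    ext i j
    simp [Matrix.mul_apply, ← hP]

/-- A holomorphic lift `G` of a linearly nondegenerate curve, and a reduced representation
`Fbar` of its `k`-th derived curve, which is the wedge product of the derivatives up to the
factor `g`. -/
structure IsDerivedLift {n : ℕ} (k : ℕ) (G : ℂ → Fin (n + 1) → ℂ) (g : ℂ → ℂ)
    (Fbar : ℂ → ⋀[ℂ]^(k + 1) (Fin (n + 1) → ℂ)) : Prop where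
  differentiable : Differentiable ℂ G
  nondegenerate : ∀ c : Module.Dual ℂ (Fin (n + 1) → ℂ), c ≠ 0 → ∃ z, c (G z) ≠ 0
  differentiable_factor : Differentiable ℂ g
  holomorphic : ∀ φ : Module.Dual ℂ (⋀[ℂ]^(k + 1) (Fin (n + 1) → ℂ)),
    Differentiable ℂ fun z => φ (Fbar z)
  ne_zero : ∀ z, Fbar z ≠ 0
  eq_smul : ∀ z, wedgeDerivatives k G z = g z • Fbar z

/-- The Wronskian of the components of `G`. -/
def wronskian {n : ℕ} (G : ℂ → Fin (n + 1) → ℂ) (z : ℂ) : ℂ :=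
  (Matrix.of fun s : Fin (n + 1) => iteratedDeriv (s : ℕ) G z).det

theorem wr_dual_comp {n m : ℕ} {G : ℂ → Fin (n + 1) → ℂ} (hG : Differentiable ℂ G)
    (b : Fin m → Module.Dual ℂ (Fin (n + 1) → ℂ)) (J : Fin m → ℕ) (z : ℂ) :
    wr J (fun i z => b i (G z)) z = dualDet b fun j => iteratedDeriv (J j) G z := by
  simp only [wr, dualDet, iteratedDeriv_dual_comp hG]

theorem form_ιMulti_eq_dualDet {n k : ℕ} (A : DecomposableHyperplane n k)
    (v : Fin (k + 1) → Fin (n + 1) → ℂ) :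
    A.form (exteriorPower.ιMulti ℂ (k + 1) v) = dualDet A.covector v := by
  rw [form_ιMulti, dualDet, ← Matrix.det_transpose]
  rfl

theorem form_wedgeDerivatives {n k : ℕ} {G : ℂ → Fin (n + 1) → ℂ} (hG : Differentiable ℂ G)
    (A : DecomposableHyperplane n k) (z : ℂ) :
    A.form (wedgeDerivatives k G z) =
      wr (fun j : Fin (k + 1) => (j : ℕ)) (fun i z => A.covector i (G z)) z := by
  rw [wedgeDerivatives, form_ιMulti_eq_dualDet, wr_dual_comp hG]

theorem DecomposableHyperplane.linearIndependent_covector {n k : ℕ}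
    (A : DecomposableHyperplane n k) : LinearIndependent ℂ A.covector := by
  by_contra hcon
  exact A.ne_zero (AlternatingMap.map_linearDependent _ _ hcon)

/-- Evaluation of covectors at the derivatives of `G`. -/
def jetForm {n : ℕ} (G : ℂ → Fin (n + 1) → ℂ) (a : ℂ) (s : ℕ) :
    Module.Dual ℂ (Fin (n + 1) → ℂ) →ₗ[ℂ] ℂ :=
  Module.Dual.eval ℂ (Fin (n + 1) → ℂ) (iteratedDeriv s G a)

theorem exists_isAdapted_jetForm {n m : ℕ} {G : ℂ → Fin (n + 1) → ℂ} (hG : Differentiable ℂ G)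
    (hnd : ∀ c : Module.Dual ℂ (Fin (n + 1) → ℂ), c ≠ 0 → ∃ z, c (G z) ≠ 0) (a : ℂ)
    {b : Fin m → Module.Dual ℂ (Fin (n + 1) → ℂ)} (hb : LinearIndependent ℂ b) :
    ∃ (w : Fin m → Module.Dual ℂ (Fin (n + 1) → ℂ)) (ν : Fin m → ℕ),
      (∀ i, w i ∈ Submodule.span ℂ (range b)) ∧ IsAdapted (jetForm G a) w ν :=
  exists_isAdapted (jetForm G a) m (Submodule.span ℂ (range b))
    (fun c _ hc => exists_iteratedDeriv_ne_zero hG (hnd c hc) a)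
    (by rw [finrank_span_eq_card hb, Fintype.card_fin])

theorem analyticOrderAt_mul_const {h : ℂ → ℂ} {a p : ℂ} (hp : p ≠ 0) (hh : AnalyticAt ℂ h a) :
    analyticOrderAt (fun z => p * h z) a = analyticOrderAt h a := by
  have h1 : (fun z => p * h z) = (fun _ => p) * h := rfl
  rw [h1, analyticOrderAt_mul analyticAt_const hh,
    (analyticAt_const.analyticOrderAt_eq_zero).2 hp, zero_add]

theorem analyticAt_wr_dual_comp {n m : ℕ} {G : ℂ → Fin (n + 1) → ℂ} (hG : Differentiable ℂ G)
    (b : Fin m → Module.Dual ℂ (Fin (n + 1) → ℂ)) (J : Fin m → ℕ) (a : ℂ) :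
    AnalyticAt ℂ (wr J fun i z => b i (G z)) a :=
  analyticAt_det fun i _ =>
    analyticAt_iteratedDeriv ((differentiable_dual_comp hG (b i)).analyticAt a) _

theorem analyticOrderAt_wr_dual_comp {n m : ℕ} {G : ℂ → Fin (n + 1) → ℂ}
    (hG : Differentiable ℂ G) {a : ℂ} {b w : Fin m → Module.Dual ℂ (Fin (n + 1) → ℂ)}
    {ν : Fin m → ℕ} (hwb : ∀ i, w i ∈ Submodule.span ℂ (range b))
    (hw : IsAdapted (jetForm G a) w ν) :
    ∃ o : ℕ, analyticOrderAt (wr (fun j : Fin m => (j : ℕ)) fun i z => b i (G z)) a = o ∧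
      o + ∑ j : Fin m, (j : ℕ) = ∑ i, ν i := by
  obtain ⟨o, ho, hsum⟩ := analyticOrderAt_wr_add (h := fun i z => w i (G z)) (a := a) (ν := ν)
    (fun i => (differentiable_dual_comp hG (w i)).analyticAt a)
    (fun i => analyticOrderAt_dual_comp_eq hG (hw.eq_zero i) (hw.ne_zero i))
    hw.strictMono.injective
  refine ⟨o, ?_, hsum⟩
  obtain ⟨p, hp, hpe⟩ := exists_dualDet_eq_mul hw.linearIndependent hwb
  have h1 : wr (fun j : Fin m => (j : ℕ)) (fun i z => w i (G z)) =
      fun z => p * wr (fun j : Fin m => (j : ℕ)) (fun i z => b i (G z)) z := by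
    ext z
    rw [wr_dual_comp hG, wr_dual_comp hG, hpe]
  rw [← ho, h1, analyticOrderAt_mul_const hp (analyticAt_wr_dual_comp hG b _ a)]

theorem sum_le_sum_of_dualDet_ne_zero {V : Type*} [AddCommGroup V] [Module ℂ V] {n m : ℕ}
    {ℓ : ℕ → Module.Dual ℂ V →ₗ[ℂ] ℂ}
    {w : Fin (n + 1) → Module.Dual ℂ V} {ν : Fin (n + 1) → ℕ} (hw : IsAdapted ℓ w ν)
    (hspan : ⊤ ≤ Submodule.span ℂ (range w))
    {e : Fin (n + 1) → V} (he : ∀ i j, w i (e j) = if i = j then 1 else 0)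
    {b w' : Fin m → Module.Dual ℂ V} {ν' : Fin m → ℕ}
    (hwb : ∀ i, w' i ∈ Submodule.span ℂ (range b)) (hw' : IsAdapted ℓ w' ν')
    {t : Fin m → Fin (n + 1)} (ht : dualDet b (e ∘ t) ≠ 0) : ∑ j, ν' j ≤ ∑ j, ν (t j) := by
  obtain ⟨p, hp, hpe⟩ := exists_dualDet_eq_mul hw'.linearIndependent hwb
  have h1 : dualDet w' (e ∘ t) ≠ 0 := by
    rw [hpe]
    exact mul_ne_zero hp ht
  rw [dualDet, Matrix.det_apply] at h1
  obtain ⟨σ, -, hσ⟩ := Finset.exists_ne_zero_of_sum_ne_zero h1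
  have hσ' : ∀ i, w' (σ i) (e (t i)) ≠ 0 := by
    intro i hi
    refine hσ ?_
    rw [Finset.prod_eq_zero (Finset.mem_univ i) (by simpa using hi), smul_zero]
  have h2 : ∀ i, ν' (σ i) ≤ ν (t i) := by
    intro i
    obtain ⟨c, hc⟩ := (Submodule.mem_span_range_iff_exists_fun ℂ).1
      (hspan (Submodule.mem_top (x := w' (σ i))))
    have h3 : c (t i) = w' (σ i) (e (t i)) := by
      rw [← hc]
      simp [he]
    by_contra hcon
    refine hσ' i ?_
    rw [← h3]
    refine hw.coeff_eq_zero fun s hs => ?_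
    rw [hc]
    exact hw'.eq_zero _ _ (hs.trans_lt (not_le.1 hcon))
  rw [← Equiv.sum_comp σ ν']
  exact Finset.sum_le_sum fun i _ => h2 i

theorem val_le_emb {n k : ℕ} (t : PluckerIndex n k) (j : Fin (k + 1)) : (j : ℕ) ≤ emb t j := by
  obtain ⟨j, hj⟩ := j
  induction j with
  | zero => exact Nat.zero_le _
  | succ j ih =>
    have h1 := ih (by omega)
    have h2 : emb t ⟨j, by omega⟩ < emb t ⟨j + 1, hj⟩ := (emb t).strictMono (by simp)
    have h3 : ((emb t ⟨j, by omega⟩ : Fin (n + 1)) : ℕ) < emb t ⟨j + 1, hj⟩ := h2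
    simp only at h1 ⊢
    omega

theorem emb_add_le {n k : ℕ} (t : PluckerIndex n k) (j : Fin (k + 1)) :
    (emb t j : ℕ) + k ≤ n + j := by
  induction j using Fin.reverseInduction with
  | last =>
    have := (emb t (Fin.last k)).2
    simp only [Fin.val_last]
    omega
  | cast j ih =>
    have h2 : emb t j.castSucc < emb t j.succ := (emb t).strictMono Fin.castSucc_lt_succ
    have h3 : ((emb t j.castSucc : Fin (n + 1)) : ℕ) < emb t j.succ := h2
    simp only [Fin.val_succ, Fin.val_castSucc] at ih ⊢
    omega

theorem sum_emb_le {n k : ℕ} (hk : k ≤ n) (t : PluckerIndex n k) :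
    ∑ j, (emb t j : ℕ) ≤ ∑ j : Fin (k + 1), (j : ℕ) + (k + 1) * (n - k) := by
  have h1 : ∀ j, (emb t j : ℕ) ≤ j + (n - k) := fun j => by
    have := emb_add_le t j
    omega
  refine (Finset.sum_le_sum fun j _ => h1 j).trans ?_
  rw [Finset.sum_add_distrib, Finset.sum_const, Finset.card_univ, Fintype.card_fin, smul_eq_mul]

theorem strictMono_add_le {n : ℕ} {ν : Fin (n + 1) → ℕ} (hν : StrictMono ν) {i j : Fin (n + 1)}
    (hij : i ≤ j) : ν i + j ≤ ν j + i := by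
  induction j using Fin.induction with
  | zero =>
    have : i = 0 := by simpa using hij
    simp [this]
  | succ j ih =>
    rcases hij.eq_or_lt with rfl | h
    · rfl
    · have h1 := ih (Fin.le_castSucc_iff.2 h)
      have h2 := hν (Fin.castSucc_lt_succ (i := j))
      simp only [Fin.val_succ, Fin.val_castSucc] at h1 ⊢
      omega

theorem exists_dual_family {n : ℕ} {w : Fin (n + 1) → Module.Dual ℂ (Fin (n + 1) → ℂ)}
    (hw : LinearIndependent ℂ w) :
    ∃ e : Fin (n + 1) → Fin (n + 1) → ℂ, (∀ i j, w i (e j) = if i = j then 1 else 0) ∧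
      (Matrix.of e).det ≠ 0 := by
  have hM := det_apply_basis_ne_zero (Pi.basisFun ℂ (Fin (n + 1))) hw
  set M : Matrix (Fin (n + 1)) (Fin (n + 1)) ℂ :=
    Matrix.of fun s t => w s (Pi.basisFun ℂ (Fin (n + 1)) t) with hMdef
  refine ⟨fun j i => M⁻¹ i j, fun i j => ?_, ?_⟩
  · have h1 : w i (fun l => M⁻¹ l j) = (M * M⁻¹) i j := by
      conv_lhs => rw [← (Pi.basisFun ℂ (Fin (n + 1))).sum_repr fun l => M⁻¹ l j]
      rw [map_sum, Matrix.mul_apply]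
      refine Finset.sum_congr rfl fun l _ => ?_
      rw [map_smul, smul_eq_mul, mul_comm]
      simp [hMdef]
    rw [h1, Matrix.mul_nonsing_inv _ hM.isUnit, Matrix.one_apply]
  · change (M⁻¹).transpose.det ≠ 0
    rw [Matrix.det_transpose, Matrix.det_nonsing_inv]
    simpa using hM

theorem exists_wronskian_order {n : ℕ} {G : ℂ → Fin (n + 1) → ℂ} {a : ℂ} (hG : Differentiable ℂ G)
    {w : Fin (n + 1) → Module.Dual ℂ (Fin (n + 1) → ℂ)}
    {ν : Fin (n + 1) → ℕ} (hw : IsAdapted (jetForm G a) w ν) :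
    ∃ o : ℕ, analyticOrderAt (wronskian G) a = o ∧ o + ∑ j : Fin (n + 1), (j : ℕ) = ∑ i, ν i := by
  obtain ⟨o, ho, hsum⟩ := analyticOrderAt_wr_dual_comp hG
    (fun i => Submodule.subset_span (mem_range_self i)) hw
  refine ⟨o, ?_, hsum⟩
  have hM := det_apply_basis_ne_zero (Pi.basisFun ℂ (Fin (n + 1))) hw.linearIndependent
  have hWa : AnalyticAt ℂ (wronskian G) a := by
    refine analyticAt_det fun s i => ?_
    have h1 := differentiable_dual_comp (differentiable_iteratedDeriv hG s)
      (LinearMap.proj (R := ℂ) (φ := fun _ : Fin (n + 1) => ℂ) i)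
    exact h1.analyticAt a
  have h1 : wr (fun j : Fin (n + 1) => (j : ℕ)) (fun i z => w i (G z)) =
      fun z => (Matrix.of fun s t => w s (Pi.basisFun ℂ (Fin (n + 1)) t)).det * wronskian G z := by
    ext z
    rw [wr_dual_comp hG, wronskian, ← Matrix.det_transpose (Matrix.of fun s : Fin (n + 1) =>
      iteratedDeriv (s : ℕ) G z), ← Matrix.det_mul, dualDet]
    congr 1
    ext i j
    rw [Matrix.mul_apply, Matrix.of_apply]
    conv_lhs => rw [← (Pi.basisFun ℂ (Fin (n + 1))).sum_repr (iteratedDeriv (j : ℕ) G z)]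
    rw [map_sum]
    refine Finset.sum_congr rfl fun l _ => ?_
    rw [map_smul, smul_eq_mul, mul_comm]
    simp
  rw [← ho, h1, analyticOrderAt_mul_const hM hWa]

namespace IsDerivedLift

variable {n k : ℕ} {G : ℂ → Fin (n + 1) → ℂ} {g : ℂ → ℂ}
  {Fbar : ℂ → ⋀[ℂ]^(k + 1) (Fin (n + 1) → ℂ)} (hL : IsDerivedLift k G g Fbar)

include hL

theorem analyticOrderAt_factor_add (A : DecomposableHyperplane n k) (a : ℂ) :
    analyticOrderAt g a + analyticOrderAt (fun z => A.form (Fbar z)) a =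
      analyticOrderAt (wr (fun j : Fin (k + 1) => (j : ℕ)) fun i z => A.covector i (G z)) a := by
  rw [← analyticOrderAt_mul (hL.differentiable_factor.analyticAt a)
    ((hL.holomorphic A.form).analyticAt a)]
  congr 1
  ext z
  rw [← form_wedgeDerivatives hL.differentiable, hL.eq_smul, map_smul]
  rfl

theorem exists_order (A : DecomposableHyperplane n k) (a : ℂ) :
    ∃ o : ℕ, analyticOrderAt (wr (fun j : Fin (k + 1) => (j : ℕ))
      fun i z => A.covector i (G z)) a = o := by
  obtain ⟨w, ν, hwb, hw⟩ := exists_isAdapted_jetForm hL.differentiable hL.nondegenerate a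
    A.linearIndependent_covector
  obtain ⟨o, ho, -⟩ := analyticOrderAt_wr_dual_comp hL.differentiable hwb hw
  exact ⟨o, ho⟩

theorem analyticOrderAt_form_ne_top (A : DecomposableHyperplane n k) (a : ℂ) :
    analyticOrderAt (fun z => A.form (Fbar z)) a ≠ ⊤ := by
  intro h
  obtain ⟨o, ho⟩ := hL.exists_order A a
  have h1 := hL.analyticOrderAt_factor_add A a
  rw [h, add_top, ho] at h1
  exact ENat.natCast_ne_top _ h1.symm

theorem analyticOrderAt_factor_ne_top (A : DecomposableHyperplane n k) (a : ℂ) :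
    analyticOrderAt g a ≠ ⊤ := by
  intro h
  obtain ⟨o, ho⟩ := hL.exists_order A a
  have h1 := hL.analyticOrderAt_factor_add A a
  rw [h, top_add, ho] at h1
  exact ENat.natCast_ne_top _ h1.symm

/-- The local inequality between the orders of vanishing. -/
theorem sum_tsub_add_le (hk : k ≤ n) {A : PluckerIndex n k → DecomposableHyperplane n k}
    (hA : LinearIndependent ℂ fun t => (A t).form) (a : ℂ) :
    ∑ t, (zeroDivisor (fun z => (A t).form (Fbar z)) a - (k + 1) * (n - k)) +
      (n + 1).choose (k + 1) * zeroDivisor g a ≤ n.choose k * zeroDivisor (wronskian G) a := by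
  obtain ⟨w, ν, -, hw⟩ := exists_isAdapted_jetForm hL.differentiable hL.nondegenerate a
    (b := fun i => LinearMap.proj (R := ℂ) (φ := fun _ : Fin (n + 1) => ℂ) i)
    (by
      have := (Pi.basisFun ℂ (Fin (n + 1))).dualBasis.linearIndependent
      convert! this using 1
      ext i j
      simp)
  have hspan : ⊤ ≤ Submodule.span ℂ (range w) := by
    refine (hw.linearIndependent.span_eq_top_of_card_eq_finrank ?_).ge
    rw [Subspace.dual_finrank_eq, Module.finrank_fin_fun, Fintype.card_fin]
  obtain ⟨o, ho, hosum⟩ := exists_wronskian_order hL.differentiable hw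
  obtain ⟨e, he, hedet⟩ := exists_dual_family hw.linearIndependent
  have hzW : zeroDivisor (wronskian G) a = o := by
    rw [zeroDivisor, analyticOrderNatAt, ho]
    rfl
  obtain ⟨γ, hγ⟩ : ∃ γ, zeroDivisor g a = γ := ⟨_, rfl⟩
  rw [hzW, hγ]
  -- the order of each form
  have hform : ∀ B : DecomposableHyperplane n k, ∀ w' : Fin (k + 1) → _, ∀ ν' : Fin (k + 1) → ℕ,
      (∀ i, w' i ∈ Submodule.span ℂ (range B.covector)) → IsAdapted (jetForm G a) w' ν' →
      zeroDivisor (fun z => B.form (Fbar z)) a + γ + ∑ j : Fin (k + 1), (j : ℕ) = ∑ j, ν' j := by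
    intro B w' ν' hwB hw'
    obtain ⟨oB, hoB, hsB⟩ := analyticOrderAt_wr_dual_comp hL.differentiable hwB hw'
    have h1 := hL.analyticOrderAt_factor_add B a
    rw [hoB, ← Nat.cast_analyticOrderNatAt (hL.analyticOrderAt_form_ne_top B a),
      ← Nat.cast_analyticOrderNatAt (hL.analyticOrderAt_factor_ne_top B a)] at h1
    have h2 : analyticOrderNatAt g a + analyticOrderNatAt (fun z => B.form (Fbar z)) a = oB := by
      exact_mod_cast h1
    rw [← hsB, ← h2, ← hγ, zeroDivisor, zeroDivisor]
    ring
  have hle : ∀ B : DecomposableHyperplane n k, ∀ t : PluckerIndex n k,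
      B.form (exteriorPower.ιMulti ℂ (k + 1) (e ∘ emb t)) ≠ 0 →
      zeroDivisor (fun z => B.form (Fbar z)) a + γ + ∑ j : Fin (k + 1), (j : ℕ) ≤
        ∑ j, ν (emb t j) := by
    intro B t ht
    obtain ⟨w', ν', hwb, hw'⟩ := exists_isAdapted_jetForm hL.differentiable hL.nondegenerate a
      B.linearIndependent_covector
    rw [hform B w' ν' hwb hw']
    rw [form_ιMulti_eq_dualDet] at ht
    exact sum_le_sum_of_dualDet_ne_zero hw hspan he hwb hw' ht
  -- the factor
  have hγle : γ + ∑ j : Fin (k + 1), (j : ℕ) ≤ ∑ j : Fin (k + 1), ν (Fin.castLE (by omega) j) := by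
    have hsub : IsAdapted (jetForm G a) (fun j : Fin (k + 1) => w (Fin.castLE (by omega) j))
        fun j => ν (Fin.castLE (by omega) j) :=
      ⟨hw.strictMono.comp (Fin.strictMono_castLE _), fun i => hw.eq_zero _, fun i => hw.ne_zero _⟩
    have hne : exteriorPower.ιMulti ℂ (k + 1)
        (fun j : Fin (k + 1) => w (Fin.castLE (by omega) j)) ≠ 0 := by
      intro h0
      have h1 := exteriorPower.pairingDual_ιMulti_ιMulti
        (fun j : Fin (k + 1) => w (Fin.castLE (by omega) j))
        fun j => e (Fin.castLE (by omega) j)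
      rw [h0, map_zero] at h1
      have h2 : (Matrix.of fun i j : Fin (k + 1) =>
          w (Fin.castLE (show k + 1 ≤ n + 1 by omega) j) (e (Fin.castLE (by omega) i))) = 1 := by
        ext i j
        simp [he, Matrix.one_apply, eq_comm]
      rw [h2, Matrix.det_one] at h1
      exact zero_ne_one h1
    have := hform ⟨_, hne⟩ _ _ (fun i => Submodule.subset_span (mem_range_self i)) hsub
    omega
  -- a permutation
  obtain ⟨c, hc0, hc⟩ := exists_det_form_ιMulti_eq hA
  have hdet := hc e
  have hdet0 : (Matrix.of fun s t : PluckerIndex n k =>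
      (A s).form (exteriorPower.ιMulti ℂ (k + 1) (e ∘ emb t))).det ≠ 0 := by
    rw [hdet]
    exact mul_ne_zero hc0 (pow_ne_zero _ hedet)
  rw [Matrix.det_apply] at hdet0
  obtain ⟨σ, -, hσ⟩ := Finset.exists_ne_zero_of_sum_ne_zero hdet0
  have hσ' : ∀ t, (A (σ t)).form (exteriorPower.ιMulti ℂ (k + 1) (e ∘ emb t)) ≠ 0 := by
    intro t ht
    refine hσ ?_
    rw [Finset.prod_eq_zero (Finset.mem_univ t) (by simpa using ht), smul_zero]
  have hterm : ∀ t, (zeroDivisor (fun z => (A (σ t)).form (Fbar z)) a - (k + 1) * (n - k)) + γ +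
      ∑ j, (emb t j : ℕ) ≤ ∑ j, ν (emb t j) := by
    intro t
    have h1 := hle _ t (hσ' t)
    have h2 := sum_emb_le hk t
    have h3 : ∑ j : Fin (k + 1), ν (Fin.castLE (show k + 1 ≤ n + 1 by omega) j) +
        ∑ j, (emb t j : ℕ) ≤ ∑ j, ν (emb t j) + ∑ j : Fin (k + 1), (j : ℕ) := by
      rw [← Finset.sum_add_distrib, ← Finset.sum_add_distrib]
      refine Finset.sum_le_sum fun j _ => ?_
      exact strictMono_add_le hw.strictMono (i := Fin.castLE (by omega) j) (val_le_emb t j)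
    omega
  have hsum := Finset.sum_le_sum fun t (_ : t ∈ Finset.univ) => hterm t
  rw [Finset.sum_add_distrib, Finset.sum_add_distrib, sum_sum_emb,
    sum_sum_emb ν, ← hosum, Finset.sum_const, Finset.card_univ,
    card_pluckerIndex, smul_eq_mul, smul_eq_mul, smul_eq_mul, mul_add,
    Equiv.sum_comp σ fun t => zeroDivisor (fun z => (A t).form (Fbar z)) a - (k + 1) * (n - k)]
    at hsum
  omega

end IsDerivedLift

end DerivedCurves

end

noncomputable section

namespace DerivedCurves

open Real Filter MeasureTheory Set Topology Metric ValueDistribution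

/-! ### Ratios of the components of the lift -/

/-- The matrix of the Leibniz rule for the multiplication by `ξ`. -/
def leibnizMatrix (m : ℕ) (ξ : ℂ → ℂ) (z : ℂ) : Matrix (Fin m) (Fin m) ℂ :=
  Matrix.of fun l j => (((j : ℕ).choose l : ℕ) : ℂ) * iteratedDeriv ((j : ℕ) - l) ξ z

theorem det_leibnizMatrix (m : ℕ) (ξ : ℂ → ℂ) (z : ℂ) : (leibnizMatrix m ξ z).det = ξ z ^ m := by
  rw [Matrix.det_of_isUpperTriangular]
  · simp [leibnizMatrix]
  · intro l j hlj
    have : (j : ℕ) < l := hlj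
    simp [leibnizMatrix, Nat.choose_eq_zero_of_lt this]

theorem iteratedDeriv_mul_eq_sum_leibnizMatrix {m : ℕ} {ξ h : ℂ → ℂ} {z : ℂ}
    (hξ : AnalyticAt ℂ ξ z) (hh : AnalyticAt ℂ h z) (j : Fin m) :
    iteratedDeriv (j : ℕ) (h * ξ) z =
      ∑ l : Fin m, iteratedDeriv (l : ℕ) h z * leibnizMatrix m ξ z l j := by
  rw [iteratedDeriv_mul hh.contDiffAt hξ.contDiffAt]
  have h1 : ∑ l : Fin m, iteratedDeriv (l : ℕ) h z * leibnizMatrix m ξ z l j =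
      ∑ l ∈ Finset.range m, iteratedDeriv l h z *
        ((((j : ℕ).choose l : ℕ) : ℂ) * iteratedDeriv ((j : ℕ) - l) ξ z) := by
    rw [Finset.sum_range]
    rfl
  rw [h1]
  have h2 : Finset.range ((j : ℕ) + 1) ⊆ Finset.range m := Finset.range_subset_range.2 j.2
  rw [← Finset.sum_subset h2]
  · exact Finset.sum_congr rfl fun l _ => by ring
  · intro l _ hl
    have : (j : ℕ) < l := by simpa using hl
    simp [Nat.choose_eq_zero_of_lt this]

theorem wr_val_mul {m : ℕ} {ξ : ℂ → ℂ} {h : Fin m → ℂ → ℂ} {z : ℂ} (hξ : AnalyticAt ℂ ξ z)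
    (hh : ∀ i, AnalyticAt ℂ (h i) z) :
    wr (fun j => (j : ℕ)) (fun i => h i * ξ) z = ξ z ^ m * wr (fun j => (j : ℕ)) h z := by
  rw [wr, wr, ← det_leibnizMatrix, mul_comm, ← Matrix.det_mul]
  congr 1
  ext i j
  simp only [Matrix.of_apply, Matrix.mul_apply]
  exact iteratedDeriv_mul_eq_sum_leibnizMatrix hξ (hh i) j

section Transposition

variable {k : ℕ} {q u : Fin (k + 1) → ℂ → ℂ} {v : ℂ → ℂ}

/-- The sum of the products of the `s`-th derivatives of `q` and the `j`-th derivatives of `u`. -/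
def derivPairing (q u : Fin (k + 1) → ℂ → ℂ) (s j : ℕ) (z : ℂ) : ℂ :=
  ∑ l, iteratedDeriv s (q l) z * iteratedDeriv j (u l) z

theorem meromorphic_iteratedDeriv {φ : ℂ → ℂ} (h : Meromorphic φ) (s : ℕ) :
    Meromorphic (iteratedDeriv s φ) := by
  induction s with
  | zero => simpa using h
  | succ s ih =>
    rw [iteratedDeriv_succ]
    exact ih.deriv

theorem deriv_derivPairing (hq : ∀ l, Meromorphic (q l)) (hu : ∀ l, Meromorphic (u l)) (s j : ℕ) :
    ∀ᶠ z in codiscrete ℂ, deriv (derivPairing q u s j) z =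
      derivPairing q u (s + 1) j z + derivPairing q u s (j + 1) z := by
  filter_upwards [eventually_all.2 fun l =>
    eventually_analyticAt_codiscrete (meromorphic_iteratedDeriv (hq l) s), eventually_all.2 fun l =>
    eventually_analyticAt_codiscrete (meromorphic_iteratedDeriv (hu l) j)] with z h1 h2
  have h3 : derivPairing q u s j =
      fun z => ∑ l, iteratedDeriv s (q l) z * iteratedDeriv j (u l) z := rfl
  rw [h3, deriv_fun_sum fun l _ => (h1 l).differentiableAt.fun_mul (h2 l).differentiableAt]
  simp only [derivPairing, ← Finset.sum_add_distrib, iteratedDeriv_succ]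
  exact Finset.sum_congr rfl fun l _ =>
    deriv_fun_mul (h1 l).differentiableAt (h2 l).differentiableAt

variable (hq : ∀ l, Meromorphic (q l)) (hu : ∀ l, Meromorphic (u l))
  (h : ∀ j ≤ k, derivPairing q u 0 j =ᶠ[codiscrete ℂ] iteratedDeriv j v)

include hq hu h

theorem derivPairing_eq_zero (s j : ℕ) (hsj : s + j < k) :
    derivPairing q u (s + 1) j =ᶠ[codiscrete ℂ] 0 := by
  induction s generalizing j with
  | zero =>
    filter_upwards [deriv_derivPairing hq hu 0 j, eventuallyEq_deriv_codiscrete (h j (by omega)),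
      h (j + 1) (by omega)] with z h1 h2 h3
    rw [h2, h3, iteratedDeriv_succ] at h1
    simpa using h1
  | succ s ih =>
    filter_upwards [deriv_derivPairing hq hu (s + 1) j,
      eventuallyEq_deriv_codiscrete (ih j (by omega)), ih (j + 1) (by omega)] with z h1 h2 h3
    rw [h2, h3] at h1
    simpa using h1.symm

theorem derivPairing_eq_sign_mul (s j : ℕ) (hsj : s + j = k) :
    derivPairing q u (s + 1) j =ᶠ[codiscrete ℂ] fun z => (-1) ^ s * derivPairing q u 1 k z := by
  induction s generalizing j with
  | zero =>
    obtain rfl : j = k := by omega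
    simp
  | succ s ih =>
    filter_upwards [deriv_derivPairing hq hu (s + 1) j, eventuallyEq_deriv_codiscrete
      (derivPairing_eq_zero hq hu h s j (by omega)), ih (j + 1) (by omega)] with z h1 h2 h3
    rw [h2, h3] at h1
    simp only [Pi.zero_def, deriv_const] at h1
    rw [pow_succ]
    linear_combination -h1

theorem derivPairing_one_ne_zero
    (hne : ¬ wr (fun j : Fin (k + 2) => (j : ℕ)) (Fin.snoc u v : Fin (k + 2) → ℂ → ℂ)
      =ᶠ[codiscrete ℂ] 0) :
    ∀ᶠ z in codiscrete ℂ, derivPairing q u 1 k z ≠ 0 := by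
  have hmer : Meromorphic (derivPairing q u 1 k) := by
    have : derivPairing q u 1 k = ∑ l, iteratedDeriv 1 (q l) * iteratedDeriv k (u l) := by
      ext z
      simp [derivPairing, Finset.sum_apply]
    rw [this]
    exact Meromorphic.sum fun l _ => (meromorphic_iteratedDeriv (hq l) 1).mul
      (meromorphic_iteratedDeriv (hu l) k)
  rcases eventuallyEq_zero_or_meromorphicOrderAt_ne_top hmer with h0 | h0
  · refine absurd ?_ hne
    filter_upwards [h0, deriv_derivPairing hq hu 0 k, eventuallyEq_deriv_codiscrete (h k le_rfl),
      eventually_all.2 fun j : Fin (k + 1) => h j (by omega)] with z h1 h2 h3 h4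
    rw [h3, h1] at h2
    simp only [Pi.zero_apply, zero_add, ← iteratedDeriv_succ] at h2
    have h5 : ∀ j : Fin (k + 2), derivPairing q u 0 j z = iteratedDeriv (j : ℕ) v z := by
      intro j
      refine Fin.lastCases ?_ (fun j => ?_) j
      · simpa using h2.symm
      · exact h4 j
    rw [wr, Pi.zero_apply]
    refine Matrix.exists_vecMul_eq_zero_iff.1 ⟨(Fin.snoc (fun l => q l z) (-1) : Fin (k + 2) → ℂ),
      fun hcon => ?_, ?_⟩
    · simpa using congrFun hcon (Fin.last (k + 1))
    · ext j
      simp only [Matrix.vecMul, dotProduct, Matrix.of_apply, Pi.zero_apply]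
      rw [Fin.sum_univ_castSucc]
      simp only [Fin.snoc_castSucc, Fin.snoc_last]
      rw [← h5]
      simp only [derivPairing, iteratedDeriv_zero]
      ring
  · exact eventually_ne_zero_of_meromorphicOrderAt_ne_top hmer h0

theorem moderate_div_of_derivPairing {𝔤 : Gauge} (hqm : ∀ l, 𝔤.Moderate (q l))
    (hne : ¬ wr (fun j : Fin (k + 2) => (j : ℕ)) (Fin.snoc u v : Fin (k + 2) → ℂ → ℂ)
      =ᶠ[codiscrete ℂ] 0) (hu0 : ∀ᶠ z in codiscrete ℂ, u 0 z ≠ 0) (l : Fin (k + 1)) :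
    𝔤.Moderate (u l / u 0) := by
  set B : Fin (k + 1) → Fin (k + 1) → ℂ → ℂ := fun s l => iteratedDeriv (s + 1 : ℕ) (q l) with hB
  set D : Fin (k + 1) → ℂ → ℂ := fun l z =>
    (Matrix.of fun i j => B i j z).adjugate l (Fin.last k) with hD
  have hDm : ∀ l, 𝔤.Moderate (D l) := by
    intro l
    have h1 : D l = fun z => (Matrix.of fun i j => (if i = Fin.last k then
        (fun _ => (Pi.single l 1 : Fin (k + 1) → ℂ) j) else B i j : ℂ → ℂ) z).det := by
      ext z
      simp only [hD, Matrix.adjugate_apply]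
      congr 1
      ext i j
      rw [Matrix.updateRow_apply]
      split_ifs with hi <;> simp [hi]
    rw [h1]
    refine Gauge.Moderate.det fun i j => ?_
    split_ifs
    · exact Gauge.moderate_const _
    · exact (hqm j).iteratedDeriv _
  refine ((hDm l).div (hDm 0)).congr ?_
  have hrel : ∀ᶠ z in codiscrete ℂ, ∀ s j : Fin (k + 1),
      ((s : ℕ) + j < k → derivPairing q u (s + 1) j z = 0) ∧
      ((s : ℕ) + j = k → derivPairing q u (s + 1) j z = (-1) ^ (s : ℕ) * derivPairing q u 1 k z) := by
    refine eventually_all.2 fun s => eventually_all.2 fun j => ?_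
    refine Filter.Eventually.and ?_ ?_
    · by_cases hsj : (s : ℕ) + j < k
      · filter_upwards [derivPairing_eq_zero hq hu h s j hsj] with z hz _
        exact hz
      · exact Eventually.of_forall fun z hz => absurd hz hsj
    · by_cases hsj : (s : ℕ) + j = k
      · filter_upwards [derivPairing_eq_sign_mul hq hu h s j hsj] with z hz _
        exact hz
      · exact Eventually.of_forall fun z hz => absurd hz hsj
  filter_upwards [hrel, derivPairing_one_ne_zero hq hu h hne, hu0] with z h1 h2 h3
  set M : Matrix (Fin (k + 1)) (Fin (k + 1)) ℂ := Matrix.of fun i j => B i j z with hM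
  have hMu : ∀ s j : Fin (k + 1), (M * Matrix.of fun l i : Fin (k + 1) =>
      iteratedDeriv (k - i : ℕ) (u l) z) s j = derivPairing q u (s + 1) (k - j) z := by
    intro s j
    simp [Matrix.mul_apply, derivPairing, hM, hB]
  have hdet : M.det ≠ 0 := by
    have h4 : (M * Matrix.of fun l i : Fin (k + 1) => iteratedDeriv (k - i : ℕ) (u l) z).det ≠ 0 := by
      rw [Matrix.det_of_isLowerTriangular]
      · refine Finset.prod_ne_zero_iff.2 fun s _ => ?_
        rw [hMu, (h1 s ⟨k - s, by omega⟩).2 (by simp only; omega)]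
        exact mul_ne_zero (pow_ne_zero _ (by norm_num)) h2
      · intro s j hsj
        have hsj' : (s : ℕ) < j := hsj
        rw [hMu]
        exact (h1 s ⟨k - j, by omega⟩).1 (by simp only; omega)
    rw [Matrix.det_mul] at h4
    exact left_ne_zero_of_mul h4
  obtain ⟨c, hc⟩ : ∃ c, M.mulVec (fun l => u l z) = Pi.single (Fin.last k) c := by
    refine ⟨derivPairing q u (k + 1) 0 z, funext fun s => ?_⟩
    have h4 : M.mulVec (fun l => u l z) s = derivPairing q u (s + 1) 0 z := by
      simp [Matrix.mulVec, dotProduct, derivPairing, hM, hB]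
    rw [h4]
    by_cases hs : s = Fin.last k
    · subst hs
      simp
    · rw [Pi.single_eq_of_ne hs]
      have hs' : (s : ℕ) ≠ k := fun h' => hs (Fin.ext h')
      exact (h1 s 0).1 (by simp only [Fin.val_zero]; omega)
  have hul : ∀ l, M.det * u l z = D l z * c := by
    intro l
    have h5 := congrArg M.adjugate.mulVec hc
    rw [Matrix.mulVec_mulVec, Matrix.adjugate_mul, Matrix.smul_mulVec, Matrix.one_mulVec] at h5
    have h6 := congrFun h5 l
    rw [Matrix.mulVec_single] at h6
    simpa [hD, mul_comm] using h6
  have h7 : D 0 z ≠ 0 := by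
    intro h8
    have := hul 0
    rw [h8, zero_mul] at this
    exact mul_ne_zero hdet h3 this
  simp only [Pi.div_apply]
  rw [div_eq_div_iff h7 h3]
  have e1 := hul l
  have e2 := hul 0
  refine mul_left_cancel₀ hdet ?_
  linear_combination D l z * e2 - D 0 z * e1

end Transposition

end DerivedCurves

end

noncomputable section

namespace DerivedCurves

open Real Filter MeasureTheory Set Topology Metric ValueDistribution

/-! ### The Wronskian identity -/

theorem eventually_ne_zero_of_exists {φ : ℂ → ℂ} (hφ : Differentiable ℂ φ) (h : ∃ z, φ z ≠ 0) :
    ∀ᶠ z in codiscrete ℂ, φ z ≠ 0 := by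
  obtain ⟨z, hz⟩ := h
  exact AnalyticOnNhd.preimage_zero_mem_codiscrete (fun z _ => hφ.analyticAt z) hz

theorem exists_ne_zero_of_analyticOrderAt_ne_top {φ : ℂ → ℂ} {a : ℂ}
    (h : analyticOrderAt φ a ≠ ⊤) : ∃ z, φ z ≠ 0 := by
  by_contra! hcon
  exact h (analyticOrderAt_eq_top.2 (Eventually.of_forall hcon))

/-- The linear form on the exterior power given by a family of covectors. -/
def covectorForm {n k : ℕ} (c : Fin (k + 1) → Module.Dual ℂ (Fin (n + 1) → ℂ)) :
    Module.Dual ℂ (⋀[ℂ]^(k + 1) (Fin (n + 1) → ℂ)) :=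
  exteriorPower.pairingDual ℂ (Fin (n + 1) → ℂ) (k + 1) (exteriorPower.ιMulti ℂ (k + 1) c)

theorem covectorForm_ιMulti {n k : ℕ} (c : Fin (k + 1) → Module.Dual ℂ (Fin (n + 1) → ℂ))
    (v : Fin (k + 1) → Fin (n + 1) → ℂ) :
    covectorForm c (exteriorPower.ιMulti ℂ (k + 1) v) = dualDet c v := by
  rw [covectorForm, exteriorPower.pairingDual_ιMulti_ιMulti, dualDet, ← Matrix.det_transpose]
  rfl

theorem ιMulti_ne_zero_of_dualDet_ne_zero {n k : ℕ}
    {c : Fin (k + 1) → Module.Dual ℂ (Fin (n + 1) → ℂ)} {v : Fin (k + 1) → Fin (n + 1) → ℂ}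
    (h : dualDet c v ≠ 0) : exteriorPower.ιMulti ℂ (k + 1) c ≠ 0 := by
  intro h0
  rw [← covectorForm_ιMulti, covectorForm, h0] at h
  simp at h

/-- The coordinates on `ℂⁿ⁺¹`, as linear forms. -/
def coordinate {n : ℕ} (i : Fin (n + 1)) : Module.Dual ℂ (Fin (n + 1) → ℂ) :=
  LinearMap.proj i

theorem coordinate_apply {n : ℕ} (i : Fin (n + 1)) (v : Fin (n + 1) → ℂ) : coordinate i v = v i :=
  rfl

theorem linearIndependent_coordinate (n : ℕ) : LinearIndependent ℂ (coordinate (n := n)) := by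
  have := (Pi.basisFun ℂ (Fin (n + 1))).dualBasis.linearIndependent
  convert! this using 1
  ext i j
  simp [coordinate]

namespace IsDerivedLift

variable {n k : ℕ} {G : ℂ → Fin (n + 1) → ℂ} {g : ℂ → ℂ}
  {Fbar : ℂ → ⋀[ℂ]^(k + 1) (Fin (n + 1) → ℂ)} (hL : IsDerivedLift k G g Fbar)

include hL

theorem eventually_wr_ne_zero {m : ℕ} {b : Fin m → Module.Dual ℂ (Fin (n + 1) → ℂ)}
    (hb : LinearIndependent ℂ b) :
    ∀ᶠ z in codiscrete ℂ, wr (fun j : Fin m => (j : ℕ)) (fun i z => b i (G z)) z ≠ 0 := by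
  obtain ⟨w, ν, hwb, hw⟩ := exists_isAdapted_jetForm hL.differentiable hL.nondegenerate 0 hb
  obtain ⟨o, ho, -⟩ := analyticOrderAt_wr_dual_comp hL.differentiable hwb hw
  refine eventually_ne_zero_of_exists (fun a =>
    (analyticAt_wr_dual_comp hL.differentiable b _ a).differentiableAt)
    (exists_ne_zero_of_analyticOrderAt_ne_top (a := 0) ?_)
  rw [ho]
  exact ENat.natCast_ne_top o

theorem eventually_form_ne_zero (A : DecomposableHyperplane n k) :
    ∀ᶠ z in codiscrete ℂ, A.form (Fbar z) ≠ 0 :=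
  eventually_ne_zero_of_exists (hL.holomorphic _)
    (exists_ne_zero_of_analyticOrderAt_ne_top (hL.analyticOrderAt_form_ne_top A 0))

theorem moderate_components (hk : k < n) {𝔤 : Gauge}
    (hmod : ∀ φ ψ : Module.Dual ℂ (⋀[ℂ]^(k + 1) (Fin (n + 1) → ℂ)), (∃ z, ψ (Fbar z) ≠ 0) →
      𝔤.Moderate fun z => φ (Fbar z) / ψ (Fbar z)) (i : Fin (n + 1)) :
    𝔤.Moderate fun z => G z i / G z 0 := by
  set b : Fin (k + 1) → Module.Dual ℂ (Fin (n + 1) → ℂ) :=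
    fun l => coordinate (Fin.castLE (by omega) l) with hb
  have hbne : exteriorPower.ιMulti ℂ (k + 1) b ≠ 0 := by
    refine ιMulti_ne_zero_of_dualDet_ne_zero
      (v := fun l => Pi.single (Fin.castLE (by omega) l) 1) ?_
    have h1 : (Matrix.of fun i j : Fin (k + 1) => b i (Pi.single (Fin.castLE (by omega) j) 1)) =
        1 := by
      ext i j
      simp [hb, coordinate_apply, Matrix.one_apply, Pi.single_apply]
    rw [dualDet, h1, Matrix.det_one]
    exact one_ne_zero
  set A₀ : DecomposableHyperplane n k := ⟨b, hbne⟩ with hA₀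
  set q : Fin (n + 1) → Fin (k + 1) → ℂ → ℂ := fun i l z =>
    covectorForm (Function.update b l (coordinate i)) (Fbar z) / A₀.form (Fbar z) with hq
  set u : Fin (k + 1) → ℂ → ℂ := fun l z => b l (G z) with hu
  have hqm : ∀ i l, 𝔤.Moderate (q i l) := fun i l =>
    hmod _ _ (exists_ne_zero_of_analyticOrderAt_ne_top (hL.analyticOrderAt_form_ne_top A₀ 0))
  have hg : ∀ᶠ z in codiscrete ℂ, g z ≠ 0 :=
    eventually_ne_zero_of_exists hL.differentiable_factor
      (exists_ne_zero_of_analyticOrderAt_ne_top (hL.analyticOrderAt_factor_ne_top A₀ 0))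
  have hpair : ∀ i, ∀ j ≤ k, derivPairing (q i) u 0 j =ᶠ[codiscrete ℂ]
      iteratedDeriv j fun z => coordinate i (G z) := by
    intro i j hj
    filter_upwards [hg, hL.eventually_form_ne_zero A₀] with z h1 h2
    have h3 : ∀ c : Fin (k + 1) → Module.Dual ℂ (Fin (n + 1) → ℂ),
        g z * covectorForm c (Fbar z) =
          (Matrix.of fun i j : Fin (k + 1) => c i (iteratedDeriv (j : ℕ) G z)).det := by
      intro c
      have h4 := congrArg (covectorForm c) (hL.eq_smul z)
      rw [map_smul, smul_eq_mul, wedgeDerivatives, covectorForm_ιMulti] at h4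
      exact h4.symm
    set M : Matrix (Fin (k + 1)) (Fin (k + 1)) ℂ :=
      Matrix.of fun i j : Fin (k + 1) => b i (iteratedDeriv (j : ℕ) G z) with hM
    have hMdet : M.det = g z * A₀.form (Fbar z) := (h3 b).symm
    have h5 := congrFun (Matrix.mulVec_cramer M.transpose
      fun j => coordinate i (iteratedDeriv (j : ℕ) G z)) ⟨j, by omega⟩
    rw [Matrix.det_transpose, hMdet] at h5
    simp only [Matrix.mulVec, dotProduct, Matrix.transpose_apply, Pi.smul_apply, smul_eq_mul] at h5
    rw [iteratedDeriv_dual_comp hL.differentiable]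
    have h6 : ∀ l, M.transpose.cramer (fun j => coordinate i (iteratedDeriv (j : ℕ) G z)) l =
        g z * covectorForm (Function.update b l (coordinate i)) (Fbar z) := by
      intro l
      rw [Matrix.cramer_transpose_apply, h3]
      congr 1
      ext s t
      by_cases hs : s = l
      · subst hs
        simp
      · simp [hs, hM]
    simp only [h6] at h5
    have h7 : g z * A₀.form (Fbar z) * derivPairing (q i) u 0 j z =
        g z * A₀.form (Fbar z) * coordinate i (iteratedDeriv j G z) := by
      rw [← h5, derivPairing, Finset.mul_sum]
      refine Finset.sum_congr rfl fun l _ => ?_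
      simp only [hu, hq, iteratedDeriv_dual_comp hL.differentiable, iteratedDeriv_zero, hM,
        Matrix.of_apply]
      field_simp
    exact mul_left_cancel₀ (mul_ne_zero h1 h2) h7
  have hum : ∀ l, Meromorphic (u l) := fun l a =>
    ((differentiable_dual_comp hL.differentiable (b l)).analyticAt a).meromorphicAt
  have hu0 : ∀ᶠ z in codiscrete ℂ, u 0 z ≠ 0 :=
    eventually_ne_zero_of_exists (differentiable_dual_comp hL.differentiable (b 0))
      (hL.nondegenerate _ ((linearIndependent_coordinate n).ne_zero _))
  have hdiv : ∀ l, 𝔤.Moderate (u l / u 0) := by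
    set i₀ : Fin (n + 1) := ⟨k + 1, by omega⟩ with hi₀
    refine moderate_div_of_derivPairing (q := q i₀) (v := fun z => coordinate i₀ (G z))
      (fun l => (hqm i₀ l).meromorphic) hum (hpair i₀) (hqm i₀) (fun h0 => ?_) hu0
    have h1 := hL.eventually_wr_ne_zero (b := fun j : Fin (k + 2) =>
      coordinate (Fin.castLE (by omega) j)) ((linearIndependent_coordinate n).comp _
        (Fin.castLE_injective (by omega)))
    have h2 : (Fin.snoc u (fun z => coordinate i₀ (G z)) : Fin (k + 2) → ℂ → ℂ) =
        fun j z => coordinate (Fin.castLE (by omega) j) (G z) := by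
      ext j z
      refine Fin.lastCases ?_ (fun j => ?_) j
      · rw [Fin.snoc_last]
        rfl
      · rw [Fin.snoc_castSucc]
        rfl
    rw [h2] at h0
    have h3 := h0.and h1
    obtain ⟨z, hz⟩ := (eventually_codiscrete_iff.1 h3 0).exists
    exact hz.2 hz.1
  refine (Gauge.Moderate.sum Finset.univ fun l _ => (hqm i l).mul (hdiv l)).congr ?_
  filter_upwards [hpair i 0 (Nat.zero_le _), hu0] with z h1 h2
  simp only [derivPairing, iteratedDeriv_zero, coordinate_apply] at h1
  have h3 : G z 0 = u 0 z := rfl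
  rw [← h1, h3, Finset.sum_apply, Finset.sum_div]
  refine Finset.sum_congr rfl fun l _ => ?_
  simp only [Pi.mul_apply, Pi.div_apply]
  ring

/-- The comparison of the Wronskian with the product of linearly independent decomposable
forms. -/
theorem exists_slow_wronskian_pow_eq (hk : k < n) {𝔤 : Gauge}
    (hmod : ∀ φ ψ : Module.Dual ℂ (⋀[ℂ]^(k + 1) (Fin (n + 1) → ℂ)), (∃ z, ψ (Fbar z) ≠ 0) →
      𝔤.Moderate fun z => φ (Fbar z) / ψ (Fbar z))
    {A : PluckerIndex n k → DecomposableHyperplane n k}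
    (hA : LinearIndependent ℂ fun t => (A t).form) :
    ∃ ρ, 𝔤.Slow ρ ∧ ∀ᶠ z in codiscrete ℂ, wronskian G z ^ n.choose k =
      ρ z * (g z ^ (n + 1).choose (k + 1) * ∏ t, (A t).form (Fbar z)) := by
  set ξ : ℂ → ℂ := fun z => (G z 0)⁻¹ with hξ
  set h : PluckerIndex n k → Fin (k + 1) → ℂ → ℂ := fun s i =>
    (fun z => (A s).covector i (G z)) * ξ with hh
  have hhm : ∀ s i, 𝔤.Moderate (h s i) := by
    intro s i
    have h1 : h s i = ∑ l, (fun _ => (A s).covector i (Pi.single l 1)) *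
        fun z => G z l / G z 0 := by
      ext z
      simp only [hh, hξ, Pi.mul_apply, Finset.sum_apply]
      rw [LinearMap.pi_apply_eq_sum_univ ((A s).covector i) (G z), Finset.sum_mul]
      refine Finset.sum_congr rfl fun l _ => ?_
      rw [smul_eq_mul, div_eq_mul_inv]
      have : (fun j => if l = j then (1 : ℂ) else 0) = Pi.single l 1 := by
        ext j
        simp [Pi.single_apply, eq_comm]
      rw [this]
      ring
    rw [h1]
    exact Gauge.Moderate.sum _ fun l _ =>
      (Gauge.moderate_const _).mul (hL.moderate_components hk hmod l)
  choose ρ hρ hρe using fun s t : PluckerIndex n k =>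
    Gauge.exists_slow_wr_eq_mul (fun j => (emb t j : ℕ)) (hhm s)
  obtain ⟨c, hc0, hc⟩ := exists_det_form_ιMulti_eq hA
  refine ⟨_, (Gauge.slow_const c⁻¹).mul (Gauge.Slow.det fun s t => hρ s t), ?_⟩
  have hG0 : ∀ᶠ z in codiscrete ℂ, coordinate 0 (G z) ≠ 0 :=
    eventually_ne_zero_of_exists (differentiable_dual_comp hL.differentiable _)
      (hL.nondegenerate _ ((linearIndependent_coordinate n).ne_zero 0))
  filter_upwards [hG0, eventually_all.2 fun s => eventually_all.2 fun t => hρe s t] with z h1 h2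
  have hGa : ∀ c : Module.Dual ℂ (Fin (n + 1) → ℂ), AnalyticAt ℂ (fun z => c (G z)) z :=
    fun c => (differentiable_dual_comp hL.differentiable c).analyticAt z
  have hξa : AnalyticAt ℂ ξ z := (hGa (coordinate 0)).inv h1
  have hξ0 : ξ z ≠ 0 := inv_ne_zero h1
  set v : Fin (n + 1) → Fin (n + 1) → ℂ := fun j =>
    ∑ l : Fin (n + 1), leibnizMatrix (n + 1) ξ z l j • iteratedDeriv (l : ℕ) G z with hv
  have hcov : ∀ (c : Module.Dual ℂ (Fin (n + 1) → ℂ)) (j : Fin (n + 1)),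
      iteratedDeriv (j : ℕ) ((fun z => c (G z)) * ξ) z = c (v j) := by
    intro c j
    rw [iteratedDeriv_mul_eq_sum_leibnizMatrix hξa (hGa c), hv, map_sum]
    refine Finset.sum_congr rfl fun l _ => ?_
    rw [iteratedDeriv_dual_comp hL.differentiable, map_smul, smul_eq_mul, mul_comm]
  have hdetv : (Matrix.of v).det = ξ z ^ (n + 1) * wronskian G z := by
    rw [wronskian, ← det_leibnizMatrix, ← Matrix.det_transpose (leibnizMatrix _ _ _),
      ← Matrix.det_mul]
    congr 1
    ext i j
    simp [hv, Matrix.mul_apply, Finset.sum_apply]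
  have hentry : ∀ s t, (A s).form (exteriorPower.ιMulti ℂ (k + 1) (v ∘ emb t)) =
      (ξ z ^ (k + 1) * (g z * (A s).form (Fbar z))) * ρ s t z := by
    intro s t
    have h3 : wr (fun j => (emb t j : ℕ)) (h s) z = dualDet (A s).covector (v ∘ emb t) := by
      simp only [wr, dualDet, hh, hcov, Function.comp_apply]
    have h4 := congrArg (A s).form (hL.eq_smul z)
    rw [map_smul, smul_eq_mul, form_wedgeDerivatives hL.differentiable] at h4
    rw [form_ιMulti_eq_dualDet, ← h3, h2, wr_val_mul hξa fun i => hGa _, h4]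
    ring
  have h5 := hc v
  simp only [hentry] at h5
  have h6 : (Matrix.of fun s t : PluckerIndex n k =>
      (ξ z ^ (k + 1) * (g z * (A s).form (Fbar z))) * ρ s t z).det =
      (∏ s, (ξ z ^ (k + 1) * (g z * (A s).form (Fbar z)))) *
        (Matrix.of fun s t => ρ s t z).det := Matrix.det_mul_column _ _
  rw [h6, Finset.prod_mul_distrib, Finset.prod_mul_distrib, Finset.prod_const, Finset.prod_const,
    Finset.card_univ, card_pluckerIndex, hdetv, mul_pow, ← pow_mul, ← pow_mul,
    mul_comm (k + 1), ← Nat.add_one_mul_choose_eq] at h5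
  have h7 : ξ z ^ ((n + 1) * n.choose k) ≠ 0 := pow_ne_zero _ hξ0
  refine mul_left_cancel₀ (mul_ne_zero hc0 h7) ?_
  simp only [Pi.mul_apply]
  rw [mul_assoc, ← h5]
  field_simp

end IsDerivedLift

end DerivedCurves

end

noncomputable section

namespace DerivedCurves

open Real Filter MeasureTheory Set Topology Metric ValueDistribution

/-! ### Jensen's formula and counting functions -/

theorem analyticOrderAt_ne_top_of_exists {h : ℂ → ℂ} (hh : Differentiable ℂ h)
    (hne : ∃ z, h z ≠ 0) (a : ℂ) : analyticOrderAt h a ≠ ⊤ := by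
  intro h1
  have h2 : h = 0 := AnalyticOnNhd.eq_of_eventuallyEq (z₀ := a)
    (fun z _ => hh.analyticAt z) (fun z _ => analyticAt_const) (analyticOrderAt_eq_top.1 h1)
  obtain ⟨z, hz⟩ := hne
  exact hz (congrFun h2 z)

theorem divisor_eq_zeroDivisor {h : ℂ → ℂ} (hh : Differentiable ℂ h)
    (hne : ∃ z, h z ≠ 0) (a : ℂ) : MeromorphicOn.divisor h univ a = (zeroDivisor h a : ℤ) := by
  have hm : Meromorphic h := fun z => (hh.analyticAt z).meromorphicAt
  rw [MeromorphicOn.divisor_apply hm.meromorphicOn (mem_univ a),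
    (hh.analyticAt a).meromorphicOrderAt_eq,
    ← Nat.cast_analyticOrderNatAt (analyticOrderAt_ne_top_of_exists hh hne a)]
  rfl

/-- Jensen's formula for entire functions. -/
theorem exists_circleAverage_log_eq_sum {h : ℂ → ℂ} (hh : Differentiable ℂ h)
    (hne : ∃ z, h z ≠ 0) :
    ∃ c : ℝ, ∀ r > 0, ∀ F : Finset ℂ, (∀ z ∈ F, ‖z‖ ≤ r) →
      (∀ z, ‖z‖ ≤ r → zeroDivisor h z ≠ 0 → z ∈ F) →
      circleAverage (fun z => log ‖h z‖) 0 r =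
        ∑ z ∈ F, (zeroDivisor h z : ℝ) * (log r - log ‖z‖) + c := by
  have hm : Meromorphic h := fun z => (hh.analyticAt z).meromorphicAt
  refine ⟨log ‖meromorphicTrailingCoeffAt h 0‖, fun r hr F hF hF' => ?_⟩
  have h1 := Function.locallyFinsuppWithin.logCounting_divisor_eq_circleAverage_sub_const
    hm hr.ne'
  rw [logCounting_eq_sum (MeromorphicOn.divisor h univ) hr
    (F := F.filter fun z => zeroDivisor h z ≠ 0)] at h1
  · rw [Finset.sum_filter_of_ne] at h1
    · simp only [divisor_eq_zeroDivisor hh hne, Int.cast_natCast] at h1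
      linarith
    · intro z _ hz h0
      rw [divisor_eq_zeroDivisor hh hne, h0] at hz
      simp at hz
  · intro z
    rw [divisor_eq_zeroDivisor hh hne, Finset.mem_filter]
    simp only [ne_eq, Nat.cast_eq_zero]
    exact ⟨fun h => ⟨hF z h.1, h.2⟩, fun h => ⟨hF' z h.1 h.2, h.2⟩⟩

theorem exists_finset_zeroDivisor {h : ℂ → ℂ} (hh : Differentiable ℂ h)
    (hne : ∃ z, h z ≠ 0) (r : ℝ) :
    ∃ F : Finset ℂ, ∀ z, z ∈ F ↔ ‖z‖ ≤ r ∧ zeroDivisor h z ≠ 0 := by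
  obtain ⟨F, hF⟩ := exists_finset_support (MeromorphicOn.divisor h univ) r
  refine ⟨F, fun z => ?_⟩
  rw [hF, divisor_eq_zeroDivisor hh hne]
  simp

theorem truncatedDegree_eq_sum (m : ℕ) (E : ℂ → ℕ) {r t : ℝ} {F : Finset ℂ}
    (hF : ∀ z, ‖z‖ ≤ r → E z ≠ 0 → z ∈ F) (ht : t ≤ r) :
    truncatedDegree m E t = ∑ z ∈ F, if ‖z‖ < t then min m (E z) else 0 := by
  rw [truncatedDegree, finsum_mem_def, finsum_eq_sum_of_support_subset (s := F)]
  · refine Finset.sum_congr rfl fun z _ => ?_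
    by_cases hz : ‖z‖ < t
    · rw [indicator_of_mem (by simpa using hz), if_pos hz]
    · rw [indicator_of_notMem (by simpa using hz), if_neg hz]
  · intro z hz
    have h1 : z ∈ ball (0 : ℂ) t := by
      by_contra hcon
      exact hz (indicator_of_notMem hcon _)
    rw [Function.mem_support, indicator_of_mem h1] at hz
    refine hF z ((mem_ball_zero_iff.1 h1).le.trans ht) fun h0 => hz ?_
    simp [h0]

theorem intervalIntegrable_indicator_inv (a r : ℝ) (hr : 1 ≤ r) :
    IntervalIntegrable (indicator (Ioi a) fun t : ℝ => 1 / t) volume 1 r := by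
  rw [intervalIntegrable_iff]
  refine IntegrableOn.indicator ?_ measurableSet_Ioi
  rw [← intervalIntegrable_iff]
  refine ContinuousOn.intervalIntegrable fun t ht => ?_
  rw [uIcc_of_le hr] at ht
  exact (continuousAt_const.div continuousAt_id (by simp only [id]; linarith [ht.1])).continuousWithinAt

theorem integral_indicator_inv {a r : ℝ} (hr : 1 ≤ r) (ha : a ≤ r) :
    ∫ t in (1 : ℝ)..r, indicator (Ioi a) (fun t : ℝ => 1 / t) t = log r - log (max 1 a) := by
  have h1 : (1 : ℝ) ≤ max 1 a := le_max_left _ _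
  have h2 : max 1 a ≤ r := max_le hr ha
  have hi : ∀ {x y}, 1 ≤ x → x ≤ y → y ≤ r →
      IntervalIntegrable (indicator (Ioi a) fun t : ℝ => 1 / t) volume x y := fun hx hxy hy =>
    (intervalIntegrable_indicator_inv a r hr).mono_set (by
      rw [uIcc_of_le hxy, uIcc_of_le hr]
      exact Icc_subset_Icc hx hy)
  rw [← intervalIntegral.integral_add_adjacent_intervals (hi le_rfl h1 h2) (hi h1 h2 le_rfl)]
  have e1 : ∫ t in (1 : ℝ)..max 1 a, indicator (Ioi a) (fun t : ℝ => 1 / t) t = 0 := by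
    rw [intervalIntegral.integral_of_le h1]
    refine setIntegral_eq_zero_of_forall_eq_zero fun t ht => indicator_of_notMem ?_ _
    simp only [mem_Ioc, le_max_iff, mem_Ioi, not_lt] at ht ⊢
    rcases ht.2 with h | h
    · linarith [ht.1]
    · exact h
  have e2 : ∫ t in max 1 a..r, indicator (Ioi a) (fun t : ℝ => 1 / t) t =
      ∫ t in max 1 a..r, 1 / t := by
    rw [intervalIntegral.integral_of_le h2, intervalIntegral.integral_of_le h2]
    refine setIntegral_congr_fun measurableSet_Ioc fun t ht => indicator_of_mem ?_ _
    exact (le_max_right 1 a).trans_lt ht.1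
  rw [e1, e2, integral_one_div_of_pos (by linarith) (by linarith), zero_add,
    log_div (by linarith) (by linarith)]

theorem truncatedCounting_eq_sum (m : ℕ) (E : ℂ → ℕ) {r : ℝ} (hr : 1 ≤ r) {F : Finset ℂ}
    (hF : ∀ z ∈ F, ‖z‖ ≤ r) (hF' : ∀ z, ‖z‖ ≤ r → E z ≠ 0 → z ∈ F) :
    truncatedCounting m E r =
      ∑ z ∈ F, (min m (E z) : ℕ) * (log r - log (max 1 ‖z‖)) := by
  have h1 : truncatedCounting m E r = ∫ t in (1 : ℝ)..r,
      ∑ z ∈ F, ((min m (E z) : ℕ) : ℝ) * indicator (Ioi ‖z‖) (fun t : ℝ => 1 / t) t := by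
    rw [truncatedCounting, intervalIntegral.integral_of_le hr, intervalIntegral.integral_of_le hr]
    refine setIntegral_congr_fun measurableSet_Ioc fun t ht => ?_
    rw [truncatedDegree_eq_sum m E hF' ht.2, Nat.cast_sum, Finset.sum_div]
    refine Finset.sum_congr rfl fun z _ => ?_
    by_cases hz : ‖z‖ < t
    · rw [if_pos hz, indicator_of_mem (by simpa using hz), mul_one_div]
    · rw [if_neg hz, indicator_of_notMem (by simpa using hz)]
      simp
  rw [h1, intervalIntegral.integral_finsetSum fun z _ =>
    (intervalIntegrable_indicator_inv ‖z‖ r hr).const_mul _]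
  refine Finset.sum_congr rfl fun z hz => ?_
  rw [intervalIntegral.integral_const_mul, integral_indicator_inv hr (hF z hz)]

theorem exists_sum_le_truncatedCounting (m : ℕ) (E : ℂ → ℕ) {F₁ : Finset ℂ}
    (hF₁ : ∀ z, z ∈ F₁ ↔ ‖z‖ ≤ 1 ∧ E z ≠ 0) :
    ∃ c : ℝ, ∀ r ≥ 1, ∀ F : Finset ℂ, (∀ z ∈ F, ‖z‖ ≤ r) → (∀ z, ‖z‖ ≤ r → E z ≠ 0 → z ∈ F) →
      ∑ z ∈ F, (min m (E z) : ℕ) * (log r - log ‖z‖) ≤ truncatedCounting m E r + c := by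
  refine ⟨∑ z ∈ F₁, (min m (E z) : ℕ) * (log (max 1 ‖z‖) - log ‖z‖), fun r hr F hF hF' => ?_⟩
  have h1 : ∑ z ∈ F₁, ((min m (E z) : ℕ) : ℝ) * (log (max 1 ‖z‖) - log ‖z‖) =
      ∑ z ∈ F, ((min m (E z) : ℕ) : ℝ) * (log (max 1 ‖z‖) - log ‖z‖) := by
    refine Finset.sum_subset (fun z hz => hF' z (((hF₁ z).1 hz).1.trans hr) ((hF₁ z).1 hz).2)
      fun z _ hz => ?_
    rw [hF₁, not_and_or, not_le, not_not] at hz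
    rcases hz with hz | hz
    · rw [max_eq_right hz.le, sub_self, mul_zero]
    · simp [hz]
  rw [h1, truncatedCounting_eq_sum m E hr hF hF', ← Finset.sum_add_distrib]
  refine le_of_eq (Finset.sum_congr rfl fun z _ => ?_)
  ring

theorem truncatedCounting_nonneg (m : ℕ) (E : ℂ → ℕ) {r : ℝ} (hr : 1 ≤ r) :
    0 ≤ truncatedCounting m E r :=
  intervalIntegral.integral_nonneg hr fun t ht => div_nonneg (Nat.cast_nonneg _) (by linarith [ht.1])

/-! ### The order function -/

theorem circleIntegrable_log_norm_dual {V : Type*} [AddCommGroup V] [Module ℂ V] {G : ℂ → V}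
    (hG : ∀ φ : Module.Dual ℂ V, Differentiable ℂ fun z => φ (G z)) (φ : Module.Dual ℂ V) (r : ℝ) :
    CircleIntegrable (fun z => log ‖φ (G z)‖) 0 r :=
  MeromorphicOn.circleIntegrable_log_norm fun z _ => ((hG φ).analyticAt z).meromorphicAt

section OrderFunction

variable {V ι : Type*} [AddCommGroup V] [Module ℂ V] [Fintype ι] (b : Module.Basis ι ℂ V)

theorem maxNorm_eq_norm (v : V) : maxNorm b v = ‖b.equivFun v‖ := by
  cases isEmpty_or_nonempty ι
  · rw [maxNorm, Real.iSup_of_isEmpty, Subsingleton.elim (b.equivFun v) 0, norm_zero]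
  · refine le_antisymm (ciSup_le fun i => norm_le_pi_norm (b.equivFun v) i) ?_
    exact (pi_norm_le_iff_of_nonempty _).2 fun i =>
      le_ciSup (f := fun i => ‖b.repr v i‖) (Set.finite_range _).bddAbove i

theorem maxNorm_pos {v : V} (hv : v ≠ 0) : 0 < maxNorm b v := by
  rw [maxNorm_eq_norm, norm_pos_iff]
  exact fun h => hv (b.equivFun.map_eq_zero_iff.1 h)

theorem maxNorm_smul (c : ℂ) (v : V) : maxNorm b (c • v) = ‖c‖ * maxNorm b v := by
  rw [maxNorm_eq_norm, maxNorm_eq_norm, map_smul, norm_smul]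

theorem norm_dual_le (φ : Module.Dual ℂ V) (v : V) :
    ‖φ v‖ ≤ (∑ i, ‖φ (b i)‖) * maxNorm b v := by
  conv_lhs => rw [← b.sum_equivFun v]
  rw [map_sum, Finset.sum_mul]
  refine (norm_sum_le _ _).trans (Finset.sum_le_sum fun i _ => ?_)
  rw [map_smul, smul_eq_mul, norm_mul, mul_comm, maxNorm_eq_norm]
  exact mul_le_mul_of_nonneg_left (norm_le_pi_norm _ i) (norm_nonneg _)

theorem exists_log_norm_dual_le (φ : Module.Dual ℂ V) :
    ∃ c : ℝ, 0 ≤ c ∧ ∀ v, φ v ≠ 0 → log ‖φ v‖ ≤ log (maxNorm b v) + c := by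
  refine ⟨|log (∑ i, ‖φ (b i)‖)|, abs_nonneg _, fun v hv => ?_⟩
  have h1 := norm_dual_le b φ v
  have h2 : 0 < maxNorm b v := maxNorm_pos b fun h => hv (by rw [h, map_zero])
  have h3 : 0 < ‖φ v‖ := norm_pos_iff.2 hv
  have h4 : 0 < ∑ i, ‖φ (b i)‖ := pos_of_mul_pos_left (h3.trans_le h1) h2.le
  have h5 := log_le_log h3 h1
  rw [log_mul h4.ne' h2.ne'] at h5
  linarith [le_abs_self (log (∑ i, ‖φ (b i)‖))]

variable {G : ℂ → V} (hG : ∀ φ : Module.Dual ℂ V, Differentiable ℂ fun z => φ (G z))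
  (hG0 : ∀ z, G z ≠ 0)

include hG hG0

theorem continuous_log_maxNorm : Continuous fun z => log (maxNorm b (G z)) := by
  refine Continuous.log ?_ fun z => (maxNorm_pos b (hG0 z)).ne'
  simp only [maxNorm_eq_norm]
  refine continuous_norm.comp (continuous_pi fun i => ?_)
  exact (hG (b.coord i)).continuous

theorem circleIntegrable_log_maxNorm (r : ℝ) :
    CircleIntegrable (fun z => log (maxNorm b (G z))) 0 r :=
  (continuous_log_maxNorm b hG hG0).continuousOn.circleIntegrable'

theorem continuous_orderFunction : Continuous (orderFunction b G) :=
  (continuous_log_maxNorm b hG hG0).circleAverage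

theorem circleAverage_log_norm_dual_le {φ : Module.Dual ℂ V} (hφ : ∃ z, φ (G z) ≠ 0) :
    ∃ c : ℝ, ∀ r ≠ 0, circleAverage (fun z => log ‖φ (G z)‖) 0 r ≤ orderFunction b G r + c := by
  obtain ⟨c, -, hc⟩ := exists_log_norm_dual_le b φ
  refine ⟨c, fun r hr => ?_⟩
  have h1 : circleAverage (fun z => log (maxNorm b (G z)) + c) 0 r = orderFunction b G r + c := by
    rw [circleAverage_fun_add (circleIntegrable_log_maxNorm b hG hG0 r)
      (circleIntegrable_const _ _ _), circleAverage_const]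
    rfl
  rw [← h1]
  refine circleAverage_mono_of_codiscrete hr (circleIntegrable_log_norm_dual hG φ r)
    ((circleIntegrable_log_maxNorm b hG hG0 r).add (circleIntegrable_const _ _ _)) ?_
  have h2 := eventually_ne_zero_of_exists (hG φ) hφ
  exact Filter.Eventually.filter_mono (Filter.codiscreteWithin_mono (subset_univ _))
    (h2.mono fun z hz => hc _ hz)

end OrderFunction

end DerivedCurves

end

noncomputable section

namespace DerivedCurves

open Real Filter MeasureTheory Set Topology Metric ValueDistribution

section OrderFunction

variable {V ι : Type*} [AddCommGroup V] [Module ℂ V] [Fintype ι] (b : Module.Basis ι ℂ V)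
  {G : ℂ → V} (hG : ∀ φ : Module.Dual ℂ V, Differentiable ℂ fun z => φ (G z))
  (hG0 : ∀ z, G z ≠ 0)

include hG hG0

/-- The order function dominates the characteristics of the ratios of linear forms. -/
theorem moderate_ratio {𝔤 : Gauge} (h𝔤 : 𝔤.T = orderFunction b G) (φ ψ : Module.Dual ℂ V)
    (hψ : ∃ z, ψ (G z) ≠ 0) : 𝔤.Moderate fun z => φ (G z) / ψ (G z) := by
  by_cases hφ : ∃ z, φ (G z) ≠ 0
  swap
  · push Not at hφ
    simp only [hφ, zero_div]
    exact Gauge.moderate_const 0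
  have hmφ : Meromorphic fun z => φ (G z) := fun z => ((hG φ).analyticAt z).meromorphicAt
  have hmψ : Meromorphic fun z => ψ (G z) := fun z => ((hG ψ).analyticAt z).meromorphicAt
  have hne : ∀ φ : Module.Dual ℂ V, (∃ z, φ (G z) ≠ 0) →
      ∀ a, meromorphicOrderAt (fun z => φ (G z)) a ≠ ⊤ := by
    intro φ hφ a
    rw [((hG φ).analyticAt a).meromorphicOrderAt_eq]
    have := analyticOrderAt_ne_top_of_exists (hG φ) hφ a
    rw [← Nat.cast_analyticOrderNatAt this]
    exact WithTop.coe_ne_top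
  obtain ⟨c₁, hc₁, hφb⟩ := exists_log_norm_dual_le b φ
  obtain ⟨c₂, hc₂, hψb⟩ := exists_log_norm_dual_le b ψ
  have hdiv : (fun z => φ (G z) / ψ (G z)) = (fun z => φ (G z)) * (fun z => ψ (G z))⁻¹ := by
    ext z
    simp [div_eq_mul_inv]
  have hm : Meromorphic fun z => φ (G z) / ψ (G z) := hmφ.div hmψ
  refine Gauge.Moderate.of_le hm (C := 1)
    (c := c₁ + c₂ - log ‖meromorphicTrailingCoeffAt (fun z => ψ (G z)) 0‖) ?_
  filter_upwards [Gauge.eventually_ge 1] with r hr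
  have hr0 : r ≠ 0 := by linarith
  have h1 : logCounting (fun z => φ (G z) / ψ (G z)) ⊤ r ≤
      circleAverage (fun z => log ‖ψ (G z)‖) 0 r -
        log ‖meromorphicTrailingCoeffAt (fun z => ψ (G z)) 0‖ := by
    rw [hdiv]
    have h2 := logCounting_mul_top_le hr hmφ (hne φ hφ) hmψ.inv fun a => by
      rw [meromorphicOrderAt_inv]
      exact fun h => hne ψ hψ a (by simpa using congrArg Neg.neg h)
    refine h2.trans ?_
    have h3 : ∀ φ : Module.Dual ℂ V, (∃ z, φ (G z) ≠ 0) →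
        0 ≤ MeromorphicOn.divisor (fun z => φ (G z)) univ := by
      intro φ hφ z
      rw [divisor_eq_zeroDivisor (hG φ) hφ]
      exact Nat.cast_nonneg _
    rw [Pi.add_apply, logCounting_top, negPart_eq_zero.2 (h3 φ hφ), map_zero, Pi.zero_apply,
      zero_add, logCounting_inv, logCounting_zero, posPart_eq_self.2 (h3 ψ hψ),
      Function.locallyFinsuppWithin.logCounting_divisor_eq_circleAverage_sub_const hmψ hr0]
  have h4 : proximity (fun z => φ (G z) / ψ (G z)) ⊤ r +
      circleAverage (fun z => log ‖ψ (G z)‖) 0 r ≤ orderFunction b G r + (c₁ + c₂) := by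
    have hi : CircleIntegrable (fun z => log⁺ ‖φ (G z) / ψ (G z)‖) 0 r :=
      MeromorphicOn.circleIntegrable_posLog_norm fun z _ => hm z
    have e1 : circleAverage (fun z => log (maxNorm b (G z)) + (c₁ + c₂)) 0 r =
        orderFunction b G r + (c₁ + c₂) := by
      rw [circleAverage_fun_add (circleIntegrable_log_maxNorm b hG hG0 r)
        (circleIntegrable_const _ _ _), circleAverage_const]
      rfl
    rw [proximity_top, ← circleAverage_fun_add hi (circleIntegrable_log_norm_dual hG ψ r), ← e1]
    refine circleAverage_mono_of_codiscrete hr0 (hi.add (circleIntegrable_log_norm_dual hG ψ r))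
      ((circleIntegrable_log_maxNorm b hG hG0 r).add (circleIntegrable_const _ _ _)) ?_
    have h2 := (eventually_ne_zero_of_exists (hG φ) hφ).and (eventually_ne_zero_of_exists (hG ψ) hψ)
    refine Filter.Eventually.filter_mono (Filter.codiscreteWithin_mono (subset_univ _))
      (h2.mono fun z hz => ?_)
    have h5 := hφb _ hz.1
    have h6 := hψb _ hz.2
    have h7 : log⁺ (‖φ (G z)‖ / ‖ψ (G z)‖) = max 0 (log (‖φ (G z)‖ / ‖ψ (G z)‖)) := rfl
    rw [norm_div, h7, log_div (norm_ne_zero_iff.2 hz.1) (norm_ne_zero_iff.2 hz.2)]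
    rcases max_cases 0 (log ‖φ (G z)‖ - log ‖ψ (G z)‖) with h | h <;> rw [h.1] <;> linarith
  rw [characteristic, Pi.add_apply, h𝔤]
  linarith

theorem exists_le_orderFunction : ∃ c : ℝ, ∀ r ≥ 1, c ≤ orderFunction b G r := by
  obtain ⟨φ, hφ⟩ : ∃ φ : Module.Dual ℂ V, φ (G 0) ≠ 0 := by
    by_contra! h
    exact hG0 0 ((Module.forall_dual_apply_eq_zero_iff ℂ _).1 h)
  obtain ⟨c, hc⟩ := circleAverage_log_norm_dual_le b hG hG0 ⟨0, hφ⟩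
  obtain ⟨c', hc'⟩ := exists_circleAverage_log_eq_sum (hG φ) ⟨0, hφ⟩
  refine ⟨c' - c, fun r hr => ?_⟩
  obtain ⟨F, hF⟩ := exists_finset_zeroDivisor (hG φ) ⟨0, hφ⟩ r
  have h1 := hc' r (by linarith) F (fun z hz => ((hF z).1 hz).1) fun z h1 h2 => (hF z).2 ⟨h1, h2⟩
  have h2 : 0 ≤ ∑ z ∈ F, (zeroDivisor (fun z => φ (G z)) z : ℝ) * (log r - log ‖z‖) := by
    refine Finset.sum_nonneg fun z hz => mul_nonneg (Nat.cast_nonneg _) (sub_nonneg.2 ?_)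
    rcases (norm_nonneg z).eq_or_lt with h | h
    · rw [← h, log_zero]
      exact log_nonneg hr
    · exact log_le_log h ((hF z).1 hz).1
  have h3 := hc r (by linarith)
  linarith

theorem exists_log_le_orderFunction {φ : Module.Dual ℂ V} (hφ : ∃ z, φ (G z) ≠ 0) {a : ℂ}
    (ha : φ (G a) = 0) : ∃ c : ℝ, ∀ᶠ r in atTop, log r - c ≤ orderFunction b G r := by
  obtain ⟨c, hc⟩ := circleAverage_log_norm_dual_le b hG hG0 hφ
  obtain ⟨c', hc'⟩ := exists_circleAverage_log_eq_sum (hG φ) hφ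
  refine ⟨log ‖a‖ - c' + c, ?_⟩
  filter_upwards [eventually_ge_atTop 1, eventually_ge_atTop ‖a‖] with r hr hra
  obtain ⟨F, hF⟩ := exists_finset_zeroDivisor (hG φ) hφ r
  have h1 := hc' r (by linarith) F (fun z hz => ((hF z).1 hz).1) fun z h1 h2 => (hF z).2 ⟨h1, h2⟩
  have hterm : ∀ z ∈ F, 0 ≤ log r - log ‖z‖ := by
    intro z hz
    refine sub_nonneg.2 ?_
    rcases (norm_nonneg z).eq_or_lt with h | h
    · rw [← h, log_zero]
      exact log_nonneg hr
    · exact log_le_log h ((hF z).1 hz).1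
  have hz0 : zeroDivisor (fun z => φ (G z)) a ≠ 0 := by
    intro h0
    have h2 := Nat.cast_analyticOrderNatAt (analyticOrderAt_ne_top_of_exists (hG φ) hφ a)
    rw [zeroDivisor] at h0
    rw [h0, Nat.cast_zero] at h2
    exact ((hG φ).analyticAt a).analyticOrderAt_eq_zero.1 h2.symm ha
  have haF : a ∈ F := (hF a).2 ⟨hra, hz0⟩
  have h2 : log r - log ‖a‖ ≤
      ∑ z ∈ F, (zeroDivisor (fun z => φ (G z)) z : ℝ) * (log r - log ‖z‖) := by
    refine le_trans ?_ (Finset.single_le_sum (f := fun z =>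
      (zeroDivisor (fun z => φ (G z)) z : ℝ) * (log r - log ‖z‖))
      (fun z hz => mul_nonneg (Nat.cast_nonneg _) (hterm z hz)) haF)
    refine le_mul_of_one_le_left (hterm a haF) ?_
    exact_mod_cast Nat.one_le_iff_ne_zero.2 hz0
  have h3 := hc r (by linarith)
  linarith

end OrderFunction

section Representations

variable {V : Type*} [AddCommGroup V] [Module ℂ V] {f : ℂ → ℙ ℂ V} {G₁ G₂ : ℂ → V}

/-- Two reduced representations differ by an entire function without zeros. -/
theorem IsReducedRepresentation.exists_smul (h₁ : IsReducedRepresentation f G₁)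
    (h₂ : IsReducedRepresentation f G₂) :
    ∃ u : ℂ → ℂ, Differentiable ℂ u ∧ (∀ z, u z ≠ 0) ∧ ∀ z, G₂ z = u z • G₁ z := by
  have h3 : ∀ z, ∃ c : ℂˣ, c • G₁ z = G₂ z := fun z =>
    (Projectivization.mk_eq_mk_iff ℂ _ _ (h₂.ne_zero z) (h₁.ne_zero z)).1
      ((h₂.eq_mk z).symm.trans (h₁.eq_mk z))
  choose c hc using h3
  refine ⟨fun z => c z, fun a => ?_, fun z => (c z).ne_zero, fun z => (hc z).symm⟩
  obtain ⟨φ, hφ⟩ : ∃ φ : Module.Dual ℂ V, φ (G₁ a) ≠ 0 := by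
    by_contra! h
    exact h₁.ne_zero a ((Module.forall_dual_apply_eq_zero_iff ℂ _).1 h)
  have h4 : ∀ᶠ z in 𝓝 a, φ (G₁ z) ≠ 0 := (h₁.holomorphic φ).continuous.continuousAt.eventually_ne hφ
  refine DifferentiableAt.congr_of_eventuallyEq
    ((h₂.holomorphic φ a).div (h₁.holomorphic φ a) hφ) ?_
  filter_upwards [h4] with z hz
  have h5 : φ (G₂ z) = c z * φ (G₁ z) := by
    rw [← hc z, Units.smul_def, map_smul, smul_eq_mul]
  simp only [Pi.div_apply]
  rw [h5, mul_div_cancel_right₀ _ hz]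

theorem circleAverage_log_norm_unit {u : ℂ → ℂ} (hu : Differentiable ℂ u) (hu0 : ∀ z, u z ≠ 0)
    (r : ℝ) : circleAverage (fun z => log ‖u z‖) 0 r = log ‖u 0‖ :=
  AnalyticOnNhd.circleAverage_log_norm_of_ne_zero (fun z _ => hu.analyticAt z) fun z _ => hu0 z

/-- The order function of a rational curve is of logarithmic growth. -/
theorem exists_orderFunction_le_log {ι : Type*} [Fintype ι] (b : Module.Basis ι ℂ V)
    (h₁ : IsReducedRepresentation f G₁) (hf : IsRationalCurve f) :
    ∃ A : ℝ, ∀ᶠ r in atTop, orderFunction b G₁ r ≤ A * log r := by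
  obtain ⟨d, v, hv⟩ := hf
  set P : ℂ → V := fun z => ∑ j ∈ Finset.range (d + 1), z ^ j • v j with hP
  have hP' : IsReducedRepresentation f P := by
    refine ⟨fun φ => ?_, fun z => (hv z).1, fun z => (hv z).2⟩
    simp only [hP, map_sum, map_smul, smul_eq_mul]
    fun_prop
  obtain ⟨u, hu, hu0, huG⟩ := hP'.exists_smul h₁
  set S : ℝ := ∑ j ∈ Finset.range (d + 1), maxNorm b (v j) with hS
  have hnn : ∀ v, 0 ≤ maxNorm b v := fun v => by
    rw [maxNorm_eq_norm]
    exact norm_nonneg _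
  have hbound : ∀ r ≥ 1, orderFunction b G₁ r ≤ log ‖u 0‖ + (log S + d * log r) := by
    intro r hr
    have e1 : orderFunction b G₁ r = log ‖u 0‖ + orderFunction b P r := by
      rw [orderFunction, orderFunction, ← circleAverage_log_norm_unit hu hu0 r,
        ← circleAverage_fun_add (MeromorphicOn.circleIntegrable_log_norm fun z _ =>
          (hu.analyticAt z).meromorphicAt)
          (circleIntegrable_log_maxNorm b hP'.holomorphic hP'.ne_zero r)]
      congr 1
      ext z
      rw [huG, maxNorm_smul, log_mul (norm_ne_zero_iff.2 (hu0 z))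
        (maxNorm_pos b (hP'.ne_zero z)).ne']
    rw [e1]
    refine add_le_add le_rfl (circleAverage_mono_on_of_le_circle
      (circleIntegrable_log_maxNorm b hP'.holomorphic hP'.ne_zero r) fun z hz => ?_)
    have hz' : ‖z‖ = r := by
      rw [mem_sphere_zero_iff_norm, abs_of_nonneg (by linarith)] at hz
      exact hz
    have h2 : maxNorm b (P z) ≤ S * r ^ d := by
      rw [maxNorm_eq_norm, hP, map_sum, hS, Finset.sum_mul]
      refine (norm_sum_le _ _).trans (Finset.sum_le_sum fun j hj => ?_)
      rw [map_smul, norm_smul, norm_pow, hz', maxNorm_eq_norm, mul_comm]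
      refine mul_le_mul_of_nonneg_left (pow_le_pow_right₀ hr ?_) (norm_nonneg _)
      exact Nat.lt_succ_iff.1 (Finset.mem_range.1 hj)
    have h3 := maxNorm_pos b (hP'.ne_zero z)
    have h4 : 0 < r ^ d := by positivity
    have h5 : 0 < S := pos_of_mul_pos_left (h3.trans_le h2) h4.le
    refine (log_le_log h3 h2).trans ?_
    rw [log_mul h5.ne' h4.ne', log_pow]
  refine ⟨|log ‖u 0‖ + log S| + d, ?_⟩
  filter_upwards [eventually_ge_atTop 1, tendsto_log_atTop.eventually_ge_atTop 1] with r hr hlog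
  have h1 := hbound r hr
  have h2 : log ‖u 0‖ + log S ≤ |log ‖u 0‖ + log S| * log r :=
    (le_abs_self _).trans (le_mul_of_one_le_right (abs_nonneg _) hlog)
  linarith

theorem IsDerivedCurve.exists_isDerivedLift {n k : ℕ} {f : ℂ → ℙ ℂ (Fin (n + 1) → ℂ)}
    (hnd : IsLinearlyNondegenerate f) {F : ℂ → ℙ ℂ (⋀[ℂ]^(k + 1) (Fin (n + 1) → ℂ))}
    (hF : IsDerivedCurve k f F) {Fbar : ℂ → ⋀[ℂ]^(k + 1) (Fin (n + 1) → ℂ)}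
    (hFbar : IsReducedRepresentation F Fbar) : ∃ G g, IsDerivedLift k G g Fbar := by
  obtain ⟨G, hG, g, hg, -, F₀, hF₀, hw⟩ := hF
  obtain ⟨u, hu, hu0, huF⟩ := hFbar.exists_smul hF₀
  refine ⟨G, fun z => g z * u z, ⟨?_, fun c hc => ?_, hg.mul hu, hFbar.holomorphic,
    hFbar.ne_zero, fun z => ?_⟩⟩
  · exact differentiable_pi.2 fun i => hG.holomorphic (coordinate i)
  · by_contra! hcon
    refine hnd c hc ?_
    rintro _ ⟨z, rfl⟩ v hv
    rw [hG.eq_mk z, Projectivization.submodule_mk, Submodule.mem_span_singleton] at hv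
    obtain ⟨a, rfl⟩ := hv
    rw [map_smul, hcon, smul_zero]
  · rw [hw, huF, smul_smul]

end Representations

/-- For `k < n` the order function grows at least like the logarithm. -/
theorem IsDerivedLift.exists_log_le_orderFunction {n k : ℕ} (hk : k < n)
    {G : ℂ → Fin (n + 1) → ℂ} {g : ℂ → ℂ}
    {Fbar : ℂ → ⋀[ℂ]^(k + 1) (Fin (n + 1) → ℂ)} (hL : IsDerivedLift k G g Fbar)
    {ι : Type*} [Fintype ι] (b : Module.Basis ι ℂ (⋀[ℂ]^(k + 1) (Fin (n + 1) → ℂ))) :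
    ∃ c : ℝ, ∀ᶠ r in atTop, log r - c ≤ orderFunction b Fbar r := by
  have hpt : ∀ a, ∃ A : DecomposableHyperplane n k, g a * A.form (Fbar a) = 0 := by
    intro a
    obtain ⟨w, ν, -, hw⟩ := exists_isAdapted_jetForm hL.differentiable hL.nondegenerate a
      (linearIndependent_coordinate n)
    obtain ⟨e, he, -⟩ := exists_dual_family hw.linearIndependent
    have hne : exteriorPower.ιMulti ℂ (k + 1)
        (fun j : Fin (k + 1) => w ⟨j + 1, by omega⟩) ≠ 0 := by
      refine ιMulti_ne_zero_of_dualDet_ne_zero (v := fun j : Fin (k + 1) => e ⟨j + 1, by omega⟩) ?_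
      have h2 : (Matrix.of fun i j : Fin (k + 1) =>
          w ⟨i + 1, by omega⟩ (e ⟨j + 1, by omega⟩)) = 1 := by
        ext i j
        simp [he, Matrix.one_apply, Fin.ext_iff]
      rw [dualDet, h2, Matrix.det_one]
      exact one_ne_zero
    refine ⟨⟨_, hne⟩, ?_⟩
    have h1 := congrArg (DecomposableHyperplane.form ⟨_, hne⟩) (hL.eq_smul a)
    rw [map_smul, smul_eq_mul] at h1
    rw [← h1, wedgeDerivatives, form_ιMulti_eq_dualDet, dualDet]
    refine Matrix.det_eq_zero_of_column_eq_zero 0 fun i => ?_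
    refine hw.eq_zero _ _ ?_
    have h3 : ν 0 < ν ⟨i + 1, by omega⟩ := hw.strictMono (by simp [Fin.lt_def])
    simp only [Fin.val_zero]
    omega
  obtain ⟨A₀, -⟩ := hpt 0
  obtain ⟨a, ha⟩ := exists_ne_zero_of_analyticOrderAt_ne_top
    (hL.analyticOrderAt_factor_ne_top A₀ 0)
  obtain ⟨A, hA⟩ := hpt a
  exact DerivedCurves.exists_log_le_orderFunction b hL.holomorphic hL.ne_zero
    (exists_ne_zero_of_analyticOrderAt_ne_top (hL.analyticOrderAt_form_ne_top A 0))
    ((mul_eq_zero.1 hA).resolve_left ha)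

end DerivedCurves

end

noncomputable section

namespace DerivedCurves

open Real Filter MeasureTheory Set Topology Metric ValueDistribution

/-! ### Families of linear forms in subgeneral position -/

section Subgeneral

variable {V ι τ : Type*} [AddCommGroup V] [Module ℂ V] [FiniteDimensional ℂ V]
  {φ : ι → Module.Dual ℂ V}

/-- The rank of a finite subfamily of linear forms. -/
def formRank (φ : ι → Module.Dual ℂ V) (R : Finset ι) : ℕ :=
  Module.finrank ℂ (Submodule.span ℂ (φ '' R))

theorem isRankFunction_formRank [DecidableEq ι] (φ : ι → Module.Dual ℂ V) : IsRankFunction (formRank φ) :=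
  isRankFunction_finrank_span φ

theorem formRank_le (φ : ι → Module.Dual ℂ V) (R : Finset ι) :
    formRank φ R ≤ Module.finrank ℂ V :=
  (Submodule.finrank_le _).trans Subspace.dual_finrank_eq.le

theorem span_eq_top_of_formRank {R : Finset ι} (h : formRank φ R = Module.finrank ℂ V) :
    Submodule.span ℂ (φ '' R) = ⊤ :=
  Submodule.eq_top_of_finrank_eq (h.trans Subspace.dual_finrank_eq.symm)

theorem formRank_eq_of_iInter_eq_empty {N : ℕ}
    (hN : ∀ s : Finset ι, s.card = N → ⋂ i ∈ s, hyperplane (φ i) = ∅) {R : Finset ι}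
    (hR : N ≤ R.card) : formRank φ R = Module.finrank ℂ V := by
  by_contra hcon
  have h1 : Submodule.span ℂ (φ '' R) ≠ ⊤ := by
    intro h
    rw [formRank, h, finrank_top, Subspace.dual_finrank_eq] at hcon
    exact hcon rfl
  obtain ⟨s, hsR, hs⟩ := Finset.exists_subset_card_eq hR
  have h2 : (Submodule.span ℂ (φ '' R)).dualCoannihilator ≠ ⊥ := by
    intro h
    apply h1
    have h3 := Subspace.dualCoannihilator_dualAnnihilator_eq (W := Submodule.span ℂ (φ '' R))
    rw [h, Submodule.dualAnnihilator_bot] at h3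
    exact h3.symm
  obtain ⟨v, hv, hv0⟩ := Submodule.exists_mem_ne_zero_of_ne_bot h2
  have h3 : Projectivization.mk ℂ v hv0 ∈ ⋂ i ∈ s, hyperplane (φ i) := by
    simp only [mem_iInter]
    intro i hi w hw
    rw [Projectivization.submodule_mk, Submodule.mem_span_singleton] at hw
    obtain ⟨a, rfl⟩ := hw
    rw [map_smul, (Submodule.mem_dualCoannihilator _).1 hv (φ i)
      (Submodule.subset_span (mem_image_of_mem φ (hsR hi))), smul_zero]
  rw [hN s hs] at h3
  exact h3

theorem exists_forall_le_norm {κ : Type*} [Fintype κ] (b : Module.Basis κ ℂ V) {R : Finset ι}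
    (h : formRank φ R = Module.finrank ℂ V) :
    ∃ δ : ℝ, 0 < δ ∧ ∀ v ≠ 0, ∃ i ∈ R, δ * maxNorm b v ≤ ‖φ i v‖ := by
  have h1 : ∀ j, ∃ c : ι → ℂ, ∑ i ∈ R, c i • φ i = b.coord j := fun j => by
    have : b.coord j ∈ Submodule.span ℂ (φ '' R) := by
      rw [span_eq_top_of_formRank h]
      exact Submodule.mem_top
    exact Submodule.mem_span_image_finset_iff_exists_fun' ℂ |>.1 this
  choose c hc using h1
  set K : ℝ := ∑ j, ∑ i ∈ R, ‖c j i‖ with hK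
  have hK0 : 0 ≤ K := Finset.sum_nonneg fun j _ => Finset.sum_nonneg fun i _ => norm_nonneg _
  refine ⟨1 / (K + 1), by positivity, fun v hv => ?_⟩
  by_contra! hcon
  have hpos := maxNorm_pos b hv
  have h2 : maxNorm b v ≤ K * (1 / (K + 1) * maxNorm b v) := by
    rw [maxNorm_eq_norm]
    refine (pi_norm_le_iff_of_nonneg (by positivity)).2 fun j => ?_
    have h3 : b.equivFun v j = ∑ i ∈ R, c j i * φ i v := by
      have := congrArg (fun ψ : Module.Dual ℂ V => ψ v) (hc j)
      simpa using this.symm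
    rw [h3]
    refine (norm_sum_le _ _).trans ?_
    have h4 : ∑ i ∈ R, ‖c j i * φ i v‖ ≤ (∑ i ∈ R, ‖c j i‖) * (1 / (K + 1) * maxNorm b v) := by
      rw [Finset.sum_mul]
      refine Finset.sum_le_sum fun i hi => ?_
      rw [norm_mul]
      exact mul_le_mul_of_nonneg_left (hcon i hi).le (norm_nonneg _)
    rw [← maxNorm_eq_norm]
    refine h4.trans (mul_le_mul_of_nonneg_right ?_ (by positivity))
    exact Finset.single_le_sum (f := fun j => ∑ i ∈ R, ‖c j i‖)
      (fun j _ => Finset.sum_nonneg fun i _ => norm_nonneg _) (Finset.mem_univ j)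
  have h5 : K * (1 / (K + 1) * maxNorm b v) < maxNorm b v := by
    have h6 : K * (1 / (K + 1) * maxNorm b v) = K / (K + 1) * maxNorm b v := by ring
    rw [h6]
    refine mul_lt_of_lt_one_left hpos ?_
    rw [div_lt_one (by positivity)]
    linarith
  linarith

omit [FiniteDimensional ℂ V] in
theorem exists_enumeration [Fintype τ] {B : Finset ι} (hB : formRank φ B = Fintype.card τ)
    (hcard : B.card = Fintype.card τ) :
    ∃ κ : τ → ι, LinearIndependent ℂ (fun t => φ (κ t)) ∧
      ∀ {M : Type} [AddCommMonoid M] (x : ι → M), ∑ i ∈ B, x i = ∑ t, x (κ t) := by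
  have e : τ ≃ B := Fintype.equivOfCardEq (by rw [Fintype.card_coe, hcard])
  refine ⟨fun t => e t, ?_, fun x => ?_⟩
  · rw [linearIndependent_iff_card_eq_finrank_span, ← hB, formRank, Set.finrank]
    have h1 : φ '' B = range fun t => φ (e t) := by
      ext ψ
      simp only [mem_image, mem_range, SetLike.mem_coe]
      constructor
      · rintro ⟨i, hi, rfl⟩
        exact ⟨e.symm ⟨i, hi⟩, by simp⟩
      · rintro ⟨t, rfl⟩
        exact ⟨e t, (e t).2, rfl⟩
    rw [h1]
  · rw [← Finset.sum_coe_sort B x]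
    exact (e.sum_comp fun i : B => x i).symm

variable [DecidableEq ι] [Fintype ι] {ω : ι → ℝ}

theorem exists_basis_sum_le
    (hω : ∀ R, formRank φ R < Module.finrank ℂ V → ∑ i ∈ R, ω i ≤ formRank φ R)
    (htop : formRank φ Finset.univ = Module.finrank ℂ V) {R : Finset ι}
    (hR : formRank φ R < Module.finrank ℂ V) {x : ι → ℝ} (hx : ∀ i, 0 ≤ x i) :
    ∃ B, formRank φ B = Module.finrank ℂ V ∧ B.card = Module.finrank ℂ V ∧
      ∑ i ∈ R, ω i * x i ≤ ∑ i ∈ B, x i := by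
  have hr := isRankFunction_formRank φ
  obtain ⟨B₀, hB₀R, hB₀, hB₀c, hsum⟩ := hr.exists_independent_sum_le R
    (fun S hS => hω S ((hr.mono hS).trans_lt hR)) (fun i _ => hx i)
  obtain ⟨B, hB₀B, -, hB, hBc⟩ := hr.exists_superset_rank (Finset.subset_univ B₀)
    (m := Module.finrank ℂ V) (by rw [hB₀]; exact hR.le) htop.ge
  refine ⟨B, hB, ?_, hsum.trans (Finset.sum_le_sum_of_subset_of_nonneg hB₀B fun i _ _ => hx i)⟩
  rw [hBc, hB₀, hB₀c]
  omega

theorem exists_basis_log_sum_le {κ : Type*} [Fintype κ] (b : Module.Basis κ ℂ V) {θ : ℝ}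
    (hω0 : ∀ i, 0 ≤ ω i ∧ ω i ≤ θ)
    (hω : ∀ R, formRank φ R < Module.finrank ℂ V → ∑ i ∈ R, ω i ≤ formRank φ R)
    (htop : formRank φ Finset.univ = Module.finrank ℂ V) :
    ∃ c : ℝ, ∀ v, v ≠ 0 → (∀ i, φ i v ≠ 0) →
      ∃ B, formRank φ B = Module.finrank ℂ V ∧ B.card = Module.finrank ℂ V ∧
        ∑ i, ω i * (log (maxNorm b v) - log ‖φ i v‖) ≤
          ∑ i ∈ B, (log (maxNorm b v) - log ‖φ i v‖) + c := by
  choose a ha0 ha using fun i => exists_log_norm_dual_le b (φ i)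
  set a' : ℝ := ∑ i, a i with ha'
  have haa : ∀ i, a i ≤ a' := fun i =>
    Finset.single_le_sum (f := a) (fun i _ => ha0 i) (Finset.mem_univ i)
  have hδ : ∀ R : Finset ι, ∃ δ : ℝ, 0 < δ ∧ (formRank φ R = Module.finrank ℂ V →
      ∀ v ≠ 0, ∃ i ∈ R, δ * maxNorm b v ≤ ‖φ i v‖) := by
    intro R
    by_cases hR : formRank φ R = Module.finrank ℂ V
    · obtain ⟨δ, h1, h2⟩ := exists_forall_le_norm b hR
      exact ⟨δ, h1, fun _ => h2⟩
    · exact ⟨1, one_pos, fun h => absurd h hR⟩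
  choose δ hδ0 hδ using hδ
  set η : ℝ := ∑ R, |log (δ R)| with hη
  have hηδ : ∀ R, -η ≤ log (δ R) := fun R => by
    have : |log (δ R)| ≤ η :=
      Finset.single_le_sum (f := fun R => |log (δ R)|) (fun R _ => abs_nonneg _) (Finset.mem_univ R)
    linarith [neg_abs_le (log (δ R))]
  refine ⟨(Module.finrank ℂ V) * a' + Fintype.card ι * (θ * (η + a')), fun v hv hφv => ?_⟩
  set x : ι → ℝ := fun i => log (maxNorm b v) - log ‖φ i v‖ + a' with hx
  have hx0 : ∀ i, 0 ≤ x i := fun i => by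
    have := ha i v (hφv i)
    have := haa i
    simp only [hx]
    linarith
  set R : Finset ι := Finset.univ.filter fun i => η < log (maxNorm b v) - log ‖φ i v‖ with hRdef
  have hR : formRank φ R < Module.finrank ℂ V := by
    refine lt_of_le_of_ne (formRank_le φ R) fun h => ?_
    obtain ⟨i, hi, hle⟩ := hδ R h v hv
    have h1 := log_le_log (mul_pos (hδ0 R) (maxNorm_pos b hv)) hle
    rw [log_mul (hδ0 R).ne' (maxNorm_pos b hv).ne'] at h1
    have h2 := (Finset.mem_filter.1 hi).2
    have := hηδ R
    linarith
  obtain ⟨B, hB, hBc, hsum⟩ := exists_basis_sum_le hω htop hR hx0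
  refine ⟨B, hB, hBc, ?_⟩
  have hBsum : ∑ i ∈ B, x i = ∑ i ∈ B, (log (maxNorm b v) - log ‖φ i v‖) +
      (Module.finrank ℂ V) * a' := by
    rw [Finset.sum_add_distrib, Finset.sum_const, hBc, nsmul_eq_mul]
  have h1 : ∑ i, ω i * x i ≤ ∑ i ∈ R, ω i * x i + Fintype.card ι * (θ * (η + a')) := by
    rw [← Finset.sum_filter_add_sum_filter_not Finset.univ
      (fun i => η < log (maxNorm b v) - log ‖φ i v‖)]
    refine add_le_add le_rfl ?_
    have hη0 : 0 ≤ η := Finset.sum_nonneg fun R _ => abs_nonneg _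
    have ha0' : 0 ≤ a' := Finset.sum_nonneg fun i _ => ha0 i
    have h2 : ∑ i ∈ Finset.univ.filter (fun i => ¬ η < log (maxNorm b v) - log ‖φ i v‖),
        ω i * x i ≤ ∑ i ∈ Finset.univ.filter (fun i => ¬ η < log (maxNorm b v) - log ‖φ i v‖),
        θ * (η + a') := by
      refine Finset.sum_le_sum fun i hi => ?_
      have h3 := not_lt.1 (Finset.mem_filter.1 hi).2
      refine mul_le_mul (hω0 i).2 ?_ (hx0 i) ((hω0 i).1.trans (hω0 i).2)
      simp only [hx]
      linarith
    refine h2.trans ?_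
    rw [Finset.sum_const, nsmul_eq_mul]
    rcases isEmpty_or_nonempty ι with hι | ⟨⟨i₀⟩⟩
    · simp
    · have hθ : 0 ≤ θ := (hω0 i₀).1.trans (hω0 i₀).2
      refine mul_le_mul_of_nonneg_right ?_ (by positivity)
      exact_mod_cast Finset.card_le_univ _
  have h4 : ∑ i, ω i * (log (maxNorm b v) - log ‖φ i v‖) ≤ ∑ i, ω i * x i := by
    refine Finset.sum_le_sum fun i _ => mul_le_mul_of_nonneg_left ?_ (hω0 i).1
    have ha0' : 0 ≤ a' := Finset.sum_nonneg fun i _ => ha0 i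
    simp only [hx]
    linarith
  linarith

end Subgeneral

end DerivedCurves

end

noncomputable section

namespace DerivedCurves

open Real Filter MeasureTheory Set Topology Metric ValueDistribution

/-! ### The second main theorem relative to a gauge -/

theorem Gauge.small_sum (𝔤 : Gauge) {ι : Type*} (s : Finset ι) {f : ι → ℝ → ℝ}
    (h : ∀ i ∈ s, 𝔤.Small (f i)) : 𝔤.Small (∑ i ∈ s, f i) :=
  Finset.sum_induction f 𝔤.Small (fun _ _ => 𝔤.small_add) (𝔤.small_const 0) h

theorem finrank_exteriorPower (n k : ℕ) :
    Module.finrank ℂ (⋀[ℂ]^(k + 1) (Fin (n + 1) → ℂ)) = (n + 1).choose (k + 1) := by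
  rw [Module.finrank_eq_card_basis (pluckerBasis n k)]
  exact card_pluckerIndex n k

theorem finiteDimensional_exteriorPower (n k : ℕ) :
    FiniteDimensional ℂ (⋀[ℂ]^(k + 1) (Fin (n + 1) → ℂ)) :=
  Module.Finite.of_basis (pluckerBasis n k)

namespace IsDerivedLift

variable {n k : ℕ} {G : ℂ → Fin (n + 1) → ℂ} {g : ℂ → ℂ}
  {Fbar : ℂ → ⋀[ℂ]^(k + 1) (Fin (n + 1) → ℂ)} (hL : IsDerivedLift k G g Fbar)

include hL

theorem differentiable_wronskian : Differentiable ℂ (wronskian G) := by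
  intro a
  have : AnalyticAt ℂ (wronskian G) a := by
    refine analyticAt_det fun s i => ?_
    exact (differentiable_dual_comp (differentiable_iteratedDeriv hL.differentiable s)
      (coordinate i)).analyticAt a
  exact this.differentiableAt

theorem exists_wronskian_ne_zero : ∃ z, wronskian G z ≠ 0 := by
  obtain ⟨w, ν, -, hw⟩ := exists_isAdapted_jetForm hL.differentiable hL.nondegenerate 0
    (linearIndependent_coordinate n)
  obtain ⟨o, ho, -⟩ := exists_wronskian_order hL.differentiable hw
  refine exists_ne_zero_of_analyticOrderAt_ne_top (a := 0) ?_
  rw [ho]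
  exact ENat.natCast_ne_top o

theorem exists_form_ne_zero (A : DecomposableHyperplane n k) : ∃ z, A.form (Fbar z) ≠ 0 :=
  exists_ne_zero_of_analyticOrderAt_ne_top (hL.analyticOrderAt_form_ne_top A 0)

theorem exists_factor_ne_zero (A : DecomposableHyperplane n k) : ∃ z, g z ≠ 0 :=
  exists_ne_zero_of_analyticOrderAt_ne_top (hL.analyticOrderAt_factor_ne_top A 0)

variable {ι : Type*} [Fintype ι] [DecidableEq ι] {A : ι → DecomposableHyperplane n k}
  {ω : ι → ℝ} {θ : ℝ} (hω0 : ∀ i, 0 ≤ ω i ∧ ω i ≤ θ)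
  (hω : ∀ R, formRank (fun i => (A i).form) R < (n + 1).choose (k + 1) →
    ∑ i ∈ R, ω i ≤ formRank (fun i => (A i).form) R)
  (htop : formRank (fun i => (A i).form) Finset.univ = (n + 1).choose (k + 1))

include hω0 hω htop

theorem weighted_orders_le (hk : k ≤ n) (a : ℂ) :
    ∑ i, ω i * zeroDivisor (fun z => (A i).form (Fbar z)) a +
        (n + 1).choose (k + 1) * zeroDivisor g a ≤
      n.choose k * zeroDivisor (wronskian G) a +
        θ * ∑ i, (min ((k + 1) * (n - k)) (zeroDivisor (fun z => (A i).form (Fbar z)) a) : ℕ) := by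
  have := finiteDimensional_exteriorPower n k
  have hd := finrank_exteriorPower n k
  rw [← hd] at hω htop
  set m := (k + 1) * (n - k) with hm
  set e : ι → ℕ := fun i => zeroDivisor (fun z => (A i).form (Fbar z)) a with he
  set R : Finset ι := Finset.univ.filter fun i => m < e i with hRdef
  have hR : formRank (fun i => (A i).form) R <
      Module.finrank ℂ (⋀[ℂ]^(k + 1) (Fin (n + 1) → ℂ)) := by
    refine lt_of_le_of_ne (formRank_le _ R) fun h => ?_
    obtain ⟨δ, hδ, hle⟩ := exists_forall_le_norm (pluckerBasis n k) h
    obtain ⟨i, hi, h1⟩ := hle (Fbar a) (hL.ne_zero a)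
    have h2 : (A i).form (Fbar a) ≠ 0 := by
      rw [← norm_pos_iff]
      exact (mul_pos hδ (maxNorm_pos _ (hL.ne_zero a))).trans_le h1
    have h3 : e i = 0 := by
      have h4 := ((hL.holomorphic (A i).form).analyticAt a).analyticOrderAt_eq_zero.2 h2
      simp only [he, zeroDivisor, analyticOrderNatAt, h4]
      rfl
    have h5 := (Finset.mem_filter.1 hi).2
    omega
  obtain ⟨B, hB, hBc, hsum⟩ := exists_basis_sum_le hω htop hR
    (x := fun i => ((e i - m : ℕ) : ℝ)) fun i => Nat.cast_nonneg _
  obtain ⟨κ, hκ, hκB⟩ := exists_enumeration (τ := PluckerIndex n k) (B := B)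
    (by rw [hB, hd, card_pluckerIndex]) (by rw [hBc, hd, card_pluckerIndex])
  have h1 := hL.sum_tsub_add_le hk hκ a
  have h2 : ∑ i ∈ B, ((e i - m : ℕ) : ℝ) + (n + 1).choose (k + 1) * zeroDivisor g a ≤
      n.choose k * zeroDivisor (wronskian G) a := by
    rw [hκB fun i => ((e i - m : ℕ) : ℝ)]
    exact_mod_cast h1
  have h3 : ∑ i ∈ R, ω i * ((e i - m : ℕ) : ℝ) = ∑ i, ω i * ((e i - m : ℕ) : ℝ) := by
    refine Finset.sum_subset (Finset.subset_univ R) fun i _ hi => ?_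
    have : ¬ m < e i := fun h => hi (Finset.mem_filter.2 ⟨Finset.mem_univ i, h⟩)
    rw [Nat.sub_eq_zero_of_le (not_lt.1 this), Nat.cast_zero, mul_zero]
  have h4 : ∑ i, ω i * (e i : ℝ) ≤ ∑ i, ω i * ((e i - m : ℕ) : ℝ) + θ * ∑ i, (min m (e i) : ℕ) := by
    rw [Nat.cast_sum, Finset.mul_sum, ← Finset.sum_add_distrib]
    refine Finset.sum_le_sum fun i _ => ?_
    have h5 : (e i : ℝ) = ((e i - m : ℕ) : ℝ) + ((min m (e i) : ℕ) : ℝ) := by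
      rw [← Nat.cast_add]
      congr 1
      omega
    conv_lhs => rw [h5, mul_add]
    exact add_le_add le_rfl (mul_le_mul_of_nonneg_right (hω0 i).2 (Nat.cast_nonneg _))
  linarith

theorem weighted_counting_le (hk : k ≤ n) (A₀ : DecomposableHyperplane n k) :
    ∃ c : ℝ, ∀ r ≥ 1,
      ∑ i, ω i * circleAverage (fun z => log ‖(A i).form (Fbar z)‖) 0 r +
          (n + 1).choose (k + 1) * circleAverage (fun z => log ‖g z‖) 0 r ≤
        n.choose k * circleAverage (fun z => log ‖wronskian G z‖) 0 r +
          θ * ∑ i, (A i).counting ((k + 1) * (n - k)) Fbar r + c := by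
  have hA := fun i => exists_circleAverage_log_eq_sum (hL.holomorphic (A i).form)
    (hL.exists_form_ne_zero (A i))
  choose cA hcA using hA
  obtain ⟨cg, hcg⟩ := exists_circleAverage_log_eq_sum hL.differentiable_factor
    (hL.exists_factor_ne_zero A₀)
  obtain ⟨cW, hcW⟩ := exists_circleAverage_log_eq_sum hL.differentiable_wronskian
    hL.exists_wronskian_ne_zero
  have hN := fun i => exists_finset_zeroDivisor (hL.holomorphic (A i).form)
    (hL.exists_form_ne_zero (A i)) 1
  choose F₁ hF₁ using hN
  choose cN hcN using fun i => exists_sum_le_truncatedCounting ((k + 1) * (n - k))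
    (zeroDivisor fun z => (A i).form (Fbar z)) (hF₁ i)
  refine ⟨∑ i, ω i * cA i + (n + 1).choose (k + 1) * cg - n.choose k * cW + θ * ∑ i, cN i,
    fun r hr => ?_⟩
  choose FA hFA using fun i => exists_finset_zeroDivisor (hL.holomorphic (A i).form)
    (hL.exists_form_ne_zero (A i)) r
  obtain ⟨Fg, hFg⟩ := exists_finset_zeroDivisor hL.differentiable_factor
    (hL.exists_factor_ne_zero A₀) r
  obtain ⟨FW, hFW⟩ := exists_finset_zeroDivisor hL.differentiable_wronskian
    hL.exists_wronskian_ne_zero r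
  set F : Finset ℂ := Finset.univ.biUnion FA ∪ (Fg ∪ FW) with hF
  have hFr : ∀ z ∈ F, ‖z‖ ≤ r := by
    intro z hz
    simp only [hF, Finset.mem_union, Finset.mem_biUnion, Finset.mem_univ, true_and] at hz
    rcases hz with ⟨i, hi⟩ | hz | hz
    · exact ((hFA i z).1 hi).1
    · exact ((hFg z).1 hz).1
    · exact ((hFW z).1 hz).1
  have hFA' : ∀ i, ∀ z, ‖z‖ ≤ r → zeroDivisor (fun z => (A i).form (Fbar z)) z ≠ 0 → z ∈ F :=
    fun i z h1 h2 => Finset.mem_union_left _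
      (Finset.mem_biUnion.2 ⟨i, Finset.mem_univ i, (hFA i z).2 ⟨h1, h2⟩⟩)
  have hFg' : ∀ z, ‖z‖ ≤ r → zeroDivisor g z ≠ 0 → z ∈ F := fun z h1 h2 =>
    Finset.mem_union_right _ (Finset.mem_union_left _ ((hFg z).2 ⟨h1, h2⟩))
  have hFW' : ∀ z, ‖z‖ ≤ r → zeroDivisor (wronskian G) z ≠ 0 → z ∈ F := fun z h1 h2 =>
    Finset.mem_union_right _ (Finset.mem_union_right _ ((hFW z).2 ⟨h1, h2⟩))
  have hr0 : 0 < r := by linarith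
  rw [hcg r hr0 F hFr hFg', hcW r hr0 F hFr hFW']
  simp only [fun i => hcA i r hr0 F hFr (hFA' i)]
  have hNi : ∑ i, ∑ z ∈ F, (min ((k + 1) * (n - k))
      (zeroDivisor (fun z => (A i).form (Fbar z)) z) : ℕ) * (log r - log ‖z‖) ≤
      ∑ i, (A i).counting ((k + 1) * (n - k)) Fbar r + ∑ i, cN i := by
    rw [← Finset.sum_add_distrib]
    exact Finset.sum_le_sum fun i _ => hcN i r hr F hFr (hFA' i)
  have hlocal : ∑ z ∈ F, (∑ i, ω i * zeroDivisor (fun z => (A i).form (Fbar z)) z +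
      (n + 1).choose (k + 1) * zeroDivisor g z) * (log r - log ‖z‖) ≤
      ∑ z ∈ F, (n.choose k * zeroDivisor (wronskian G) z + θ * ∑ i, (min ((k + 1) * (n - k))
        (zeroDivisor (fun z => (A i).form (Fbar z)) z) : ℕ)) * (log r - log ‖z‖) := by
    refine Finset.sum_le_sum fun z hz => mul_le_mul_of_nonneg_right
      (hL.weighted_orders_le hω0 hω htop hk z) (sub_nonneg.2 ?_)
    rcases (norm_nonneg z).eq_or_lt with h | h
    · rw [← h, log_zero]
      exact log_nonneg hr
    · exact log_le_log h (hFr z hz)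
  have e1 : ∑ z ∈ F, (∑ i, ω i * zeroDivisor (fun z => (A i).form (Fbar z)) z +
      (n + 1).choose (k + 1) * zeroDivisor g z) * (log r - log ‖z‖) =
      ∑ i, ω i * ∑ z ∈ F, zeroDivisor (fun z => (A i).form (Fbar z)) z * (log r - log ‖z‖) +
      (n + 1).choose (k + 1) * ∑ z ∈ F, zeroDivisor g z * (log r - log ‖z‖) := by
    simp only [add_mul, Finset.sum_add_distrib, Finset.sum_mul, Finset.mul_sum]
    rw [Finset.sum_comm]
    simp only [mul_assoc]
  have e2 : ∑ z ∈ F, (n.choose k * zeroDivisor (wronskian G) z + θ * ∑ i, (min ((k + 1) * (n - k))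
        (zeroDivisor (fun z => (A i).form (Fbar z)) z) : ℕ)) * (log r - log ‖z‖) =
      n.choose k * ∑ z ∈ F, zeroDivisor (wronskian G) z * (log r - log ‖z‖) +
      θ * ∑ i, ∑ z ∈ F, (min ((k + 1) * (n - k))
      (zeroDivisor (fun z => (A i).form (Fbar z)) z) : ℕ) * (log r - log ‖z‖) := by
    simp only [add_mul, Finset.sum_add_distrib, Nat.cast_sum]
    congr 1
    · rw [Finset.mul_sum]
      simp only [mul_assoc]
    · rw [Finset.sum_comm, Finset.mul_sum]
      refine Finset.sum_congr rfl fun z _ => ?_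
      rw [mul_assoc, Finset.sum_mul]
  have hθ : θ * ∑ i, ∑ z ∈ F, (min ((k + 1) * (n - k))
      (zeroDivisor (fun z => (A i).form (Fbar z)) z) : ℕ) * (log r - log ‖z‖) ≤
      θ * (∑ i, (A i).counting ((k + 1) * (n - k)) Fbar r + ∑ i, cN i) := by
    rcases isEmpty_or_nonempty ι with hι | ⟨⟨i₀⟩⟩
    · simp
    · exact mul_le_mul_of_nonneg_left hNi ((hω0 i₀).1.trans (hω0 i₀).2)
  rw [e1, e2] at hlocal
  simp only [mul_add, Finset.sum_add_distrib] at hθ ⊢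
  linarith

end IsDerivedLift

end DerivedCurves

end

noncomputable section

namespace DerivedCurves

open Real Filter MeasureTheory Set Topology Metric ValueDistribution

theorem circleAverage_const_mul (c : ℝ) (f : ℂ → ℝ) (r : ℝ) :
    circleAverage (fun z => c * f z) 0 r = c * circleAverage f 0 r := by
  simpa only [smul_eq_mul] using circleAverage_fun_smul (a := c) (f := f) (c := 0) (R := r)

namespace IsDerivedLift

variable {n k : ℕ} {G : ℂ → Fin (n + 1) → ℂ} {g : ℂ → ℂ}
  {Fbar : ℂ → ⋀[ℂ]^(k + 1) (Fin (n + 1) → ℂ)} (hL : IsDerivedLift k G g Fbar)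

include hL

variable {ι : Type*} [Fintype ι] [DecidableEq ι] {A : ι → DecomposableHyperplane n k}
  {ω : ι → ℝ} {θ : ℝ} (hω0 : ∀ i, 0 ≤ ω i ∧ ω i ≤ θ)
  (hω : ∀ R, formRank (fun i => (A i).form) R < (n + 1).choose (k + 1) →
    ∑ i ∈ R, ω i ≤ formRank (fun i => (A i).form) R)
  (htop : formRank (fun i => (A i).form) Finset.univ = (n + 1).choose (k + 1))
  (hk : k < n) {𝔤 : Gauge} (h𝔤 : 𝔤.T = orderFunction (pluckerBasis n k) Fbar)

include hω0 hω htop hk h𝔤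

theorem weighted_proximity_le (A₀ : DecomposableHyperplane n k) :
    ∃ P : ℝ → ℝ, 𝔤.Small P ∧ ∃ c : ℝ, ∀ r ≥ 1, 0 ≤ P r ∧
      ∑ i, ω i * (orderFunction (pluckerBasis n k) Fbar r -
          circleAverage (fun z => log ‖(A i).form (Fbar z)‖) 0 r) ≤
        (n + 1).choose (k + 1) * orderFunction (pluckerBasis n k) Fbar r -
          n.choose k * circleAverage (fun z => log ‖wronskian G z‖) 0 r +
          (n + 1).choose (k + 1) * circleAverage (fun z => log ‖g z‖) 0 r + (P r + c) := by
  classical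
  have := finiteDimensional_exteriorPower n k
  have hd := finrank_exteriorPower n k
  rw [← hd] at hω htop
  have hmod := moderate_ratio (pluckerBasis n k) hL.holomorphic hL.ne_zero h𝔤
  let K := {κ : PluckerIndex n k → ι // LinearIndependent ℂ fun t => (A (κ t)).form}
  have : Fintype K := Fintype.ofFinite K
  choose ρ hρ hρe using fun κ : K => hL.exists_slow_wronskian_pow_eq hk hmod κ.2
  obtain ⟨c, hc⟩ := exists_basis_log_sum_le (pluckerBasis n k) hω0 hω htop
  refine ⟨∑ κ, proximity (ρ κ) ⊤, 𝔤.small_sum _ fun κ _ => (hρ κ).small, c, fun r hr => ?_⟩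
  have hP : (∑ κ, proximity (ρ κ) ⊤) r = ∑ κ, circleAverage (fun z => log⁺ ‖ρ κ z‖) 0 r := by
    rw [Finset.sum_apply]
    rfl
  refine ⟨?_, ?_⟩
  · rw [Finset.sum_apply]
    exact Finset.sum_nonneg fun κ _ => proximity_nonneg (f := ρ κ) (a := ⊤) r
  rw [hP]
  set lF : ℂ → ℝ := fun z => log (maxNorm (pluckerBasis n k) (Fbar z)) with hlF
  have hiF : CircleIntegrable lF 0 r :=
    circleIntegrable_log_maxNorm (pluckerBasis n k) hL.holomorphic hL.ne_zero r
  have hiA : ∀ i, CircleIntegrable (fun z => log ‖(A i).form (Fbar z)‖) 0 r := fun i =>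
    circleIntegrable_log_norm_dual hL.holomorphic (A i).form r
  have hiW : CircleIntegrable (fun z => log ‖wronskian G z‖) 0 r :=
    MeromorphicOn.circleIntegrable_log_norm fun z _ =>
      (hL.differentiable_wronskian.analyticAt z).meromorphicAt
  have hig : CircleIntegrable (fun z => log ‖g z‖) 0 r :=
    MeromorphicOn.circleIntegrable_log_norm fun z _ =>
      (hL.differentiable_factor.analyticAt z).meromorphicAt
  have hiρ : ∀ κ, CircleIntegrable (fun z => log⁺ ‖ρ κ z‖) 0 r := fun κ =>
    MeromorphicOn.circleIntegrable_posLog_norm fun z _ => (hρ κ).moderate.meromorphic z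
  have hmul : ∀ {f : ℂ → ℝ} (a : ℝ), CircleIntegrable f 0 r →
      CircleIntegrable (fun z => a * f z) 0 r := fun a hf => hf.const_mul a
  have hiL : ∀ i ∈ (Finset.univ : Finset ι),
      CircleIntegrable (fun z => ω i * (lF z - log ‖(A i).form (Fbar z)‖)) 0 r := fun i _ =>
    hmul _ (hiF.sub (hiA i))
  have hiP : CircleIntegrable (fun z => ∑ κ, log⁺ ‖ρ κ z‖) 0 r :=
    CircleIntegrable.fun_sum _ fun κ _ => hiρ κ
  have hic : CircleIntegrable (fun _ : ℂ => c) 0 r := circleIntegrable_const _ _ _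
  have hi1 : CircleIntegrable (fun z => (n + 1).choose (k + 1) * lF z -
      n.choose k * log ‖wronskian G z‖) 0 r := (hmul _ hiF).sub (hmul _ hiW)
  have hi2 : CircleIntegrable (fun z => (n + 1).choose (k + 1) * lF z -
      n.choose k * log ‖wronskian G z‖ + (n + 1).choose (k + 1) * log ‖g z‖) 0 r :=
    hi1.add (hmul _ hig)
  have hi3 : CircleIntegrable (fun z => ∑ κ, log⁺ ‖ρ κ z‖ + c) 0 r := hiP.add hic
  have key : circleAverage (fun z => ∑ i, ω i * (lF z - log ‖(A i).form (Fbar z)‖)) 0 r ≤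
      circleAverage (fun z => (n + 1).choose (k + 1) * lF z - n.choose k * log ‖wronskian G z‖ +
        (n + 1).choose (k + 1) * log ‖g z‖ + (∑ κ, log⁺ ‖ρ κ z‖ + c)) 0 r := by
    refine circleAverage_mono_of_codiscrete (by linarith) (CircleIntegrable.fun_sum _ hiL)
      (hi2.add hi3) ?_
    refine Filter.Eventually.filter_mono (Filter.codiscreteWithin_mono (subset_univ _)) ?_
    filter_upwards [eventually_all.2 fun i => hL.eventually_form_ne_zero (A i),
      eventually_ne_zero_of_exists hL.differentiable_wronskian hL.exists_wronskian_ne_zero,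
      eventually_ne_zero_of_exists hL.differentiable_factor (hL.exists_factor_ne_zero A₀),
      eventually_all.2 hρe] with z h1 h2 h3 h4
    obtain ⟨B, hB, hBc, hsum⟩ := hc (Fbar z) (hL.ne_zero z) h1
    obtain ⟨κ, hκ, hκB⟩ := exists_enumeration (τ := PluckerIndex n k) (B := B)
      (by rw [hB, hd, card_pluckerIndex]) (by rw [hBc, hd, card_pluckerIndex])
    rw [hκB, Finset.sum_sub_distrib, Finset.sum_const, Finset.card_univ, card_pluckerIndex,
      nsmul_eq_mul] at hsum
    have h5 := h4 ⟨κ, hκ⟩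
    have h6 : ρ ⟨κ, hκ⟩ z ≠ 0 := by
      intro h0
      rw [h0, zero_mul] at h5
      exact pow_ne_zero _ h2 h5
    have h7 := congrArg (fun w : ℂ => log ‖w‖) h5
    simp only [norm_pow, norm_mul, norm_prod, log_pow] at h7
    have hprod : ∏ t, ‖(A (κ t)).form (Fbar z)‖ ≠ 0 :=
      Finset.prod_ne_zero_iff.2 fun t _ => norm_ne_zero_iff.2 (h1 _)
    rw [log_mul (norm_ne_zero_iff.2 h6) (mul_ne_zero (pow_ne_zero _ (norm_ne_zero_iff.2 h3)) hprod),
      log_mul (pow_ne_zero _ (norm_ne_zero_iff.2 h3)) hprod, log_pow,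
      log_prod fun t _ => norm_ne_zero_iff.2 (h1 _)] at h7
    have h8 : log ‖ρ ⟨κ, hκ⟩ z‖ ≤ log⁺ ‖ρ ⟨κ, hκ⟩ z‖ := le_max_right _ _
    have h9 : log⁺ ‖ρ ⟨κ, hκ⟩ z‖ ≤ ∑ κ, log⁺ ‖ρ κ z‖ :=
      Finset.single_le_sum (f := fun κ => log⁺ ‖ρ κ z‖) (fun κ _ => posLog_nonneg)
        (Finset.mem_univ _)
    simp only [hlF]
    linarith
  rw [circleAverage_fun_sum hiL, circleAverage_fun_add hi2 hi3,
    circleAverage_fun_add hi1 (hmul _ hig), circleAverage_fun_sub (hmul _ hiF) (hmul _ hiW),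
    circleAverage_fun_add hiP hic, circleAverage_fun_sum fun κ _ => hiρ κ, circleAverage_const,
    circleAverage_const_mul, circleAverage_const_mul, circleAverage_const_mul] at key
  simp only [circleAverage_const_mul, fun i => circleAverage_fun_sub hiF (hiA i)] at key
  exact key

end IsDerivedLift

/-- The second main theorem, relative to a gauge. -/
theorem IsDerivedLift.small_defect {n k : ℕ} {G : ℂ → Fin (n + 1) → ℂ} {g : ℂ → ℂ}
    {Fbar : ℂ → ⋀[ℂ]^(k + 1) (Fin (n + 1) → ℂ)} (hL : IsDerivedLift k G g Fbar)
    (hk : k < n) {𝔤 : Gauge} (h𝔤 : 𝔤.T = orderFunction (pluckerBasis n k) Fbar) {q N : ℕ}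
    (hN : (n + 1).choose (k + 1) ≤ N) (hqN : N ≤ q) (A : Fin q → DecomposableHyperplane n k)
    (hA : ∀ s : Finset (Fin q), s.card = N → ⋂ i ∈ s, (A i).carrier = ∅) :
    𝔤.Small fun r => ((q : ℝ) - 2 * N + (n + 1).choose (k + 1)) *
      orderFunction (pluckerBasis n k) Fbar r -
        ∑ i, (A i).counting ((k + 1) * (n - k)) Fbar r := by
  have := finiteDimensional_exteriorPower n k
  have hd := finrank_exteriorPower n k
  have hrank : ∀ R : Finset (Fin q), N ≤ R.card →
      formRank (fun i => (A i).form) R = (n + 1).choose (k + 1) := fun R hR => by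
    rw [← hd]
    exact formRank_eq_of_iInter_eq_empty hA hR
  have hd0 : 0 < (n + 1).choose (k + 1) := Nat.choose_pos (by omega)
  obtain ⟨ω, θ, hθ, hω0, hωsum, hω⟩ :=
    (isRankFunction_formRank fun i => (A i).form).exists_weights hd0 hN hrank (by simpa using hqN)
  have htop := hrank Finset.univ (by simpa using hqN)
  have A₀ : DecomposableHyperplane n k := A ⟨0, by omega⟩
  obtain ⟨P, hP, c₁, hc₁⟩ := hL.weighted_proximity_le hω0 hω htop hk h𝔤 A₀
  obtain ⟨c₂, hc₂⟩ := hL.weighted_counting_le hω0 hω htop hk.le A₀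
  obtain ⟨M, hM⟩ := exists_nat_ge θ⁻¹
  have hsmall : 𝔤.Small (∑ _j ∈ Finset.range M, (P + fun _ => |c₁ + c₂|)) :=
    𝔤.small_sum _ fun _ _ => 𝔤.small_add hP (𝔤.small_const _)
  refine 𝔤.small_mono hsmall ?_
  filter_upwards [Gauge.eventually_ge 1] with r hr
  obtain ⟨hP0, h1⟩ := hc₁ r hr
  have h2 := hc₂ r hr
  simp only [mul_sub, Finset.sum_sub_distrib] at h1
  rw [← Finset.sum_mul, hωsum, Fintype.card_fin] at h1
  set D := ((q : ℝ) - 2 * N + (n + 1).choose (k + 1)) * orderFunction (pluckerBasis n k) Fbar r -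
        ∑ i, (A i).counting ((k + 1) * (n - k)) Fbar r with hD
  have h3 : θ * D ≤ P r + |c₁ + c₂| := by
    have := le_abs_self (c₁ + c₂)
    rw [hD]
    linarith
  have h4 : D ≤ θ⁻¹ * (P r + |c₁ + c₂|) := by
    rw [inv_mul_eq_div, le_div_iff₀ hθ]
    linarith
  simp only [Finset.sum_const, Finset.card_range, Pi.smul_apply, Pi.add_apply, nsmul_eq_mul]
  exact h4.trans (mul_le_mul_of_nonneg_right hM (by positivity))

/-! ### The error term -/

section ErrorTerm

variable {V : Type*} [AddCommGroup V] [Module ℂ V]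

theorem isErrorTerm_of_bounded {F : ℂ → ℙ ℂ V} {T S : ℝ → ℝ} {M : ℝ}
    (hS : ∀ r, 1 < r → |S r| ≤ M) : IsErrorTerm F T S := by
  refine ⟨⟨0, fun ε hε => ⟨Icc 0 (max 1 (exp (M / ε))), by simp, fun r hr hrE => ?_⟩⟩,
    fun _ => ⟨M, hS⟩⟩
  have h1 : max 1 (exp (M / ε)) < r := by
    by_contra hcon
    exact hrE ⟨hr.le, not_lt.1 hcon⟩
  have h2 : M / ε ≤ log r := by
    rw [← log_exp (M / ε)]
    exact log_le_log (exp_pos _) ((le_max_right _ _).trans h1.le)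
  rw [div_le_iff₀ hε] at h2
  have h3 := (le_abs_self _).trans (hS r ((le_max_left _ _).trans_lt h1))
  linarith

theorem isErrorTerm_posPart {F : ℂ → ℙ ℂ V} {T D : ℝ → ℝ} (hT : Continuous T)
    (hlog : ∃ c, ∀ᶠ r in atTop, log r - c ≤ T r) {a : ℝ} (hD : ∀ r, 1 < r → D r ≤ a * T r)
    (hsmall : ∀ 𝔤 : Gauge, 𝔤.T = T → 𝔤.Small D)
    (hrat : IsRationalCurve F → ∃ A, ∀ᶠ r in atTop, T r ≤ A * log r) :
    IsErrorTerm F T fun r => max 0 (D r) := by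
  refine ⟨?_, fun hF => ?_⟩
  · obtain ⟨C, hC⟩ := hsmall (nevanlinnaGauge T hlog) rfl
    refine ⟨|C|, fun ε hε => ?_⟩
    have h1 := ((hC ε hε).and (cofiniteMeasure_le_atTop (log_ge_of_eventually_le hlog 1))).and
      (cofiniteMeasure_le_atTop (eventually_ge_atTop 1))
    refine ⟨_, mem_cofiniteMeasure.1 h1, fun r hr hrE => ?_⟩
    have h2 : (D r ≤ C * log (T r) + ε * log r ∧ 1 ≤ T r) ∧ 1 ≤ r := by
      by_contra hcon
      exact hrE ⟨hcon, hr⟩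
    have h3 : 0 ≤ log (T r) := log_nonneg h2.1.2
    have h4 : 0 ≤ log r := log_nonneg h2.2
    have h5 := mul_le_mul_of_nonneg_right (le_abs_self C) h3
    refine max_le (by positivity) (h2.1.1.trans (by linarith))
  · obtain ⟨C, hC⟩ := hsmall (logarithmicGauge T hlog (hrat hF)) rfl
    obtain ⟨R, hR⟩ := eventually_atTop.1 hC
    obtain ⟨M, hM⟩ := (isCompact_Icc (a := (1 : ℝ)) (b := R)).bddAbove_image
      (f := fun r => a * T r) (by fun_prop)
    refine ⟨max 0 (max C M), fun r hr => ?_⟩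
    rw [abs_of_nonneg (le_max_left _ _)]
    refine max_le_max le_rfl ?_
    rcases le_total R r with h | h
    · exact (hR r h).trans (le_max_left _ _)
    · exact (hD r hr).trans ((hM (mem_image_of_mem _ ⟨hr.le, h⟩)).trans (le_max_right _ _))

end ErrorTerm

theorem orderFunction_eq_const {V ι : Type*} [AddCommGroup V] [Module ℂ V] [Unique ι]
    (b : Module.Basis ι ℂ V) {G : ℂ → V}
    (hG : ∀ φ : Module.Dual ℂ V, Differentiable ℂ fun z => φ (G z))
    (hG0 : ∀ z, G z ≠ 0) (r : ℝ) : orderFunction b G r = log ‖b.coord default (G 0)‖ := by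
  have h0 : ∀ z, b.coord default (G z) ≠ 0 := by
    intro z hz
    refine hG0 z (b.ext_elem fun i => ?_)
    rw [Unique.eq_default i, map_zero]
    exact hz
  rw [← circleAverage_log_norm_unit (hG (b.coord default)) h0 r, orderFunction]
  congr 1
  ext z
  rw [maxNorm, ciSup_unique]
  rfl

end DerivedCurves

end

theorem mainTheorem1 (n k : ℕ) (hk : k ≤ n)
    (f : ℂ → ℙ ℂ (Fin (n + 1) → ℂ)) (hf : DerivedCurves.IsEntireCurve f)
    (hnd : DerivedCurves.IsLinearlyNondegenerate f)
    (F : ℂ → ℙ ℂ (⋀[ℂ]^(k + 1) (Fin (n + 1) → ℂ))) (hF : DerivedCurves.IsDerivedCurve k f F)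
    (Fbar : ℂ → ⋀[ℂ]^(k + 1) (Fin (n + 1) → ℂ))
    (hFbar : DerivedCurves.IsReducedRepresentation F Fbar)
    (q N : ℕ) (hN : (n + 1).choose (k + 1) ≤ N)
    (A : Fin q → DerivedCurves.DecomposableHyperplane n k)
    (hA : ∀ s : Finset (Fin q), s.card = N → ⋂ i ∈ s, (A i).carrier = ∅) :
    ∃ S : ℝ → ℝ,
      DerivedCurves.IsErrorTerm F
        (DerivedCurves.orderFunction (DerivedCurves.pluckerBasis n k) Fbar) S ∧
      ∀ r : ℝ, 1 < r →
        ((q : ℝ) - 2 * (N : ℝ) + ((n + 1).choose (k + 1) : ℝ)) *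
            DerivedCurves.orderFunction (DerivedCurves.pluckerBasis n k) Fbar r
          ≤ ∑ i, (A i).counting ((k + 1) * (n - k)) Fbar r + S r := by
  open DerivedCurves in
  obtain ⟨G, g, hL⟩ := hF.exists_isDerivedLift hnd hFbar
  set T := orderFunction (pluckerBasis n k) Fbar with hT
  set a : ℝ := (q : ℝ) - 2 * (N : ℝ) + ((n + 1).choose (k + 1) : ℝ) with ha
  set D : ℝ → ℝ := fun r => a * T r - ∑ i, (A i).counting ((k + 1) * (n - k)) Fbar r with hD
  have hcount : ∀ r, 1 < r → 0 ≤ ∑ i, (A i).counting ((k + 1) * (n - k)) Fbar r := fun r hr =>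
    Finset.sum_nonneg fun i _ => truncatedCounting_nonneg _ _ hr.le
  have hDT : ∀ r, 1 < r → D r ≤ a * T r := fun r hr => by
    have := hcount r hr
    simp only [hD]
    linarith
  suffices h : IsErrorTerm F T fun r => max 0 (D r) by
    refine ⟨_, h, fun r _ => ?_⟩
    have := le_max_right 0 (D r)
    simp only [hD] at this ⊢
    linarith
  have hbdd : (∃ M, ∀ r, 1 < r → a * T r ≤ M) → IsErrorTerm F T fun r => max 0 (D r) := by
    rintro ⟨M, hM⟩
    refine isErrorTerm_of_bounded (M := max 0 M) fun r hr => ?_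
    rw [abs_of_nonneg (le_max_left _ _)]
    exact max_le_max le_rfl ((hDT r hr).trans (hM r hr))
  rcases hk.eq_or_lt with rfl | hk'
  · have : Unique (PluckerIndex k k) :=
      (Fintype.card_eq_one_iff_nonempty_unique.1 (by rw [card_pluckerIndex, Nat.choose_self])).some
    have hconst := orderFunction_eq_const (pluckerBasis k k) hL.holomorphic hL.ne_zero
    exact hbdd ⟨a * T 1, fun r _ => by rw [hT, hconst r, hconst 1]⟩
  rcases le_or_gt a 0 with ha0 | ha0
  · obtain ⟨c, hc⟩ := exists_le_orderFunction (pluckerBasis n k) hL.holomorphic hL.ne_zero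
    exact hbdd ⟨a * c, fun r hr => mul_le_mul_of_nonpos_left (hc r hr.le) ha0⟩
  have hqN : N ≤ q := by
    have h1 : ((n + 1).choose (k + 1) : ℝ) ≤ N := by exact_mod_cast hN
    have h2 : (N : ℝ) ≤ q := by linarith
    exact_mod_cast h2
  exact isErrorTerm_posPart
    (continuous_orderFunction (pluckerBasis n k) hL.holomorphic hL.ne_zero)
    (hL.exists_log_le_orderFunction hk' (pluckerBasis n k)) hDT
    (fun 𝔤 h𝔤 => hL.small_defect hk' h𝔤 hN hqN A hA)
    fun hrat => exists_orderFunction_le_log (pluckerBasis n k) hFbar hrat
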